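/- A bond percolation model on a graph $G$ is a probability distribution on the spanning subgraphs of $G$; an edge is called open if it is present in the random subgraph, and closed otherwise. The model is 1-independent if, for any two sets $S_1$, $S_2$ of edges of $G$ such that no edge in $S_1$ shares a vertex with an edge in $S_2$, the states (open or closed) of the edges in $S_1$ are independent of the states of the edges in $S_2$. The model percolates if, with positive probability, the random subgraph has an infinite connected component. Let $p_{\max}(G)$ be the supremum of those $p\in[0,1]$ for which there is a 1-independent bond percolation model on $G$ in which each edge is open with probability at least $p$ but which does not percolate. Let $\mathbb{Z}^n$ denote the lattice graph, in which two points are adjacent when their $\ell^1$-distance is $1$. **Theorem.** The limit $\lim_{n\to\infty}p_{\max}(\mathbb{Z}^n)$ exists and satisfies $$\lim_{n\to\infty}p_{\max}(\mathbb{Z}^n)\le 0.5847 .$$ -/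

import Mathlib

open MeasureTheory ProbabilityTheory Filter Topology

namespace BondPercolation

variable {V : Type*}

/-- A configuration assigns to each edge of `G` a state: `true` is open, `false` is closed.
Configurations correspond to the spanning subgraphs of `G`. They carry the product σ-algebra. -/
abbrev Config (G : SimpleGraph V) : Type _ := G.edgeSet → Bool

/-- The spanning subgraph of `G` whose edges are the open edges of `ω`. -/
def openGraph {G : SimpleGraph V} (ω : Config G) : SimpleGraph V :=
  SimpleGraph.fromEdgeSet {e | ∃ h : e ∈ G.edgeSet, ω ⟨e, h⟩ = true}

/-- No edge in `S` shares a vertex with an edge in `T`. -/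
def VertexDisjoint {G : SimpleGraph V} (S T : Set G.edgeSet) : Prop :=
  ∀ e ∈ S, ∀ f ∈ T, ∀ v : V, v ∈ (e : Sym2 V) → v ∉ (f : Sym2 V)

/-- 1-independence: the states of the edges in `S` are independent of the states of the edges
in `T` whenever `S` and `T` are vertex-disjoint sets of edges (finite or infinite). -/
def OneIndependent {G : SimpleGraph V} (μ : Measure (Config G)) : Prop :=
  ∀ S T : Set G.edgeSet, VertexDisjoint S T →
    IndepFun (fun (ω : Config G) (e : S) => ω e) (fun (ω : Config G) (f : T) => ω f) μ

/-- The class of 1-independent bond percolation models on `G` in which each edge is open with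
probability at least `p`. -/
def modelsGE (G : SimpleGraph V) (p : ℝ) : Set (Measure (Config G)) :=
  {μ | IsProbabilityMeasure μ ∧ OneIndependent μ ∧
    ∀ e : G.edgeSet, p ≤ μ.real {ω | ω e = true}}

/-- The model percolates: the random subgraph has an infinite component with positive
probability. -/
def Percolates {G : SimpleGraph V} (μ : Measure (Config G)) : Prop :=
  0 < μ {ω | ∃ C : (openGraph ω).ConnectedComponent, C.supp.Infinite}

/-- The supremum of those `p ∈ [0, 1]` for which some 1-independent bond percolation model on `G`
with all edge probabilities at least `p` does not percolate. -/
noncomputable def pmax (G : SimpleGraph V) : ℝ :=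
  sSup {p : ℝ | 0 ≤ p ∧ p ≤ 1 ∧ ∃ μ ∈ modelsGE G p, ¬ Percolates μ}

/-- The lattice graph `ℤⁿ`: two points are adjacent when they are at `ℓ¹`-distance one. -/
def latticeGraph (n : ℕ) : SimpleGraph (Fin n → ℤ) where
  Adj x y := ∑ i, |x i - y i| = 1
  symm := ⟨fun x y h => by simpa only [abs_sub_comm] using h⟩
  loopless := ⟨fun x h => by simp at h⟩

end BondPercolation

/-! Restricting a 1-independent model to a subgraph keeps it 1-independent and cannot create
percolation. Hence p_max(ℤⁿ) is non-increasing in n, its limit is its infimum, and it suffices to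
exhibit one subgraph of some ℤ^d on which density 0.5847 forces percolation
(`exists_bigGraph_percolates`). That subgraph is `bigGraph`: the square grid times a high power of
the star K_{1,N}. A vertex is a grid site together with a list of slots, each holding one of N
labels or nothing.

Fix a grid site and labels, and empty a slot s; this vertex is the centre of row s. Its spokes empty
one more slot t. If two spokes are open, their far ends are usually also joined without using the
centre: as the two labels concerned vary, the exceptional pairs form a bipartite graph all of whose
edges are bridges, so they number at most 2N out of N² (`card_clashAt_le`). The open spokes, of mean
density at least 0.5847, therefore nearly always lie in one component of the far ends. A moment
bound and a second moment estimate show that the far ends alone, with the centre deleted, contain a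
component of density above 1/2 (`Star.real_dense_empty_le`). Majority components of different blocks
of spokes fit together (`Coherent`), except with probability of high polynomial order.

For a spoke t let a be the probability that its far end lies in the main component of a block, and b
the probability that the centre has an open spoke into the main component of a sibling block. These
events use disjoint vertex sets, hence are independent. An increment argument over a hierarchy of
blocks finds a level at which, for most t, an open spoke forces the two events to agree up to a
small error. So 0.5847 ≤ ab + (1-a)(1-b) + error, that is, (2a-1)(2b-1) is at least about
2·0.5847-1, and a, b > 1/2. Such spokes are called `Regular`.

Rows s and t of one base point share the vertex with both slots emptied. If each is regular for the
other, their main components meet there with positive probability; many link rows give many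
independent attempts, so almost surely all fair rows of a base point are joined. Two adjacent base
points, with parameters (a,b) and (a',b'), are joined through an edge between far ends or between
centres: `product_bound` shows that aa' or bb' exceeds 1-0.5847, and again there are many
independent attempts (`Base.real_not_baseJoin_le`).

Finally, each grid site u receives labels from which most other labels are reached by changing one
slot at a time through base points where clashes are rare. Neighbouring sites u, v can meet at
common labels, so their main components are joined with probability at least 1-1/1296. This is a
1-independent model on the square grid, and a 3×3 block renormalization shows that it percolates
(`grid_percolates`). -/

namespace BondPercolation

/-! ### Events determined by the edges inside a vertex set -/

/-- `E` depends only on the states of the edges with both ends in `S`. -/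
def DetBy {V : Type*} {G : SimpleGraph V} (S : Set V) (E : Set (Config G)) : Prop :=
  ∀ ω ω' : Config G,
    (∀ e : G.edgeSet, (∀ v ∈ (e : Sym2 V), v ∈ S) → ω e = ω' e) → ω ∈ E → ω' ∈ E

section DetBy

variable {V : Type*} {G : SimpleGraph V} {S S' : Set V} {E E' : Set (Config G)}

theorem DetBy.mono (h : DetBy S E) (hS : S ⊆ S') : DetBy S' E :=
  fun ω ω' hω => h ω ω' fun e he => hω e fun v hv => hS (he v hv)

theorem DetBy.iff (h : DetBy S E) {ω ω' : Config G}
    (hω : ∀ e : G.edgeSet, (∀ v ∈ (e : Sym2 V), v ∈ S) → ω e = ω' e) : ω ∈ E ↔ ω' ∈ E :=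
  ⟨h ω ω' hω, h ω' ω fun e he => (hω e he).symm⟩

theorem DetBy.compl (h : DetBy S E) : DetBy S Eᶜ :=
  fun ω ω' hω hE hE' => hE (h ω' ω (fun e he => (hω e he).symm) hE')

theorem DetBy.inter (h : DetBy S E) (h' : DetBy S E') : DetBy S (E ∩ E') :=
  fun ω ω' hω hE => ⟨h ω ω' hω hE.1, h' ω ω' hω hE.2⟩

theorem DetBy.iUnion {ι : Sort*} {E : ι → Set (Config G)} (h : ∀ i, DetBy S (E i)) :
    DetBy S (⋃ i, E i) := fun ω ω' hω hE => by
  obtain ⟨i, hi⟩ := Set.mem_iUnion.1 hE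
  exact Set.mem_iUnion.2 ⟨i, h i ω ω' hω hi⟩

theorem DetBy.iInter {ι : Sort*} {E : ι → Set (Config G)} (h : ∀ i, DetBy S (E i)) :
    DetBy S (⋂ i, E i) := fun ω ω' hω hE =>
  Set.mem_iInter.2 fun i => h i ω ω' hω (Set.mem_iInter.1 hE i)

theorem detBy_of_eq {α : Type*} (f : Config G → α)
    (h : ∀ ω ω' : Config G, (∀ e : G.edgeSet, (∀ v ∈ (e : Sym2 V), v ∈ S) → ω e = ω' e) →
      f ω = f ω') (P : α → Prop) : DetBy S {ω | P (f ω)} :=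
  fun ω ω' hω hP => by
    have := h ω ω' hω
    simpa only [Set.mem_ofPred_eq, ← this] using hP

theorem finite_edges_inside (hS : S.Finite) :
    {e : G.edgeSet | ∀ v ∈ (e : Sym2 V), v ∈ S}.Finite := by
  refine Set.Finite.of_finite_image
    (Set.Finite.subset ((hS.prod hS).image fun q : V × V => s(q.1, q.2)) ?_)
    Subtype.val_injective.injOn
  rintro _ ⟨⟨e, he⟩, h, rfl⟩
  induction e using Sym2.ind with
  | _ a b => exact ⟨(a, b), ⟨h a (by simp), h b (by simp)⟩, rfl⟩

/-- Extension of a partial configuration by closed edges. -/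
noncomputable def extendClosed (F : Set G.edgeSet) (η : F → Bool) : Config G :=
  open Classical in fun e => if h : e ∈ F then η ⟨e, h⟩ else false

theorem measurable_extendClosed (F : Set G.edgeSet) : Measurable (extendClosed F) := by
  refine measurable_pi_lambda _ fun e => ?_
  by_cases h : e ∈ F
  · simpa [extendClosed, h] using measurable_pi_apply (⟨e, h⟩ : F)
  · simp [extendClosed, h]

theorem extendClosed_restrict (F : Set G.edgeSet) (ω : Config G) (e : G.edgeSet) (he : e ∈ F) :
    extendClosed F (fun f : F => ω f) e = ω e := by
  simp [extendClosed, he]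

/-- Edges not inside S may be declared closed without affecting E. This factors E through the
restriction to the edges inside S, the form in which 1-independence and measurability on a finite
product can be applied. -/
theorem DetBy.eq_preimage (h : DetBy S E) :
    E = (fun (ω : Config G) (e : {e : G.edgeSet | ∀ v ∈ (e : Sym2 V), v ∈ S}) => ω e) ⁻¹'
      (extendClosed _ ⁻¹' E) := by
  ext ω
  refine h.iff fun e he => ?_
  exact (extendClosed_restrict {e : G.edgeSet | ∀ v ∈ (e : Sym2 V), v ∈ S} ω e he).symm

theorem measurable_restrict (F : Set G.edgeSet) :
    Measurable (fun (ω : Config G) (e : F) => ω e) :=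
  measurable_pi_lambda _ fun e => measurable_pi_apply (e : G.edgeSet)

theorem DetBy.measurableSet (h : DetBy S E) (hS : S.Finite) : MeasurableSet E := by
  rw [h.eq_preimage]
  have : Finite {e : G.edgeSet | ∀ v ∈ (e : Sym2 V), v ∈ S} := (finite_edges_inside hS).to_subtype
  exact measurable_restrict _ (Set.toFinite _).measurableSet

variable {μ : Measure (Config G)}

theorem vertexDisjoint_inside (h : Disjoint S S') :
    VertexDisjoint {e : G.edgeSet | ∀ v ∈ (e : Sym2 V), v ∈ S}
      {e : G.edgeSet | ∀ v ∈ (e : Sym2 V), v ∈ S'} :=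
  fun _ he _ hf v hv hv' => Set.disjoint_left.1 h (he v hv) (hf v hv')

/-- Edges inside disjoint vertex sets share no vertex. Independence of individual events is always
obtained through this lemma, so the later work consists in exhibiting disjoint vertex sets. -/
theorem DetBy.real_inter (h1 : OneIndependent μ) (h : DetBy S E) (h' : DetBy S' E')
    (hS : S.Finite) (hS' : S'.Finite) (hd : Disjoint S S') :
    μ.real (E ∩ E') = μ.real E * μ.real E' := by
  have hi := h1 _ _ (vertexDisjoint_inside (G := G) hd)
  have : Finite {e : G.edgeSet | ∀ v ∈ (e : Sym2 V), v ∈ S} := (finite_edges_inside hS).to_subtype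
  have : Finite {e : G.edgeSet | ∀ v ∈ (e : Sym2 V), v ∈ S'} :=
    (finite_edges_inside hS').to_subtype
  have := hi.measure_inter_preimage_eq_mul (extendClosed _ ⁻¹' E) (extendClosed _ ⁻¹' E')
    (Set.toFinite _).measurableSet (Set.toFinite _).measurableSet
  rw [← h.eq_preimage, ← h'.eq_preimage] at this
  simp [measureReal_def, this]

theorem DetBy.real_biInter [IsProbabilityMeasure μ] (h1 : OneIndependent μ) {ι : Type*}
    (I : Finset ι) (R : ι → Set V) (E : ι → Set (Config G)) (hE : ∀ i ∈ I, DetBy (R i) (E i))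
    (hR : ∀ i ∈ I, (R i).Finite) (hd : ∀ i ∈ I, ∀ j ∈ I, i ≠ j → Disjoint (R i) (R j)) :
    μ.real (⋂ i ∈ I, E i) = ∏ i ∈ I, μ.real (E i) := by
  classical
  induction I using Finset.induction_on with
  | empty => simp
  | insert a I ha ih =>
    rw [Finset.prod_insert ha, ← ih (fun i hi => hE i (Finset.mem_insert_of_mem hi))
      (fun i hi => hR i (Finset.mem_insert_of_mem hi))
      (fun i hi j hj => hd i (Finset.mem_insert_of_mem hi) j (Finset.mem_insert_of_mem hj)),
      Finset.set_biInter_insert]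
    refine DetBy.real_inter (S' := ⋃ i ∈ I, R i) h1 (hE a (Finset.mem_insert_self a I)) ?_
      (hR a (Finset.mem_insert_self a I)) ?_ ?_
    · refine DetBy.iInter fun i => DetBy.iInter fun hi => ?_
      exact (hE i (Finset.mem_insert_of_mem hi)).mono (Set.subset_biUnion_of_mem (u := R) hi)
    · exact I.finite_toSet.biUnion fun i hi => hR i (Finset.mem_insert_of_mem hi)
    · rw [Set.disjoint_iUnion₂_right]
      intro i hi
      exact hd a (Finset.mem_insert_self a I) i (Finset.mem_insert_of_mem hi)
        fun h => ha (h ▸ hi)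

theorem real_compl_eq [IsProbabilityMeasure μ] (h : DetBy S E) (hS : S.Finite) :
    μ.real Eᶜ = 1 - μ.real E := by
  rw [measureReal_compl (h.measurableSet hS), probReal_univ]

/-- If independent events have probability at least `c`, the chance that all fail is small. -/
theorem DetBy.real_forall_not_le [IsProbabilityMeasure μ] (h1 : OneIndependent μ) {ι : Type*}
    (I : Finset ι) (R : ι → Set V) (E : ι → Set (Config G)) (hE : ∀ i ∈ I, DetBy (R i) (E i))
    (hR : ∀ i ∈ I, (R i).Finite) (hd : ∀ i ∈ I, ∀ j ∈ I, i ≠ j → Disjoint (R i) (R j))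
    {c : ℝ} (hc : ∀ i ∈ I, c ≤ μ.real (E i)) :
    μ.real {ω | ∀ i ∈ I, ω ∉ E i} ≤ (1 - c) ^ I.card := by
  have : {ω | ∀ i ∈ I, ω ∉ E i} = ⋂ i ∈ I, (E i)ᶜ := by ext; simp
  rw [this, DetBy.real_biInter h1 I R _ (fun i hi => (hE i hi).compl) hR hd]
  rw [← Finset.prod_const]
  refine Finset.prod_le_prod (fun i _ => measureReal_nonneg) fun i hi => ?_
  rw [real_compl_eq (hE i hi) (hR i hi)]
  linarith [hc i hi]

/-- Two independent events. -/
theorem real_inter_ge [IsProbabilityMeasure μ] (A B : Set (Config G)) (hB : MeasurableSet B) :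
    μ.real A + μ.real B - 1 ≤ μ.real (A ∩ B) := by
  -- Independence plays no role here: this is inclusion-exclusion with the union bounded by one.
  have := measureReal_union_add_inter (μ := μ) (s := A) hB
  have h2 : μ.real (A ∪ B) ≤ 1 := measureReal_le_one
  linarith

end DetBy

/-! ### Images of one-independent models -/

/-- The renormalization principle: if each new edge looks at its own region and vertex-disjoint new
edges look at disjoint regions, 1-independence passes to the image. It serves for block coarsening,
for the final grid model and for subgraphs. -/
theorem oneIndependent_map {V V' : Type*} {G : SimpleGraph V} {G' : SimpleGraph V'}
    {μ : Measure (Config G)} (h1 : OneIndependent μ) (f : Config G → Config G')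
    (hf : Measurable f) (R : G'.edgeSet → Set V)
    (hdet : ∀ e, DetBy (R e) {ω | f ω e = true})
    (hdisj : ∀ e e' : G'.edgeSet, (∀ v ∈ (e : Sym2 V'), v ∉ (e' : Sym2 V')) →
      Disjoint (R e) (R e')) :
    OneIndependent (μ.map f) := by
  intro S T hST
  have key : ∀ U : Set G'.edgeSet, ∃ φ :
      ({e : G.edgeSet | ∀ v ∈ (e : Sym2 V), v ∈ ⋃ d ∈ U, R d} → Bool) → (U → Bool),
      Measurable φ ∧ ∀ ω : Config G, (fun d : U => f ω d) = φ fun e => ω e := by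
    intro U
    refine ⟨fun η d => f (extendClosed _ η) d, ?_, fun ω => ?_⟩
    · exact (measurable_restrict U).comp (hf.comp (measurable_extendClosed _))
    · ext d
      have : ω ∈ {ω | f ω d = true} ↔ _ := (hdet d).iff (ω := ω)
        (ω' := extendClosed {e : G.edgeSet | ∀ v ∈ (e : Sym2 V), v ∈ ⋃ d ∈ U, R d}
          (fun e => ω e)) fun e he => by
            refine (extendClosed_restrict _ ω e ?_).symm
            exact fun v hv => Set.mem_biUnion d.2 (he v hv)
      rw [Bool.eq_iff_iff]
      exact this
  obtain ⟨φ, hφ, hφ'⟩ := key S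
  obtain ⟨ψ, hψ, hψ'⟩ := key T
  have hvd := h1 _ _ (vertexDisjoint_inside (G := G) (S := ⋃ d ∈ S, R d) (S' := ⋃ d ∈ T, R d) (by
    simp only [Set.disjoint_iUnion_left, Set.disjoint_iUnion_right]
    exact fun d hd d' hd' => hdisj d' d (hST d' hd' d hd)))
  have hcomp := hvd.comp hφ hψ
  rw [indepFun_iff_measure_inter_preimage_eq_mul] at hcomp ⊢
  intro s t hs ht
  have e1 : f ⁻¹' ((fun (ω : Config G') (e : S) => ω e) ⁻¹' s) =
      (φ ∘ fun (ω : Config G) e => ω e) ⁻¹' s := by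
    ext ω; simp only [Set.mem_preimage, Function.comp_apply, ← hφ' ω]
  have e2 : f ⁻¹' ((fun (ω : Config G') (e : T) => ω e) ⁻¹' t) =
      (ψ ∘ fun (ω : Config G) e => ω e) ⁻¹' t := by
    ext ω; simp only [Set.mem_preimage, Function.comp_apply, ← hψ' ω]
  rw [Measure.map_apply hf ((measurable_restrict S hs).inter (measurable_restrict T ht)),
    Measure.map_apply hf (measurable_restrict S hs),
    Measure.map_apply hf (measurable_restrict T ht), Set.preimage_inter, e1, e2]
  exact hcomp s t hs ht

theorem measurable_of_detBy {V V' : Type*} {G : SimpleGraph V} {G' : SimpleGraph V'}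
    (f : Config G → Config G') (R : G'.edgeSet → Set V) (hR : ∀ e, (R e).Finite)
    (hdet : ∀ e, DetBy (R e) {ω | f ω e = true}) : Measurable f := by
  refine measurable_pi_lambda _ fun e => ?_
  refine measurable_to_bool ?_
  exact (hdet e).measurableSet (hR e)

/-! ### Open paths -/

theorem openGraph_adj {V : Type*} {G : SimpleGraph V} {ω : Config G} {a b : V} :
    (openGraph ω).Adj a b ↔ ∃ h : G.Adj a b, ω ⟨s(a, b), h⟩ = true := by
  simp only [openGraph, SimpleGraph.fromEdgeSet_adj, Set.mem_ofPred_eq]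
  constructor
  · rintro ⟨⟨h, h'⟩, -⟩; exact ⟨h, h'⟩
  · rintro ⟨h, h'⟩; exact ⟨⟨h, h'⟩, h.ne⟩

/-- The open graph with all edges leaving `S` removed. -/
def openIn {V : Type*} {G : SimpleGraph V} (ω : Config G) (S : Set V) : SimpleGraph V where
  Adj a b := (openGraph ω).Adj a b ∧ a ∈ S ∧ b ∈ S
  symm := ⟨fun _ _ h => ⟨h.1.symm, h.2.2, h.2.1⟩⟩
  loopless := ⟨fun _ h => h.1.ne rfl⟩

section openIn

variable {V : Type*} {G : SimpleGraph V}

theorem openIn_mono (ω : Config G) {S S' : Set V} (h : S ⊆ S') : openIn ω S ≤ openIn ω S' :=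
  fun _ _ hab => ⟨hab.1, h hab.2.1, h hab.2.2⟩

theorem openIn_le (ω : Config G) (S : Set V) : openIn ω S ≤ openGraph ω := fun _ _ h => h.1

theorem openIn_congr {S : Set V} {ω ω' : Config G}
    (h : ∀ e : G.edgeSet, (∀ v ∈ (e : Sym2 V), v ∈ S) → ω e = ω' e) :
    openIn ω S = openIn ω' S := by
  ext a b
  simp only [openIn, openGraph_adj]
  constructor
  · rintro ⟨⟨h1, h2⟩, ha, hb⟩
    exact ⟨⟨h1, by rw [← h ⟨s(a, b), h1⟩ (by simp [ha, hb]), h2]⟩, ha, hb⟩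
  · rintro ⟨⟨h1, h2⟩, ha, hb⟩
    exact ⟨⟨h1, by rw [h ⟨s(a, b), h1⟩ (by simp [ha, hb]), h2]⟩, ha, hb⟩

theorem detBy_openIn (S : Set V) (P : SimpleGraph V → Prop) :
    DetBy S {ω : Config G | P (openIn ω S)} :=
  detBy_of_eq _ (fun _ _ h => openIn_congr h) P

end openIn

/-! ### The square grid at high density -/

/-- The square grid. -/
def gridGraph : SimpleGraph (ℤ × ℤ) where
  Adj u v := |u.1 - v.1| + |u.2 - v.2| = 1
  symm := ⟨fun x y h => by simpa only [abs_sub_comm] using h⟩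
  loopless := ⟨fun x h => by simp at h⟩

theorem gridGraph_adj_right (c r : ℤ) : gridGraph.Adj (c, r) (c + 1, r) := by
  simp [gridGraph]

theorem gridGraph_adj_up (c r : ℤ) : gridGraph.Adj (c, r) (c, r + 1) := by
  simp [gridGraph]

theorem gridGraph_adj_cases {A A' : ℤ × ℤ} (h : gridGraph.Adj A A') :
    (A'.1 = A.1 + 1 ∧ A'.2 = A.2) ∨ (A'.1 = A.1 - 1 ∧ A'.2 = A.2) ∨
      (A'.1 = A.1 ∧ A'.2 = A.2 + 1) ∨ (A'.1 = A.1 ∧ A'.2 = A.2 - 1) := by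
  simp only [gridGraph] at h
  rcases abs_cases (A.1 - A'.1) with h1 | h1 <;> rcases abs_cases (A.2 - A'.2) with h2 | h2 <;>
    omega

/-- The three-by-three block containing a site. -/
def blockOf (x : ℤ × ℤ) : ℤ × ℤ := (x.1 / 3, x.2 / 3)

/-- The sites in the two blocks joined by a coarse edge. -/
def edgeBox (e : Sym2 (ℤ × ℤ)) : Set (ℤ × ℤ) := {x | blockOf x ∈ e}

def RowGood (ω : Config gridGraph) (S : Set (ℤ × ℤ)) (r : ℤ) : Prop :=
  ∀ c : ℤ, (c, r) ∈ S → (c + 1, r) ∈ S → (openGraph ω).Adj (c, r) (c + 1, r)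

def ColGood (ω : Config gridGraph) (S : Set (ℤ × ℤ)) (c : ℤ) : Prop :=
  ∀ r : ℤ, (c, r) ∈ S → (c, r + 1) ∈ S → (openGraph ω).Adj (c, r) (c, r + 1)

/-- At most one row and at most one column of `S` has a closed edge. -/
def MostlyOpen (ω : Config gridGraph) (S : Set (ℤ × ℤ)) : Prop :=
  (∀ r r', ¬ RowGood ω S r → ¬ RowGood ω S r' → r = r') ∧
    ∀ c c', ¬ ColGood ω S c → ¬ ColGood ω S c' → c = c'

/-- The coarse configuration on blocks. -/
noncomputable def coarsen (ω : Config gridGraph) : Config gridGraph :=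
  open Classical in fun e => decide (MostlyOpen ω (edgeBox e))

theorem coarsen_eq_true {ω : Config gridGraph} {e : gridGraph.edgeSet} :
    coarsen ω e = true ↔ MostlyOpen ω (edgeBox e) := by
  simp [coarsen]

theorem finite_edgeBox (e : Sym2 (ℤ × ℤ)) : (edgeBox e).Finite := by
  induction e using Sym2.ind with
  | _ A A' =>
    refine Set.Finite.subset (((Set.finite_Icc (3 * A.1) (3 * A.1 + 2)).union
      (Set.finite_Icc (3 * A'.1) (3 * A'.1 + 2))).prod
      ((Set.finite_Icc (3 * A.2) (3 * A.2 + 2)).union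
      (Set.finite_Icc (3 * A'.2) (3 * A'.2 + 2)))) ?_
    rintro ⟨x, y⟩ h
    simp only [edgeBox, blockOf, Set.mem_ofPred_eq, Sym2.mem_iff, Prod.ext_iff] at h
    simp only [Set.mem_prod, Set.mem_union, Set.mem_Icc]
    omega

theorem mostlyOpen_congr {S : Set (ℤ × ℤ)} {ω ω' : Config gridGraph}
    (h : openIn ω S = openIn ω' S) (hω : MostlyOpen ω S) : MostlyOpen ω' S := by
  have hadj : ∀ a b, a ∈ S → b ∈ S → ((openGraph ω).Adj a b ↔ (openGraph ω').Adj a b) := by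
    intro a b ha hb
    have := congrArg (fun H => H.Adj a b) h
    simpa [openIn, ha, hb] using this
  have hr : ∀ r, RowGood ω S r ↔ RowGood ω' S r := fun r =>
    forall_congr' fun c => forall_congr' fun h1 => forall_congr' fun h2 => hadj _ _ h1 h2
  have hc : ∀ r, ColGood ω S r ↔ ColGood ω' S r := fun r =>
    forall_congr' fun c => forall_congr' fun h1 => forall_congr' fun h2 => hadj _ _ h1 h2
  simpa only [MostlyOpen, hr, hc] using hω

theorem detBy_coarsen (e : gridGraph.edgeSet) :
    DetBy (edgeBox e) {ω : Config gridGraph | coarsen ω e = true} := by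
  intro ω ω' h hω
  exact coarsen_eq_true.2 (mostlyOpen_congr (openIn_congr h) (coarsen_eq_true.1 hω))

theorem disjoint_edgeBox {e e' : Sym2 (ℤ × ℤ)} (h : ∀ v ∈ e, v ∉ e') :
    Disjoint (edgeBox e) (edgeBox e') :=
  Set.disjoint_left.2 fun x hx hx' => h (blockOf x) hx hx'

theorem measurable_coarsen : Measurable coarsen :=
  measurable_of_detBy coarsen (fun e => edgeBox e) (fun e => finite_edgeBox e) detBy_coarsen

theorem oneIndependent_coarsen {μ : Measure (Config gridGraph)} (h1 : OneIndependent μ) :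
    OneIndependent (μ.map coarsen) :=
  oneIndependent_map h1 coarsen measurable_coarsen (fun e => edgeBox e) detBy_coarsen
    fun _ _ h => disjoint_edgeBox h

theorem detBy_adj {V : Type*} {G : SimpleGraph V} (a b : V) :
    DetBy {a, b} {ω : Config G | (openGraph ω).Adj a b} := by
  have := detBy_openIn (G := G) {a, b} (fun H => H.Adj a b)
  simpa [openIn] using this

theorem real_not_adj_le {V : Type*} {G : SimpleGraph V} {μ : Measure (Config G)}
    [IsProbabilityMeasure μ] {ε : ℝ} (h : ∀ e : G.edgeSet, 1 - ε ≤ μ.real {ω | ω e = true})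
    {a b : V} (hab : G.Adj a b) : μ.real {ω | ¬ (openGraph ω).Adj a b} ≤ ε := by
  have h2 : {ω : Config G | ¬ (openGraph ω).Adj a b} =
      {ω : Config G | (openGraph ω).Adj a b}ᶜ := rfl
  rw [h2, real_compl_eq (detBy_adj a b) (Set.toFinite _)]
  have h3 : {ω : Config G | (openGraph ω).Adj a b} = {ω | ω ⟨s(a, b), hab⟩ = true} := by
    ext ω; simp [openGraph_adj, hab]
  rw [h3]; linarith [h ⟨s(a, b), hab⟩]

theorem ncard_edgeBox_le (e : Sym2 (ℤ × ℤ)) :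
    ∃ F : Finset (ℤ × ℤ), F.card ≤ 18 ∧ edgeBox e ⊆ F := by
  classical
  induction e using Sym2.ind with
  | _ A A' =>
    let B : ℤ × ℤ → Finset (ℤ × ℤ) := fun A =>
      Finset.Icc (3 * A.1) (3 * A.1 + 2) ×ˢ Finset.Icc (3 * A.2) (3 * A.2 + 2)
    have hB : ∀ A, (B A).card = 9 := by
      intro A
      simp only [B, Finset.card_product, Int.card_Icc]
      have : ∀ z : ℤ, (3 * z + 2 + 1 - 3 * z).toNat = 3 := by intro z; omega
      simp [this]
    refine ⟨B A ∪ B A', (Finset.card_union_le _ _).trans (by simp [hB]), ?_⟩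
    rintro ⟨x, y⟩ h
    simp only [edgeBox, blockOf, Set.mem_ofPred_eq, Sym2.mem_iff, Prod.ext_iff] at h
    simp only [B, Finset.coe_union, Set.mem_union, Finset.mem_coe, Finset.mem_product,
      Finset.mem_Icc]
    omega

/-- A box fails only if it has closed horizontal edges in two different rows or closed vertical
edges in two different columns. Two such edges share no vertex, so each pair costs ε². A box has at
most 18 sites, giving at most 2·18² = 648 pairs. -/
theorem real_coarsen_ge {μ : Measure (Config gridGraph)} [IsProbabilityMeasure μ]
    (h1 : OneIndependent μ) {ε : ℝ} (h : ∀ e : gridGraph.edgeSet, 1 - ε ≤ μ.real {ω | ω e = true})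
    (e : gridGraph.edgeSet) : 1 - 648 * ε ^ 2 ≤ (μ.map coarsen).real {ω | ω e = true} := by
  have hm : MeasurableSet {ω : Config gridGraph | ω e = true} :=
    measurableSet_eq_fun (measurable_pi_apply e) measurable_const
  rw [map_measureReal_apply measurable_coarsen hm]
  have hε : 0 ≤ ε := by
    have := h e
    have h2 : μ.real {ω | ω e = true} ≤ 1 := measureReal_le_one
    linarith
  obtain ⟨F, hF, hsub⟩ := ncard_edgeBox_le (e : Sym2 (ℤ × ℤ))
  have hcov : (coarsen ⁻¹' {ω | ω e = true})ᶜ ⊆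
      ⋃ q ∈ F ×ˢ F, (({ω | q.1.2 ≠ q.2.2 ∧ ¬ (openGraph ω).Adj q.1 (q.1.1 + 1, q.1.2) ∧
          ¬ (openGraph ω).Adj q.2 (q.2.1 + 1, q.2.2)}) ∪
        {ω | q.1.1 ≠ q.2.1 ∧ ¬ (openGraph ω).Adj q.1 (q.1.1, q.1.2 + 1) ∧
          ¬ (openGraph ω).Adj q.2 (q.2.1, q.2.2 + 1)}) := by
    intro ω hω
    have hω' : ¬ MostlyOpen ω (edgeBox e) := fun hc => hω (coarsen_eq_true.2 hc)
    simp only [MostlyOpen, not_and_or, not_forall, RowGood, ColGood] at hω'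
    simp only [Set.mem_iUnion, Finset.mem_product, exists_prop]
    rcases hω' with ⟨r, r', ⟨c, hc, _, hc'⟩, ⟨d, hd, _, hd'⟩, hne⟩ |
      ⟨c, c', ⟨r, hr, _, hr'⟩, ⟨d, hd, _, hd'⟩, hne⟩
    · exact ⟨((c, r), (d, r')), ⟨hsub hc, hsub hd⟩, Or.inl ⟨hne, hc', hd'⟩⟩
    · exact ⟨((c, r), (c', d)), ⟨hsub hr, hsub hd⟩, Or.inr ⟨hne, hr', hd'⟩⟩
  have hpair : ∀ a b a' b' : ℤ × ℤ, gridGraph.Adj a b → gridGraph.Adj a' b' →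
      Disjoint ({a, b} : Set (ℤ × ℤ)) {a', b'} →
      μ.real {ω | ¬ (openGraph ω).Adj a b ∧ ¬ (openGraph ω).Adj a' b'} ≤ ε ^ 2 := by
    intro a b a' b' hab hab' hd
    have := (detBy_adj (G := gridGraph) a b).compl.real_inter h1
      (detBy_adj (G := gridGraph) a' b').compl (Set.toFinite _) (Set.toFinite _) hd
    have e1 : {ω | ¬ (openGraph ω).Adj a b ∧ ¬ (openGraph ω).Adj a' b'} =
      {ω : Config gridGraph | (openGraph ω).Adj a b}ᶜ ∩ {ω | (openGraph ω).Adj a' b'}ᶜ := rfl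
    rw [e1, this, sq]
    exact mul_le_mul (real_not_adj_le h hab) (real_not_adj_le h hab') measureReal_nonneg hε
  have hb : μ.real (coarsen ⁻¹' {ω | ω e = true})ᶜ ≤ 648 * ε ^ 2 := by
    refine (measureReal_mono hcov (measure_ne_top _ _)).trans ?_
    refine (measureReal_biUnion_finset_le _ _).trans ?_
    have hterm : ∀ q ∈ F ×ˢ F, μ.real (({ω | q.1.2 ≠ q.2.2 ∧
        ¬ (openGraph ω).Adj q.1 (q.1.1 + 1, q.1.2) ∧
          ¬ (openGraph ω).Adj q.2 (q.2.1 + 1, q.2.2)}) ∪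
        {ω | q.1.1 ≠ q.2.1 ∧ ¬ (openGraph ω).Adj q.1 (q.1.1, q.1.2 + 1) ∧
          ¬ (openGraph ω).Adj q.2 (q.2.1, q.2.2 + 1)}) ≤ 2 * ε ^ 2 := by
      rintro ⟨⟨a, b⟩, ⟨c, d⟩⟩ -
      refine (measureReal_union_le _ _).trans ?_
      have t1 : μ.real {ω | b ≠ d ∧ ¬ (openGraph ω).Adj (a, b) (a + 1, b) ∧
          ¬ (openGraph ω).Adj (c, d) (c + 1, d)} ≤ ε ^ 2 := by
        by_cases hbd : b = d
        · simp [hbd, sq_nonneg]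
        · refine (measureReal_mono (fun ω hω => hω.2) (measure_ne_top _ _)).trans
            (hpair _ _ _ _ (gridGraph_adj_right a b) (gridGraph_adj_right c d) ?_)
          simp [Prod.ext_iff]
          omega
      have t2 : μ.real {ω | a ≠ c ∧ ¬ (openGraph ω).Adj (a, b) (a, b + 1) ∧
          ¬ (openGraph ω).Adj (c, d) (c, d + 1)} ≤ ε ^ 2 := by
        by_cases hbd : a = c
        · simp [hbd, sq_nonneg]
        · refine (measureReal_mono (fun ω hω => hω.2) (measure_ne_top _ _)).trans
            (hpair _ _ _ _ (gridGraph_adj_up a b) (gridGraph_adj_up c d) ?_)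
          simp [Prod.ext_iff]
          omega
      linarith [t1, t2]
    refine (Finset.sum_le_sum hterm).trans ?_
    rw [Finset.sum_const, Finset.card_product, nsmul_eq_mul]
    have : ((F.card * F.card : ℕ) : ℝ) ≤ 324 := by
      exact_mod_cast (Nat.mul_le_mul hF hF)
    nlinarith [sq_nonneg ε]
  have hmm : MeasurableSet (coarsen ⁻¹' {ω | ω e = true}) := measurable_coarsen hm
  rw [measureReal_compl hmm, probReal_univ] at hb
  linarith

/-! ### From paths of coarse edges to paths of fine edges. -/

theorem reachable_row {H : SimpleGraph (ℤ × ℤ)} {r : ℤ} (n : ℕ) (c : ℤ)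
    (h : ∀ i, c ≤ i → i < c + n → H.Adj (i, r) (i + 1, r)) : H.Reachable (c, r) (c + n, r) := by
  induction n with
  | zero => simp
  | succ n ih =>
    refine (ih fun i h1 h2 => h i h1 (by push_cast; omega)).trans ?_
    have := h (c + n) (by omega) (by push_cast; omega)
    refine (this.reachable).trans ?_
    push_cast
    rw [add_assoc]

theorem reachable_col {H : SimpleGraph (ℤ × ℤ)} {c : ℤ} (n : ℕ) (r : ℤ)
    (h : ∀ i, r ≤ i → i < r + n → H.Adj (c, i) (c, i + 1)) : H.Reachable (c, r) (c, r + n) := by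
  induction n with
  | zero => simp
  | succ n ih =>
    refine (ih fun i h1 h2 => h i h1 (by push_cast; omega)).trans ?_
    have := h (r + n) (by omega) (by push_cast; omega)
    refine (this.reachable).trans ?_
    push_cast
    rw [add_assoc]

theorem mem_edgeBox_iff {A A' x : ℤ × ℤ} : x ∈ edgeBox s(A, A') ↔
    (3 * A.1 ≤ x.1 ∧ x.1 ≤ 3 * A.1 + 2 ∧ 3 * A.2 ≤ x.2 ∧ x.2 ≤ 3 * A.2 + 2) ∨
    (3 * A'.1 ≤ x.1 ∧ x.1 ≤ 3 * A'.1 + 2 ∧ 3 * A'.2 ≤ x.2 ∧ x.2 ≤ 3 * A'.2 + 2) := by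
  simp only [edgeBox, blockOf, Set.mem_ofPred_eq, Sym2.mem_iff, Prod.ext_iff]
  omega

/-- The box of a coarse edge is a rectangle with sides at least three. -/
theorem edgeBox_rect {A A' : ℤ × ℤ} (h : gridGraph.Adj A A') :
    ∃ a b w t : ℤ, 3 ≤ w ∧ 3 ≤ t ∧ ∀ x, x ∈ edgeBox s(A, A') ↔
      (a ≤ x.1 ∧ x.1 < a + w ∧ b ≤ x.2 ∧ x.2 < b + t) := by
  rcases gridGraph_adj_cases h with ⟨h1, h2⟩ | ⟨h1, h2⟩ | ⟨h1, h2⟩ | ⟨h1, h2⟩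
  · refine ⟨3 * A.1, 3 * A.2, 6, 3, by norm_num, by norm_num, fun x => ?_⟩
    rw [mem_edgeBox_iff]; omega
  · refine ⟨3 * A'.1, 3 * A.2, 6, 3, by norm_num, by norm_num, fun x => ?_⟩
    rw [mem_edgeBox_iff]; omega
  · refine ⟨3 * A.1, 3 * A.2, 3, 6, by norm_num, by norm_num, fun x => ?_⟩
    rw [mem_edgeBox_iff]; omega
  · refine ⟨3 * A.1, 3 * A'.2, 3, 6, by norm_num, by norm_num, fun x => ?_⟩
    rw [mem_edgeBox_iff]; omega

/-- At most one column of the box is bad, so some column is fully open and crosses every good row.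
-/
theorem reachable_of_rowGood {ω : Config gridGraph} {A A' : ℤ × ℤ} (h : gridGraph.Adj A A')
    (hω : MostlyOpen ω (edgeBox s(A, A'))) {x x' : ℤ × ℤ} (hx : x ∈ edgeBox s(A, A'))
    (hx' : x' ∈ edgeBox s(A, A')) (hr : RowGood ω (edgeBox s(A, A')) x.2)
    (hr' : RowGood ω (edgeBox s(A, A')) x'.2) : (openGraph ω).Reachable x x' := by
  obtain ⟨a, b, w, t, hw, ht, hbox⟩ := edgeBox_rect h
  set S := edgeBox s(A, A')
  obtain ⟨c, hc1, hc2, hc⟩ : ∃ c, a ≤ c ∧ c < a + w ∧ ColGood ω S c := by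
    by_contra! hcon
    have := hω.2 a (a + 1) (hcon a le_rfl (by omega)) (hcon (a + 1) (by omega) (by omega))
    omega
  have row : ∀ r, b ≤ r → r < b + t → RowGood ω S r → ∀ c1 c2, a ≤ c1 → c1 ≤ c2 → c2 < a + w →
      (openGraph ω).Reachable (c1, r) (c2, r) := by
    intro r hb ht hg c1 c2 h1 h2 h3
    have := reachable_row (H := openGraph ω) (r := r) (c2 - c1).toNat c1 fun i hi hi' =>
      hg i ((hbox _).2 ⟨by simp; omega, by simp; omega, hb, ht⟩)
        ((hbox _).2 ⟨by simp; omega, by simp; omega, hb, ht⟩)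
    convert this using 2
    omega
  have row' : ∀ y, y ∈ S → RowGood ω S y.2 → (openGraph ω).Reachable y (c, y.2) := by
    intro y hy hg
    obtain ⟨h1, h2, h3, h4⟩ := (hbox y).1 hy
    rcases le_total y.1 c with h | h
    · exact row y.2 h3 h4 hg y.1 c h1 h hc2
    · exact (row y.2 h3 h4 hg c y.1 hc1 h h2).symm
  have col : ∀ r1 r2, b ≤ r1 → r1 ≤ r2 → r2 < b + t →
      (openGraph ω).Reachable (c, r1) (c, r2) := by
    intro r1 r2 h1 h2 h3
    have := reachable_col (H := openGraph ω) (c := c) (r2 - r1).toNat r1 fun i hi hi' =>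
      hc i ((hbox _).2 ⟨hc1, hc2, by simp; omega, by simp; omega⟩)
        ((hbox _).2 ⟨hc1, hc2, by simp; omega, by simp; omega⟩)
    convert this using 2
    omega
  obtain ⟨-, -, h3, h4⟩ := (hbox x).1 hx
  obtain ⟨-, -, h3', h4'⟩ := (hbox x').1 hx'
  refine (row' x hx hr).trans (SimpleGraph.Reachable.trans ?_ (row' x' hx' hr').symm)
  rcases le_total x.2 x'.2 with h | h
  · exact col _ _ h3 h h4'
  · exact (col _ _ h3' h h4).symm

/-- The block A has three rows and each of the two boxes spoils at most one of them. This is why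
blocks have side three. -/
theorem exists_common_row {ω : Config gridGraph} {e e' : Sym2 (ℤ × ℤ)} {A : ℤ × ℤ}
    (hA : A ∈ e) (hA' : A ∈ e') (h : MostlyOpen ω (edgeBox e)) (h' : MostlyOpen ω (edgeBox e')) :
    ∃ x, blockOf x = A ∧ x ∈ edgeBox e ∧ x ∈ edgeBox e' ∧ RowGood ω (edgeBox e) x.2 ∧
      RowGood ω (edgeBox e') x.2 := by
  obtain ⟨i, hi, hi', hg, hg'⟩ : ∃ i : ℤ, 0 ≤ i ∧ i ≤ 2 ∧ RowGood ω (edgeBox e) (3 * A.2 + i) ∧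
      RowGood ω (edgeBox e') (3 * A.2 + i) := by
    by_contra! hcon
    have h0 := hcon 0 (by norm_num) (by norm_num)
    have h1 := hcon 1 (by norm_num) (by norm_num)
    have h2 := hcon 2 (by norm_num) (by norm_num)
    by_cases g0 : RowGood ω (edgeBox e) (3 * A.2 + 0) <;>
    by_cases g1 : RowGood ω (edgeBox e) (3 * A.2 + 1) <;>
    by_cases g2 : RowGood ω (edgeBox e) (3 * A.2 + 2)
    all_goals first
      | (have := h.1 _ _ g0 g1; omega)
      | (have := h.1 _ _ g0 g2; omega)
      | (have := h.1 _ _ g1 g2; omega)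
      | (have := h'.1 _ _ (h0 g0) (h1 g1); omega)
      | (have := h'.1 _ _ (h0 g0) (h2 g2); omega)
      | (have := h'.1 _ _ (h1 g1) (h2 g2); omega)
  have hb : blockOf (3 * A.1, 3 * A.2 + i) = A := by
    ext <;> simp only [blockOf] <;> omega
  exact ⟨(3 * A.1, 3 * A.2 + i), hb, by simpa [edgeBox, hb] using hA,
    by simpa [edgeBox, hb] using hA', hg, hg'⟩

theorem exists_reachable_of_coarsen {ω : Config gridGraph} {A A' : ℤ × ℤ}
    (h : (openGraph (coarsen ω)).Reachable A A') :
    ∃ x x', blockOf x = A ∧ blockOf x' = A' ∧ (openGraph ω).Reachable x x' := by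
  rw [SimpleGraph.reachable_iff_reflTransGen] at h
  have step : ∀ {C C'}, (openGraph (coarsen ω)).Adj C C' →
      gridGraph.Adj C C' ∧ MostlyOpen ω (edgeBox s(C, C')) := by
    intro C C' hC
    obtain ⟨h1, h2⟩ := openGraph_adj.1 hC
    exact ⟨h1, coarsen_eq_true.1 h2⟩
  -- Invariant along the coarse path: a single starting site reaches all sites on good rows of the
  -- last box. The trivial path has no box and is kept apart.
  have key : A' = A ∨ ∃ C C', A' ∈ s(C, C') ∧ MostlyOpen ω (edgeBox s(C, C')) ∧
      ∃ x, blockOf x = A ∧ ∀ z ∈ edgeBox s(C, C'), RowGood ω (edgeBox s(C, C')) z.2 →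
        (openGraph ω).Reachable x z := by
    induction h with
    | refl => exact Or.inl rfl
    | @tail B B' _ hBB ih =>
      obtain ⟨hadj, hopen⟩ := step hBB
      refine Or.inr ⟨B, B', by simp, hopen, ?_⟩
      rcases ih with rfl | ⟨C, C', hB, hC, x, hx, hreach⟩
      · obtain ⟨x, hx, hx1, -, hx2, -⟩ := exists_common_row (A := B) (e := s(B, B'))
          (e' := s(B, B')) (by simp) (by simp) hopen hopen
        exact ⟨x, hx, fun z hz hzr => reachable_of_rowGood hadj hopen hx1 hz hx2 hzr⟩
      · obtain ⟨y, -, hy1, hy2, hy3, hy4⟩ := exists_common_row (A := B) (e' := s(B, B'))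
          hB (by simp) hC hopen
        exact ⟨x, hx, fun z hz hzr => (hreach y hy1 hy3).trans
          (reachable_of_rowGood hadj hopen hy2 hz hy4 hzr)⟩
  rcases key with rfl | ⟨C, C', hA, hC, x, hx, hreach⟩
  · exact ⟨(3 * A'.1, 3 * A'.2), (3 * A'.1, 3 * A'.2), by ext <;> simp [blockOf],
      by ext <;> simp [blockOf], .rfl⟩
  · obtain ⟨y, hy, hy1, -, hy3, -⟩ := exists_common_row hA hA hC hC
    exact ⟨x, y, hx, hy, hreach y hy1 hy3⟩

/-! ### Percolation of the grid from good origin blocks at all scales. -/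

/-- All edges of the block of the origin are open. -/
def OriginOpen (ω : Config gridGraph) : Prop :=
  ∀ c r : ℤ, 0 ≤ c → c ≤ 2 → 0 ≤ r → r ≤ 2 →
    (openGraph ω).Adj (c, r) (c + 1, r) ∧ (openGraph ω).Adj (c, r) (c, r + 1)

theorem OriginOpen.reachable {ω : Config gridGraph} (h : OriginOpen ω) {x : ℤ × ℤ}
    (hx : blockOf x = (0, 0)) : (openGraph ω).Reachable (0, 0) x := by
  obtain ⟨a, b⟩ := x
  simp only [blockOf, Prod.mk.injEq] at hx
  have h1 := reachable_row (H := openGraph ω) (r := 0) a.toNat 0 fun i hi hi' =>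
    (h i 0 hi (by omega) le_rfl (by norm_num)).1
  have h2 := reachable_col (H := openGraph ω) (c := a) b.toNat 0 fun i hi hi' =>
    (h a i (by omega) (by omega) hi (by omega)).2
  have ha : (0 : ℤ) + (a.toNat : ℤ) = a := by omega
  have hb : (0 : ℤ) + (b.toNat : ℤ) = b := by omega
  rw [ha] at h1
  rw [hb] at h2
  exact h1.trans h2

/-- Descending one scale only yields a path from some site of the origin's block. The block being
fully open at that scale brings its start back to the origin, so the descent can continue. -/
theorem exists_reachable_of_iterate {ω : Config gridGraph} (n : ℕ)
    (h : ∀ i < n, OriginOpen (coarsen^[i] ω)) {C : ℤ × ℤ}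
    (hC : (openGraph (coarsen^[n] ω)).Reachable (0, 0) C) :
    ∃ z : ℤ × ℤ, z.1 / 3 ^ n = C.1 ∧ (openGraph ω).Reachable (0, 0) z := by
  induction n generalizing C with
  | zero => exact ⟨C, by simp, hC⟩
  | succ n ih =>
    rw [Function.iterate_succ_apply'] at hC
    obtain ⟨x, y, hx, hy, hxy⟩ := exists_reachable_of_coarsen hC
    obtain ⟨z, hz, hz'⟩ := ih (fun i hi => h i (by omega))
      (((h n (by omega)).reachable hx).trans hxy)
    refine ⟨z, ?_, hz'⟩
    rw [pow_succ, ← Int.ediv_ediv_of_nonneg (by positivity), hz, ← hy, blockOf]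

/-- The open edge from (0,0) to (1,0) at scale n descends to a path from the origin to a site z with
3ⁿ ≤ z.1 < 2·3ⁿ. These sites are distinct for distinct n. -/
theorem infinite_component_of_originOpen {ω : Config gridGraph}
    (h : ∀ i, OriginOpen (coarsen^[i] ω)) :
    ∃ C : (openGraph ω).ConnectedComponent, C.supp.Infinite := by
  refine ⟨(openGraph ω).connectedComponentMk (0, 0), ?_⟩
  have hz : ∀ n : ℕ, ∃ z : ℤ × ℤ, z.1 / 3 ^ n = 1 ∧ (openGraph ω).Reachable (0, 0) z := by
    intro n
    refine exists_reachable_of_iterate (C := (1, 0)) n (fun i _ => h i) ?_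
    exact ((h n) 0 0 le_rfl (by norm_num) le_rfl (by norm_num)).1.reachable
  choose z hz1 hz2 using hz
  have hinj : Function.Injective z := by
    intro m n hmn
    by_contra hne
    have main : ∀ m n : ℕ, m < n → z m = z n → False := by
      intro m n hlt hmn
      have e1 := hz1 m
      have e2 := hz1 n
      rw [hmn] at e1
      have hp : (3 : ℤ) ^ n = 3 ^ m * 3 ^ (n - m) := by rw [← pow_add]; congr 1; omega
      rw [hp, ← Int.ediv_ediv_of_nonneg (by positivity), e1] at e2
      have h3 : (1 : ℤ) < 3 ^ (n - m) := one_lt_pow₀ (by norm_num) (by omega)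
      rw [Int.ediv_eq_zero_of_lt (by norm_num) h3] at e2
      norm_num at e2
    rcases lt_or_gt_of_ne hne with hlt | hlt
    · exact main m n hlt hmn
    · exact main n m hlt hmn.symm
  refine (Set.infinite_range_of_injective hinj).mono ?_
  rintro _ ⟨n, rfl⟩
  simp only [SimpleGraph.ConnectedComponent.mem_supp_iff, SimpleGraph.ConnectedComponent.eq]
  exact (hz2 n).symm

/-- For x ≤ 1/1296 one has 648x² ≤ x/2, so each coarsening at least halves the bound on the failure
probability. -/
theorem oneIndependent_iterate_coarsen {μ : Measure (Config gridGraph)} [IsProbabilityMeasure μ]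
    (h1 : OneIndependent μ) {ε : ℝ} (hε : ε ≤ 1 / 1296)
    (h : ∀ e : gridGraph.edgeSet, 1 - ε ≤ μ.real {ω | ω e = true}) (n : ℕ) :
    IsProbabilityMeasure (μ.map coarsen^[n]) ∧ OneIndependent (μ.map coarsen^[n]) ∧
      ∀ e : gridGraph.edgeSet, 1 - ε * (1 / 2) ^ n ≤ (μ.map coarsen^[n]).real {ω | ω e = true} := by
  have hε0 : 0 ≤ ε := by
    have h2 := h ⟨s((0, 0), (0 + 1, 0)), gridGraph_adj_right 0 0⟩
    have h3 : μ.real {ω | ω ⟨s((0, 0), (0 + 1, 0)), gridGraph_adj_right 0 0⟩ = true} ≤ 1 :=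
      measureReal_le_one
    linarith
  induction n with
  | zero =>
    have hid : μ.map coarsen^[0] = μ := by rw [Function.iterate_zero, Measure.map_id]
    rw [hid]
    exact ⟨inferInstance, h1, fun e => by simpa using h e⟩
  | succ n ih =>
    obtain ⟨hp, hi, hq⟩ := ih
    have hmn : Measurable coarsen^[n] := measurable_coarsen.iterate n
    have : μ.map coarsen^[n + 1] = (μ.map coarsen^[n]).map coarsen := by
      rw [Measure.map_map measurable_coarsen hmn, Function.iterate_succ']
    rw [this]
    refine ⟨Measure.isProbabilityMeasure_map measurable_coarsen.aemeasurable,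
      oneIndependent_coarsen hi, fun e => le_trans ?_ (real_coarsen_ge hi hq e)⟩
    have hpow : (0 : ℝ) ≤ (1 / 2) ^ n := by positivity
    have hpow1 : ((1 : ℝ) / 2) ^ n ≤ 1 := pow_le_one₀ (by norm_num) (by norm_num)
    have hx : ε * (1 / 2) ^ n ≤ 1 / 1296 := by nlinarith
    have hx0 : 0 ≤ ε * (1 / 2) ^ n := by positivity
    rw [pow_succ]
    nlinarith

/-- A one-independent model on the grid with edge probabilities close to one percolates. -/
theorem grid_percolates {μ : Measure (Config gridGraph)} [IsProbabilityMeasure μ]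
    (h1 : OneIndependent μ) (h : ∀ e : gridGraph.edgeSet,
      1 - 1 / 1296 ≤ μ.real {ω | ω e = true}) : Percolates μ := by
  have hmeas : ∀ i, MeasurableSet {ω : Config gridGraph | OriginOpen (coarsen^[i] ω)} := by
    intro i
    refine measurableSet_preimage (measurable_coarsen.iterate i) (t := {ω | OriginOpen ω}) ?_
    simp only [OriginOpen, Set.ofPred_forall]
    refine MeasurableSet.iInter fun c => MeasurableSet.iInter fun r => MeasurableSet.iInter fun _ =>
      MeasurableSet.iInter fun _ => MeasurableSet.iInter fun _ => MeasurableSet.iInter fun _ => ?_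
    exact ((detBy_adj _ _).measurableSet (Set.toFinite _)).inter
      ((detBy_adj _ _).measurableSet (Set.toFinite _))
  -- There are nine sites with two edges each, and 18/1296 = 1/72. Summed over all scales this gives
  -- 1/36 < 1.
  have hfail : ∀ i, μ.real {ω : Config gridGraph | ¬ OriginOpen (coarsen^[i] ω)} ≤
      (1 / 72) * (1 / 2) ^ i := by
    intro i
    obtain ⟨hp, -, hq⟩ := oneIndependent_iterate_coarsen h1 le_rfl h i
    have hsub : {ω : Config gridGraph | ¬ OriginOpen (coarsen^[i] ω)} ⊆
        coarsen^[i] ⁻¹' (⋃ q ∈ Finset.Icc (0 : ℤ) 2 ×ˢ Finset.Icc (0 : ℤ) 2,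
          {ω | ¬ (openGraph ω).Adj (q.1, q.2) (q.1 + 1, q.2)} ∪
          {ω | ¬ (openGraph ω).Adj (q.1, q.2) (q.1, q.2 + 1)}) := by
      intro ω hω
      simp only [OriginOpen, Set.mem_ofPred_eq, not_forall, not_and_or] at hω
      obtain ⟨c, r, h1, h2, h3, h4, h5⟩ := hω
      simp only [Set.mem_preimage, Set.mem_iUnion]
      exact ⟨(c, r), by simp [h1, h2, h3, h4], h5⟩
    refine (measureReal_mono hsub (measure_ne_top _ _)).trans ?_
    rw [← map_measureReal_apply (measurable_coarsen.iterate i)]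
    swap
    · refine Finset.measurableSet_biUnion _ fun q _ => ?_
      exact ((detBy_adj _ _).compl.measurableSet (Set.toFinite _)).union
        ((detBy_adj _ _).compl.measurableSet (Set.toFinite _))
    refine (measureReal_biUnion_finset_le _ _).trans ?_
    refine (Finset.sum_le_card_nsmul _ _ (2 * (1 / 1296 * (1 / 2) ^ i)) fun q _ => ?_).trans ?_
    · refine (measureReal_union_le _ _).trans ?_
      linarith [real_not_adj_le hq (gridGraph_adj_right q.1 q.2),
        real_not_adj_le hq (gridGraph_adj_up q.1 q.2)]
    · have h9 : (Finset.Icc (0 : ℤ) 2 ×ˢ Finset.Icc (0 : ℤ) 2).card = 9 := rfl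
      rw [h9, nsmul_eq_mul]
      push_cast
      linarith
  have hsum : ∑' i, μ {ω : Config gridGraph | ¬ OriginOpen (coarsen^[i] ω)} ≤
      ENNReal.ofReal (1 / 36) := by
    have hs : HasSum (fun i : ℕ => (1 / 72 : ℝ) * (1 / 2) ^ i) (1 / 36) := by
      have := (hasSum_geometric_two).mul_left (1 / 72 : ℝ)
      norm_num at this ⊢
      exact this
    rw [← hs.tsum_eq, ENNReal.ofReal_tsum_of_nonneg (fun i => by positivity) hs.summable]
    refine ENNReal.tsum_le_tsum fun i => ?_
    rw [ENNReal.le_ofReal_iff_toReal_le (measure_ne_top _ _) (by positivity)]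
    exact hfail i
  have hbad : μ (⋃ i, {ω : Config gridGraph | ¬ OriginOpen (coarsen^[i] ω)}) < 1 := by
    refine ((measure_iUnion_le _).trans hsum).trans_lt ?_
    rw [ENNReal.ofReal_lt_one]; norm_num
  have hm' : ∀ i, MeasurableSet {ω : Config gridGraph | ¬ OriginOpen (coarsen^[i] ω)} :=
    fun i => (hmeas i).compl
  have hgood : 0 < μ (⋃ i, {ω : Config gridGraph | ¬ OriginOpen (coarsen^[i] ω)})ᶜ := by
    rw [prob_compl_eq_one_sub (MeasurableSet.iUnion hm')]
    exact tsub_pos_of_lt hbad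
  refine hgood.trans_le (measure_mono fun ω hω => ?_)
  refine infinite_component_of_originOpen fun i => ?_
  by_contra hcon
  exact hω (Set.mem_iUnion.2 ⟨i, hcon⟩)

/-! ### Counting events -/

section Counting

set_option linter.unusedSectionVars false

variable {Ω ι : Type*} [MeasurableSpace Ω] {μ : Measure Ω} [IsProbabilityMeasure μ]

theorem integrable_indicator_one {E : Set Ω} (hE : MeasurableSet E) :
    Integrable (E.indicator (fun _ => (1 : ℝ))) μ :=
  (integrable_const 1).indicator hE

theorem integral_indicator_real {E : Set Ω} (hE : MeasurableSet E) :
    ∫ ω, E.indicator (fun _ => (1 : ℝ)) ω ∂μ = μ.real E := by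
  rw [integral_indicator_const _ hE, smul_eq_mul, mul_one]

theorem integral_sum_indicator (F : Finset ι) {E : ι → Set Ω} (hE : ∀ i ∈ F, MeasurableSet (E i)) :
    ∫ ω, ∑ i ∈ F, (E i).indicator (fun _ => (1 : ℝ)) ω ∂μ = ∑ i ∈ F, μ.real (E i) := by
  rw [integral_finsetSum _ fun i hi => integrable_indicator_one (hE i hi)]
  exact Finset.sum_congr rfl fun i hi => integral_indicator_real (hE i hi)

theorem sum_indicator_eq_card (F : Finset ι) (E : ι → Set Ω) (ω : Ω) [DecidablePred fun i => ω ∈ E i] :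
    ∑ i ∈ F, (E i).indicator (fun _ => (1 : ℝ)) ω = (F.filter fun i => ω ∈ E i).card := by
  simp [Set.indicator_apply]

open Classical in
theorem sum_real_le_of_card_le (F : Finset ι) {E : ι → Set Ω} (hE : ∀ i ∈ F, MeasurableSet (E i))
    {c : ℝ} (h : ∀ ω, ((F.filter fun i => ω ∈ E i).card : ℝ) ≤ c) :
    ∑ i ∈ F, μ.real (E i) ≤ c := by
  rw [← integral_sum_indicator F hE]
  refine (integral_mono (integrable_finsetSum _ fun i hi => integrable_indicator_one (hE i hi))
    (integrable_const c) fun ω => ?_).trans (by simp)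
  simpa only [sum_indicator_eq_card] using h ω

open Classical in
theorem le_sum_real_of_le_card (F : Finset ι) {E : ι → Set Ω} (hE : ∀ i ∈ F, MeasurableSet (E i))
    {c : ℝ} {A : Set Ω} (hA : MeasurableSet A)
    (h : ∀ ω ∈ A, c ≤ ((F.filter fun i => ω ∈ E i).card : ℝ)) :
    c * μ.real A ≤ ∑ i ∈ F, μ.real (E i) := by
  rw [← integral_sum_indicator F hE]
  have : c * μ.real A = ∫ ω, A.indicator (fun _ => c) ω ∂μ := by
    rw [integral_indicator_const _ hA, smul_eq_mul, mul_comm]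
  rw [this]
  refine integral_mono ((integrable_const c).indicator hA)
    (integrable_finsetSum _ fun i hi => integrable_indicator_one (hE i hi)) fun ω => ?_
  simp only [sum_indicator_eq_card]
  by_cases hω : ω ∈ A
  · simpa [hω] using h ω hω
  · simp [hω]

/-- The second moment method for a sum of indicators. -/
theorem real_count_le_of_cov (F : Finset ι) {E : ι → Set Ω} (hE : ∀ i ∈ F, MeasurableSet (E i))
    {v d : ℝ} (hd : 0 < d)
    (hv : ∑ i ∈ F, ∑ j ∈ F, (μ.real (E i ∩ E j) - μ.real (E i) * μ.real (E j)) ≤ v) :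
    μ.real {ω | ∑ i ∈ F, (E i).indicator (fun _ => (1 : ℝ)) ω ≤ ∑ i ∈ F, μ.real (E i) - d} ≤
      v / d ^ 2 := by
  set f : Ω → ℝ := fun ω => ∑ i ∈ F, (E i).indicator (fun _ => (1 : ℝ)) ω with hf
  set m := ∑ i ∈ F, μ.real (E i) with hm
  have hfi : Integrable f μ :=
    integrable_finsetSum _ fun i hi => integrable_indicator_one (hE i hi)
  have hf1 : ∫ ω, f ω ∂μ = m := integral_sum_indicator F hE
  have hsq : (fun ω => f ω ^ 2) = fun ω =>
      ∑ q ∈ F ×ˢ F, (E q.1 ∩ E q.2).indicator (fun _ => (1 : ℝ)) ω := by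
    funext ω
    rw [sq, hf, Finset.sum_mul_sum, Finset.sum_product]
    refine Finset.sum_congr rfl fun i _ => Finset.sum_congr rfl fun j _ => ?_
    by_cases h1 : ω ∈ E i <;> by_cases h2 : ω ∈ E j <;> simp [h1, h2]
  have hme : ∀ q ∈ F ×ˢ F, MeasurableSet (E q.1 ∩ E q.2) := fun q hq =>
    (hE _ (Finset.mem_product.1 hq).1).inter (hE _ (Finset.mem_product.1 hq).2)
  have hfi2 : Integrable (fun ω => f ω ^ 2) μ := by
    rw [hsq]; exact integrable_finsetSum _ fun i hi => integrable_indicator_one (hme i hi)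
  have hf2 : ∫ ω, f ω ^ 2 ∂μ = ∑ q ∈ F ×ˢ F, μ.real (E q.1 ∩ E q.2) := by
    rw [hsq]; exact integral_sum_indicator _ hme
  have hexp : (fun ω => (f ω - m) ^ 2) = fun ω => (f ω ^ 2 - 2 * m * f ω) + m ^ 2 := by
    funext ω; ring
  have hvi : Integrable (fun ω => (f ω - m) ^ 2) μ := by
    rw [hexp]; exact (hfi2.sub (hfi.const_mul _)).add (integrable_const _)
  have hvar : ∫ ω, (f ω - m) ^ 2 ∂μ ≤ v := by
    have hs : Integrable (fun ω => f ω ^ 2 - 2 * m * f ω) μ := hfi2.sub (hfi.const_mul _)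
    rw [hexp, integral_add hs (integrable_const _),
      integral_sub hfi2 (hfi.const_mul _), integral_const_mul, hf1, hf2]
    simp only [integral_const, probReal_univ, smul_eq_mul, one_mul]
    refine le_trans (le_of_eq ?_) hv
    simp only [Finset.sum_sub_distrib, Finset.sum_product]
    rw [← Finset.sum_mul_sum]
    ring
  have hmark := mul_meas_ge_le_integral_of_nonneg (μ := μ) (f := fun ω => (f ω - m) ^ 2)
    (Filter.Eventually.of_forall fun ω => sq_nonneg _) hvi (d ^ 2)
  have hsub : {ω | f ω ≤ m - d} ⊆ {ω | d ^ 2 ≤ (f ω - m) ^ 2} := by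
    intro ω hω
    have : f ω ≤ m - d := hω
    show d ^ 2 ≤ (f ω - m) ^ 2
    nlinarith
  rw [le_div_iff₀ (by positivity), mul_comm]
  refine le_trans (mul_le_mul_of_nonneg_left (measureReal_mono hsub (measure_ne_top _ _))
    (by positivity)) (hmark.trans hvar)

/-- The moments of a count dominate the powers of its mean. -/
theorem pow_le_sum_real_forall (F : Finset ι) {E : ι → Set Ω} (hE : ∀ i ∈ F, MeasurableSet (E i))
    {p : ℝ} (hp : 0 < p) (h : ∀ i ∈ F, p ≤ μ.real (E i)) (ℓ : ℕ) :
    (p * F.card) ^ ℓ ≤ ∑ τ ∈ Fintype.piFinset (fun _ : Fin ℓ => F), μ.real (⋂ k, E (τ k)) := by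
  rcases F.eq_empty_or_nonempty with rfl | hne
  · rcases ℓ with _ | ℓ <;> simp
  set f : Ω → ℝ := fun ω => ∑ i ∈ F, (E i).indicator (fun _ => (1 : ℝ)) ω with hf
  have hn : (0 : ℝ) < F.card := by exact_mod_cast hne.card_pos
  set m : ℝ := p * F.card with hm
  have hm0 : 0 < m := by positivity
  have hfi : Integrable f μ :=
    integrable_finsetSum _ fun i hi => integrable_indicator_one (hE i hi)
  have hf1 : m ≤ ∫ ω, f ω ∂μ := by
    rw [integral_sum_indicator F hE, hm, mul_comm, ← nsmul_eq_mul]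
    exact Finset.card_nsmul_le_sum _ _ _ h
  have hme : ∀ τ ∈ Fintype.piFinset (fun _ : Fin ℓ => F), MeasurableSet (⋂ k, E (τ k)) :=
    fun τ hτ => MeasurableSet.iInter fun k => hE _ (Fintype.mem_piFinset.1 hτ k)
  have hpow : (fun ω => f ω ^ ℓ) = fun ω => ∑ τ ∈ Fintype.piFinset (fun _ : Fin ℓ => F),
      (⋂ k, E (τ k)).indicator (fun _ => (1 : ℝ)) ω := by
    classical
    funext ω
    rw [hf]
    simp only
    rw [Finset.sum_pow']
    refine Finset.sum_congr rfl fun τ _ => ?_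
    simp only [Set.indicator_apply, Set.mem_iInter]
    by_cases hall : ∀ k, ω ∈ E (τ k)
    · simp [hall]
    · rw [if_neg hall]
      push Not at hall
      obtain ⟨k, hk⟩ := hall
      exact Finset.prod_eq_zero (Finset.mem_univ k) (by simp [hk])
  have hpowint : Integrable (fun ω => f ω ^ ℓ) μ := by
    rw [hpow]; exact integrable_finsetSum _ fun τ hτ => integrable_indicator_one (hme τ hτ)
  rw [← integral_sum_indicator _ hme, ← hpow]
  -- Jensen by hand: Bernoulli's inequality puts the power above its tangent at m. The slope is
  -- nonnegative, so it suffices that m is a lower bound for the mean.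
  have htan : ∀ ω, m ^ ℓ * (1 - ℓ) + m ^ ℓ * ℓ / m * f ω ≤ f ω ^ ℓ := by
    intro ω
    have h0 : 0 ≤ f ω := Finset.sum_nonneg fun i _ => Set.indicator_nonneg (by simp) _
    have hq : 0 ≤ f ω / m := by positivity
    have := one_add_mul_le_pow (a := f ω / m - 1) (by linarith) ℓ
    calc m ^ ℓ * (1 - ℓ) + m ^ ℓ * ℓ / m * f ω = m ^ ℓ * (1 + ℓ * (f ω / m - 1)) := by ring
      _ ≤ m ^ ℓ * (1 + (f ω / m - 1)) ^ ℓ := by gcongr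
      _ = f ω ^ ℓ := by
        rw [← mul_pow]; congr 1; field_simp; ring
  have hmono := integral_mono (μ := μ) ((integrable_const _).add (hfi.const_mul _)) hpowint htan
  refine le_trans ?_ hmono
  rw [integral_add' (integrable_const _) (hfi.const_mul _)]
  simp only [integral_const, integral_const_mul, probReal_univ, smul_eq_mul, one_mul]
  have h1 : 1 ≤ (∫ ω, f ω ∂μ) / m := by rw [le_div_iff₀ hm0]; linarith
  have h2 : (0 : ℝ) ≤ m ^ ℓ * ℓ * ((∫ ω, f ω ∂μ) / m - 1) := by
    apply mul_nonneg (by positivity); linarith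
  have h3 : m ^ ℓ * (1 - ℓ) + m ^ ℓ * ℓ / m * ∫ ω, f ω ∂μ =
      m ^ ℓ + m ^ ℓ * ℓ * ((∫ ω, f ω ∂μ) / m - 1) := by ring
  linarith

end Counting

/-! ### Majority components of a finite graph -/

section Majority

variable {I : Type*}

/-- The edges of `Γ` inside `U`. -/
def restr (Γ : SimpleGraph I) (U : Set I) : SimpleGraph I where
  Adj a b := Γ.Adj a b ∧ a ∈ U ∧ b ∈ U
  symm := ⟨fun _ _ h => ⟨h.1.symm, h.2.2, h.2.1⟩⟩
  loopless := ⟨fun _ h => h.1.ne rfl⟩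

theorem restr_mono (Γ : SimpleGraph I) {U U' : Set I} (h : U ⊆ U') : restr Γ U ≤ restr Γ U' :=
  fun _ _ hab => ⟨hab.1, h hab.2.1, h hab.2.2⟩

theorem restr_le (Γ : SimpleGraph I) (U : Set I) : restr Γ U ≤ Γ := fun _ _ h => h.1

theorem restr_restr (Γ : SimpleGraph I) {U U' : Set I} (h : U ⊆ U') :
    restr (restr Γ U') U = restr Γ U := by
  ext a b
  exact ⟨fun hab => ⟨hab.1.1, hab.2⟩, fun hab => ⟨⟨hab.1, h hab.2.1, h hab.2.2⟩, hab.2⟩⟩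

open Classical in
/-- The members of `W` joined to `a` inside `W`. -/
noncomputable def cls (Γ : SimpleGraph I) (W : Finset I) (a : I) : Finset I :=
  W.filter fun b => (restr Γ W).Reachable a b

theorem mem_cls {Γ : SimpleGraph I} {W : Finset I} {a b : I} :
    b ∈ cls Γ W a ↔ b ∈ W ∧ (restr Γ W).Reachable a b := by simp [cls]

theorem cls_restr (Γ : SimpleGraph I) {W : Finset I} {U : Set I} (h : (W : Set I) ⊆ U) (a : I) :
    cls (restr Γ U) W a = cls Γ W a := by
  ext b; simp only [mem_cls, restr_restr Γ h]

theorem cls_eq_of_reachable {Γ : SimpleGraph I} {W : Finset I} {a b : I}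
    (h : (restr Γ W).Reachable a b) : cls Γ W a = cls Γ W b := by
  ext c; simp only [mem_cls]
  exact and_congr_right fun _ => ⟨fun hc => h.symm.trans hc, fun hc => h.trans hc⟩

/-- The members of `W` whose component inside `W` has at least `c · |W|` elements. -/
def dense (c : ℝ) (Γ : SimpleGraph I) (W : Finset I) : Set I :=
  {a | a ∈ W ∧ c * W.card ≤ (cls Γ W a).card}

theorem dense_restr (c : ℝ) (Γ : SimpleGraph I) {W : Finset I} {U : Set I}
    (h : (W : Set I) ⊆ U) : dense c (restr Γ U) W = dense c Γ W := by
  simp only [dense, cls_restr Γ h]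

theorem exists_reachable_of_card {Γ : SimpleGraph I} {W W' Z : Finset I} {a b : I}
    (hW : W ⊆ Z) (hW' : W' ⊆ Z) (h : Z.card < (cls Γ W a).card + (cls Γ W' b).card) :
    (restr Γ Z).Reachable a b := by
  classical
  have hsub : cls Γ W a ∪ cls Γ W' b ⊆ Z := Finset.union_subset
    (fun x hx => hW (mem_cls.1 hx).1) (fun x hx => hW' (mem_cls.1 hx).1)
  have hne : ((cls Γ W a) ∩ (cls Γ W' b)).Nonempty := by
    rw [← Finset.card_pos]
    have := Finset.card_union_add_card_inter (cls Γ W a) (cls Γ W' b)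
    have := Finset.card_le_card hsub
    omega
  obtain ⟨x, hx⟩ := hne
  rw [Finset.mem_inter, mem_cls, mem_cls] at hx
  exact (hx.1.2.mono (restr_mono Γ (by exact_mod_cast hW))).trans
    (hx.2.2.mono (restr_mono Γ (by exact_mod_cast hW'))).symm

/-- Two components each filling more than half of W must intersect, so above density 1/2 the dense
component is unique. -/
theorem dense_reachable {c : ℝ} (hc : 1 / 2 < c) {Γ : SimpleGraph I} {W : Finset I} {a b : I}
    (ha : a ∈ dense c Γ W) (hb : b ∈ dense c Γ W) : (restr Γ W).Reachable a b := by
  refine exists_reachable_of_card (W := W) (W' := W) subset_rfl subset_rfl ?_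
  have hpos : (0 : ℝ) < W.card := by exact_mod_cast Finset.card_pos.2 ⟨a, ha.1⟩
  have h1 := ha.2
  have h2 := hb.2
  have : (W.card : ℝ) < (cls Γ W a).card + (cls Γ W b).card := by nlinarith
  exact_mod_cast this

theorem mem_dense_of_reachable {c : ℝ} {Γ : SimpleGraph I} {W : Finset I} {a b : I}
    (ha : a ∈ dense c Γ W) (hb : b ∈ W) (h : (restr Γ W).Reachable a b) : b ∈ dense c Γ W :=
  ⟨hb, by rw [← cls_eq_of_reachable h]; exact ha.2⟩

end Majority

/-! ### Stars -/

/-- The random structure around a vertex `center`: `tip` is the set of open spokes, and `adj`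
joins spokes whose far ends are connected away from the centre, using only the region belonging
to the two spokes. -/
structure Star {V : Type*} (G : SimpleGraph V) (I : Type*) where
  center : V
  reg : Set I → Set V
  tip : Config G → Set I
  adj : Config G → SimpleGraph I
  reg_finite : ∀ U, (reg U).Finite
  reg_mono : ∀ {U U' : Set I}, U ⊆ U' → reg U ⊆ reg U'
  reg_disjoint : ∀ {U U' : Set I}, Disjoint U U' → Disjoint (reg U) (reg U')
  -- Joins of far ends never use edges at the centre. This lets main components be independent of
  -- events that do involve the centre, provided the spokes used are disjoint.
  center_notMem : ∀ U, center ∉ reg U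
  det_adj : ∀ t t', DetBy (reg {t, t'}) {ω | (adj ω).Adj t t'}
  det_tip : ∀ t, DetBy (insert center (reg {t})) {ω | t ∈ tip ω}

namespace Star

variable {V I : Type*} {G : SimpleGraph V} (S : Star G I)

theorem restr_congr {U : Set I} {ω ω' : Config G}
    (h : ∀ e : G.edgeSet, (∀ v ∈ (e : Sym2 V), v ∈ S.reg U) → ω e = ω' e) :
    restr (S.adj ω) U = restr (S.adj ω') U := by
  ext t t'
  refine and_congr_left fun ht => ?_
  refine (S.det_adj t t').iff fun e he => h e fun v hv => S.reg_mono ?_ (he v hv)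
  rintro _ (rfl | rfl)
  exacts [ht.1, ht.2]

theorem det_restr (U : Set I) (P : SimpleGraph I → Prop) :
    DetBy (S.reg U) {ω | P (restr (S.adj ω) U)} :=
  detBy_of_eq _ (fun _ _ h => S.restr_congr h) P

theorem det_dense (c : ℝ) (W : Finset I) (P : Set I → Prop) :
    DetBy (S.reg W) {ω | P (dense c (S.adj ω) W)} := by
  have := S.det_restr W fun Γ => P (dense c Γ W)
  simpa only [dense_restr c _ (subset_refl (W : Set I))] using this

/-- Some two open spokes are not joined. -/
def Clash (ω : Config G) : Prop := ∃ t ∈ S.tip ω, ∃ t' ∈ S.tip ω, t ≠ t' ∧ ¬ (S.adj ω).Adj t t'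

theorem finite_insert (U : Set I) : (insert S.center (S.reg U)).Finite := (S.reg_finite U).insert _

theorem measurableSet_tip (t : I) : MeasurableSet {ω | t ∈ S.tip ω} :=
  (S.det_tip t).measurableSet (S.finite_insert _)

variable {μ : Measure (Config G)} [IsProbabilityMeasure μ]

open Classical in
-- A tuple joined within its own range lies entirely in the class of its first entry. Without a
-- dense component each class has fewer than c·|W| elements, leaving |W| choices for the first entry
-- and at most (c·|W|)^k for the others.
theorem card_joined_le (Γ : SimpleGraph I) (W : Finset I) {c : ℝ} (k : ℕ)
    (h : dense c Γ W = ∅) :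
    (((Fintype.piFinset fun _ : Fin (k + 1) => W).filter fun τ =>
      ∀ i, (restr Γ (Set.range τ)).Reachable (τ 0) (τ i)).card : ℝ) ≤
      c ^ k * (W.card : ℝ) ^ (k + 1) := by
  have hsub : ((Fintype.piFinset fun _ : Fin (k + 1) => W).filter fun τ =>
      ∀ i, (restr Γ (Set.range τ)).Reachable (τ 0) (τ i)) ⊆
      (W.sigma fun a => Fintype.piFinset fun _ : Fin k => cls Γ W a).image
        fun q => (Fin.cons q.1 q.2 : Fin (k + 1) → I) := by
    intro τ hτ
    rw [Finset.mem_filter, Fintype.mem_piFinset] at hτ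
    rw [Finset.mem_image]
    refine ⟨⟨τ 0, Fin.tail τ⟩, ?_, Fin.cons_self_tail τ⟩
    rw [Finset.mem_sigma, Fintype.mem_piFinset]
    refine ⟨hτ.1 0, fun i => mem_cls.2 ⟨hτ.1 _, (hτ.2 _).mono (restr_mono Γ ?_)⟩⟩
    rintro _ ⟨j, rfl⟩
    exact hτ.1 j
  refine (Nat.cast_le.2 ((Finset.card_le_card hsub).trans Finset.card_image_le)).trans ?_
  rw [Finset.card_sigma]
  push_cast
  have : ∀ a ∈ W, ((Fintype.piFinset fun _ : Fin k => cls Γ W a).card : ℝ) ≤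
      (c * W.card) ^ k := by
    intro a ha
    rw [Fintype.card_piFinset_const]
    push_cast
    refine pow_le_pow_left₀ (by positivity) ?_ k
    by_contra hcon
    have : a ∈ dense c Γ W := ⟨ha, (not_le.1 hcon).le⟩
    rw [h] at this
    exact this
  refine (Finset.sum_le_card_nsmul _ _ _ this).trans (le_of_eq ?_)
  rw [nsmul_eq_mul, mul_pow]
  ring

open Classical in
-- Tuples meet when one of the ℓ² coordinate coincidences τ i = σ j holds. Given such a coincidence,
-- σ j is redundant, so overwriting it by an arbitrary element of W is injective. The lemma bounds
-- the number of correlated pairs in the variance.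
theorem card_meeting_le (W : Finset I) (ℓ : ℕ) :
    ((((Fintype.piFinset fun _ : Fin ℓ => W) ×ˢ (Fintype.piFinset fun _ : Fin ℓ => W)).filter
      fun q => ¬ Disjoint (Set.range q.1) (Set.range q.2)).card) * W.card ≤
      ℓ ^ 2 * W.card ^ (2 * ℓ) := by
  set P := Fintype.piFinset fun _ : Fin ℓ => W with hP
  have hsub : (P ×ˢ P).filter (fun q => ¬ Disjoint (Set.range q.1) (Set.range q.2)) ⊆
      (Finset.univ : Finset (Fin ℓ × Fin ℓ)).biUnion fun ij =>
        (P ×ˢ P).filter fun q => q.1 ij.1 = q.2 ij.2 := by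
    intro q hq
    rw [Finset.mem_filter, Set.not_disjoint_iff] at hq
    obtain ⟨hq, x, ⟨i, hi⟩, ⟨j, hj⟩⟩ := hq
    rw [Finset.mem_biUnion]
    exact ⟨(i, j), Finset.mem_univ _, Finset.mem_filter.2 ⟨hq, hi.trans hj.symm⟩⟩
  have hone : ∀ ij ∈ (Finset.univ : Finset (Fin ℓ × Fin ℓ)),
      ((P ×ˢ P).filter fun q => q.1 ij.1 = q.2 ij.2).card * W.card ≤ W.card ^ (2 * ℓ) := by
    rintro ⟨i, j⟩ -
    rw [← Finset.card_product]
    have : (P ×ˢ P).card = W.card ^ (2 * ℓ) := by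
      rw [Finset.card_product, hP, Fintype.card_piFinset_const, ← pow_add, two_mul]
    rw [← this]
    refine Finset.card_le_card_of_injOn (fun q => (q.1.1, Function.update q.1.2 j q.2)) ?_ ?_
    · rintro ⟨⟨τ, σ⟩, w⟩ h
      simp only [Finset.coe_product, Finset.coe_filter, Set.mem_prod, Finset.mem_coe,
        Finset.mem_product, hP, Fintype.mem_piFinset, Set.mem_ofPred_eq] at h ⊢
      refine ⟨h.1.1.1, fun k => ?_⟩
      by_cases hk : k = j
      · subst hk; simpa using h.2
      · simpa [Function.update_of_ne hk] using h.1.1.2 k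
    · rintro ⟨⟨τ, σ⟩, w⟩ h ⟨⟨τ', σ'⟩, w'⟩ h' heq
      simp only [Finset.coe_product, Finset.coe_filter, Set.mem_prod, Finset.mem_coe,
        Set.mem_ofPred_eq, Prod.mk.injEq] at h h' heq ⊢
      obtain ⟨rfl, heq⟩ := heq
      have hw : w = w' := by simpa using congrFun heq j
      refine ⟨⟨rfl, funext fun k => ?_⟩, hw⟩
      by_cases hk : k = j
      · subst hk; rw [← h.1.2, ← h'.1.2]
      · simpa [Function.update_of_ne hk] using congrFun heq k
  calc _ ≤ (∑ ij : Fin ℓ × Fin ℓ, ((P ×ˢ P).filter fun q => q.1 ij.1 = q.2 ij.2).card) *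
        W.card := Nat.mul_le_mul_right _ ((Finset.card_le_card hsub).trans Finset.card_biUnion_le)
    _ ≤ ∑ ij : Fin ℓ × Fin ℓ, W.card ^ (2 * ℓ) := by
        rw [Finset.sum_mul]; exact Finset.sum_le_sum hone
    _ = ℓ ^ 2 * W.card ^ (2 * ℓ) := by simp [sq]

/-- A large set of spokes typically has a dense component. -/
theorem real_dense_empty_le (h1 : OneIndependent μ) (W : Finset I) (hW : 0 < W.card)
    {p ε c δ : ℝ} (k : ℕ) (hp : 0 < p) (hδ : 0 < δ)
    (htip : ∀ t ∈ W, p ≤ μ.real {ω | t ∈ S.tip ω}) (hclash : μ.real {ω | S.Clash ω} ≤ ε)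
    (hnum : c ^ k ≤ p ^ (k + 1) - ε - δ) :
    μ.real {ω | dense c (S.adj ω) W = ∅} ≤ (k + 1) ^ 2 / δ ^ 2 / W.card := by
  classical
  set P := Fintype.piFinset fun _ : Fin (k + 1) => W with hP
  have hPcard : (P.card : ℝ) = (W.card : ℝ) ^ (k + 1) := by
    rw [hP, Fintype.card_piFinset_const]; push_cast; rfl
  -- All spokes share the centre, so their openness is not independent. Joins within the range of τ
  -- avoid the centre, so tuples with disjoint ranges give independent events.
  let E : (Fin (k + 1) → I) → Set (Config G) := fun τ =>
    {ω | ∀ i, (restr (S.adj ω) (Set.range τ)).Reachable (τ 0) (τ i)}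
  have hdet : ∀ τ, DetBy (S.reg (Set.range τ)) (E τ) := fun τ =>
    S.det_restr (Set.range τ) fun Γ => ∀ i, Γ.Reachable (τ 0) (τ i)
  have hE : ∀ τ ∈ P, MeasurableSet (E τ) := fun τ _ => (hdet τ).measurableSet (S.reg_finite _)
  -- Openness is used only here, for the mean: a tuple of open spokes is joined unless there is a
  -- clash.
  have hmean : (p ^ (k + 1) - ε) * (W.card : ℝ) ^ (k + 1) ≤ ∑ τ ∈ P, μ.real (E τ) := by
    have hmom := pow_le_sum_real_forall (μ := μ) W (E := fun t => {ω | t ∈ S.tip ω})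
      (fun t _ => S.measurableSet_tip t) hp htip (k + 1)
    have hle : ∀ τ ∈ P, μ.real (⋂ i, {ω | τ i ∈ S.tip ω}) - ε ≤ μ.real (E τ) := by
      intro τ _
      have hsub : (⋂ i, {ω | τ i ∈ S.tip ω}) ⊆ E τ ∪ {ω | S.Clash ω} := by
        intro ω hω
        simp only [Set.mem_iInter, Set.mem_ofPred_eq] at hω
        by_cases hcl : S.Clash ω
        · exact Or.inr hcl
        · refine Or.inl fun i => ?_
          by_cases heq : τ 0 = τ i
          · rw [heq]
          · refine SimpleGraph.Adj.reachable ⟨?_, ⟨0, rfl⟩, ⟨i, rfl⟩⟩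
            by_contra hadj
            exact hcl ⟨_, hω 0, _, hω i, heq, hadj⟩
      have := (measureReal_mono (μ := μ) hsub (measure_ne_top _ _)).trans (measureReal_union_le _ _)
      linarith
    have := Finset.sum_le_sum hle
    rw [Finset.sum_sub_distrib, Finset.sum_const, nsmul_eq_mul, hPcard] at this
    rw [mul_pow] at hmom
    linarith
  have hcov : ∑ τ ∈ P, ∑ σ ∈ P, (μ.real (E τ ∩ E σ) - μ.real (E τ) * μ.real (E σ)) ≤
      (k + 1) ^ 2 * (W.card : ℝ) ^ (2 * (k + 1)) / W.card := by
    rw [← Finset.sum_product']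
    have hmeet := card_meeting_le W (k + 1)
    rw [← hP] at hmeet
    have hterm : ∀ q ∈ P ×ˢ P, μ.real (E q.1 ∩ E q.2) - μ.real (E q.1) * μ.real (E q.2) ≤
        if ¬ Disjoint (Set.range q.1) (Set.range q.2) then 1 else 0 := by
      intro q _
      split_ifs with hd
      · rw [(hdet q.1).real_inter h1 (hdet q.2) (S.reg_finite _) (S.reg_finite _)
          (S.reg_disjoint hd), sub_self]
      · have h2 : μ.real (E q.1 ∩ E q.2) ≤ 1 := measureReal_le_one
        have h3 : 0 ≤ μ.real (E q.1) * μ.real (E q.2) := by positivity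
        linarith
    refine (Finset.sum_le_sum hterm).trans ?_
    rw [← Finset.sum_filter, Finset.sum_const, nsmul_eq_mul, mul_one, le_div_iff₀ (by positivity)]
    exact_mod_cast hmeet
  have hn : (0 : ℝ) < (W.card : ℝ) ^ (k + 1) := by positivity
  have hcheb := real_count_le_of_cov (μ := μ) P hE (d := δ * (W.card : ℝ) ^ (k + 1))
    (by positivity) hcov
  -- Absence of a dense component caps the count at c^k·|W|^(k+1), which by the numerical hypothesis
  -- is below the mean by δ·|W|^(k+1).
  have hsub : {ω | dense c (S.adj ω) W = ∅} ⊆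
      {ω | ∑ τ ∈ P, (E τ).indicator (fun _ => (1 : ℝ)) ω ≤
        ∑ τ ∈ P, μ.real (E τ) - δ * (W.card : ℝ) ^ (k + 1)} := by
    intro ω hω
    have hcount := card_joined_le (S.adj ω) W k hω
    rw [Set.mem_ofPred_eq, sum_indicator_eq_card]
    refine hcount.trans ?_
    nlinarith
  refine ((measureReal_mono hsub (measure_ne_top _ _)).trans hcheb).trans (le_of_eq ?_)
  field_simp
  ring

end Star

/-! ### Linking dense components -/

section Cells

set_option linter.unusedSectionVars false

variable {J : Type*} {n : ℕ}

/-- The spokes lying in the cells of `C`. -/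
def block (n : ℕ) (C : Finset J) : Finset (J × Fin n) := C ×ˢ Finset.univ

theorem mem_block {C : Finset J} {t : J × Fin n} : t ∈ block n C ↔ t.1 ∈ C := by
  simp [block]

theorem block_mono {C C' : Finset J} (h : C ⊆ C') : block n C ⊆ block n C' :=
  fun _ ht => mem_block.2 (h (mem_block.1 ht))

theorem card_block (C : Finset J) : (block n C).card = C.card * n := by simp [block]

theorem disjoint_block {C C' : Finset J} (h : Disjoint C C') :
    Disjoint (block n C : Set (J × Fin n)) (block n C') :=
  Set.disjoint_left.2 fun _ ht ht' =>
    Finset.disjoint_left.1 h (mem_block.1 ht) (mem_block.1 ht')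

/-- The cell `j` with the first `m` spokes replaced by those of the cell `j'`. -/
def mixedCell (n : ℕ) (j j' : J) (m : ℕ) : Finset (J × Fin n) :=
  Finset.univ.map ⟨fun i : Fin n => (if (i : ℕ) < m then j' else j, i),
    fun _ _ h => (Prod.ext_iff.1 h).2⟩

theorem card_mixedCell (j j' : J) (m : ℕ) : (mixedCell n j j' m).card = n := by
  simp [mixedCell]

theorem mem_mixedCell {j j' : J} {m : ℕ} {t : J × Fin n} :
    t ∈ mixedCell n j j' m ↔ t.1 = if (t.2 : ℕ) < m then j' else j := by
  obtain ⟨a, i⟩ := t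
  simp only [mixedCell, Finset.mem_map, Finset.mem_univ, true_and]
  constructor
  · rintro ⟨k, h⟩
    have h1 : (if (k : ℕ) < m then j' else j) = a := congrArg Prod.fst h
    have h2 : k = i := congrArg Prod.snd h
    rw [← h1, ← h2]
  · intro h
    exact ⟨i, Prod.ext h.symm rfl⟩

theorem mixedCell_zero (j j' : J) : mixedCell n j j' 0 = block n {j} := by
  ext t; simp [mem_mixedCell, mem_block]

theorem mixedCell_of_le (j j' : J) {m : ℕ} (h : n ≤ m) : mixedCell n j j' m = block n {j'} := by
  ext t
  have : (t.2 : ℕ) < m := t.2.2.trans_le h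
  simp [mem_mixedCell, mem_block, this]

variable [DecidableEq J]

theorem mixedCell_subset (j j' : J) (m : ℕ) : mixedCell n j j' m ⊆ block n {j, j'} := by
  intro t ht
  rw [mem_mixedCell] at ht
  rw [mem_block, ht]
  split_ifs <;> simp

theorem card_mixedCell_union (j j' : J) (m r : ℕ) :
    (mixedCell n j j' m ∪ mixedCell n j j' (m + r)).card ≤ n + r := by
  have hsub : mixedCell n j j' m ∪ mixedCell n j j' (m + r) ⊆ mixedCell n j j' m ∪
      ((Finset.univ.filter fun i : Fin n => m ≤ (i : ℕ) ∧ (i : ℕ) < m + r).image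
        fun i => (j', i)) := by
    intro t ht
    rw [Finset.mem_union] at ht ⊢
    rcases ht with h | h
    · exact Or.inl h
    · by_cases h1 : t ∈ mixedCell n j j' m
      · exact Or.inl h1
      · right
        rw [mem_mixedCell] at h h1
        rw [Finset.mem_image]
        by_cases hlt : (t.2 : ℕ) < m
        · rw [if_pos (by omega)] at h
          rw [if_pos hlt] at h1
          exact absurd h h1
        · by_cases hlt' : (t.2 : ℕ) < m + r
          · rw [if_pos hlt'] at h
            exact ⟨t.2, by simp; omega, by rw [← h]⟩
          · rw [if_neg hlt'] at h
            rw [if_neg hlt] at h1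
            exact absurd h h1
  refine (Finset.card_le_card hsub).trans ((Finset.card_union_le _ _).trans ?_)
  rw [card_mixedCell]
  refine Nat.add_le_add_left (Finset.card_image_le.trans ?_) _
  calc (Finset.univ.filter fun i : Fin n => m ≤ (i : ℕ) ∧ (i : ℕ) < m + r).card
      ≤ (Finset.Ico m (m + r)).card := by
        refine Finset.card_le_card_of_injOn (fun i => (i : ℕ)) ?_ Fin.val_injective.injOn
        intro i hi
        simpa using hi
    _ = r := by simp

/-- Both cells have dense components, and these are joined inside the two cells. -/
def Linked (Γ : SimpleGraph (J × Fin n)) (j j' : J) : Prop :=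
  (dense 0.54 Γ (block n {j})).Nonempty ∧ (dense 0.54 Γ (block n {j'})).Nonempty ∧
    ∀ a ∈ dense 0.54 Γ (block n {j}), ∀ b ∈ dense 0.54 Γ (block n {j'}),
      (restr Γ (block n {j, j'})).Reachable a b

/-- One cell is turned into the other in twenty steps, each replacing r = n/20 spokes. Consecutive
stages have a union of at most 1.05n spokes, while their dense classes total at least 1.08n, so they
intersect. -/
theorem linked_of_mixed {Γ : SimpleGraph (J × Fin n)} {j j' : J} {r : ℕ} (hn : n = 20 * r)
    (h : ∀ k ≤ 20, (dense 0.54 Γ (mixedCell n j j' (k * r))).Nonempty) : Linked Γ j j' := by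
  have key : ∀ k ≤ 20, ∀ a ∈ dense 0.54 Γ (block n {j}),
      ∀ b ∈ dense 0.54 Γ (mixedCell n j j' (k * r)),
        (restr Γ (block n {j, j'})).Reachable a b := by
    intro k
    induction k with
    | zero =>
      intro _ a ha b hb
      rw [zero_mul, mixedCell_zero] at hb
      refine (dense_reachable (by norm_num) ha hb).mono (restr_mono _ ?_)
      exact_mod_cast block_mono (by simp)
    | succ k ih =>
      intro hk a ha b hb
      obtain ⟨c, hc⟩ := h k (by omega)
      refine (ih (by omega) a ha c hc).trans ?_
      have hb' := hb
      rw [Nat.succ_mul] at hb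
      have hcard := card_mixedCell_union (n := n) j j' (k * r) r
      have hr : (restr Γ ↑(mixedCell n j j' (k * r) ∪ mixedCell n j j' (k * r + r))).Reachable
          c b := by
        refine exists_reachable_of_card Finset.subset_union_left Finset.subset_union_right
          (lt_of_le_of_lt hcard ?_)
        have h1 := hc.2
        have h2 := hb.2
        rw [card_mixedCell] at h1 h2
        have hn0 : 0 < n := by
          have := c.2.2
          omega
        have hnr : (n : ℝ) = 20 * r := by exact_mod_cast hn
        have hn1 : (0 : ℝ) < n := by exact_mod_cast hn0
        have : ((n + r : ℕ) : ℝ) < ((cls Γ (mixedCell n j j' (k * r)) c).card +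
            (cls Γ (mixedCell n j j' (k * r + r)) b).card : ℕ) := by
          push_cast; linarith
        exact_mod_cast this
      exact hr.mono (restr_mono _ (Finset.coe_subset.2
        (Finset.union_subset (mixedCell_subset _ _ _) (mixedCell_subset _ _ _))))
  have h0 := h 0 (by norm_num)
  have h20 := h 20 le_rfl
  rw [zero_mul, mixedCell_zero] at h0
  rw [mixedCell_of_le _ _ hn.le] at h20
  refine ⟨h0, h20, fun a ha b hb => key 20 le_rfl a ha b ?_⟩
  rwa [mixedCell_of_le _ _ hn.le]

theorem linked_restr (Γ : SimpleGraph (J × Fin n)) (j j' : J) :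
    Linked (restr Γ (block n {j, j'})) j j' ↔ Linked Γ j j' := by
  have h1 : (block n {j} : Set (J × Fin n)) ⊆ block n {j, j'} := by
    exact_mod_cast block_mono (by simp)
  have h2 : (block n {j'} : Set (J × Fin n)) ⊆ block n {j, j'} := by
    exact_mod_cast block_mono (by simp)
  simp only [Linked, dense_restr _ _ h1, dense_restr _ _ h2, restr_restr Γ (subset_refl _)]

/-- Either few elements meet all pairs in a relation, or there are many disjoint such pairs. -/
theorem exists_cover_or_matching (C : Finset J) (F : J → J → Prop) (q : ℕ) :
    (∃ D : Finset J, D.card ≤ 2 * q ∧ ∀ j ∈ C \ D, ∀ j' ∈ C \ D, ¬ F j j') ∨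
    ∃ s : Fin q → J × J, (∀ i, s i ∈ C ×ˢ C ∧ F (s i).1 (s i).2) ∧
      ∀ i i', i ≠ i' → Disjoint ({(s i).1, (s i).2} : Finset J) {(s i').1, (s i').2} := by
  induction q with
  | zero => exact Or.inr ⟨Fin.elim0, fun i => i.elim0, fun i => i.elim0⟩
  | succ q ih =>
    rcases ih with ⟨D, hD, h⟩ | ⟨s, hs, hd⟩
    · exact Or.inl ⟨D, by omega, h⟩
    -- Greedy choice: either the cells used so far meet every pair in the relation, or a pair
    -- avoiding them extends the matching.
    · set D : Finset J := Finset.univ.biUnion fun i : Fin q => {(s i).1, (s i).2} with hDdef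
      have hD : D.card ≤ 2 * q := by
        refine Finset.card_biUnion_le.trans ?_
        refine (Finset.sum_le_card_nsmul _ _ 2 fun i _ => Finset.card_le_two).trans ?_
        simp [mul_comm]
      by_cases hcov : ∀ j ∈ C \ D, ∀ j' ∈ C \ D, ¬ F j j'
      · exact Or.inl ⟨D, by omega, hcov⟩
      · push Not at hcov
        obtain ⟨j, hj, j', hj', hF⟩ := hcov
        rw [Finset.mem_sdiff] at hj hj'
        have hdis : ∀ i, Disjoint ({(s i).1, (s i).2} : Finset J) {j, j'} := by
          intro i
          rw [Finset.disjoint_left]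
          intro x hx hx'
          have hxD : x ∈ D := Finset.mem_biUnion.2 ⟨i, Finset.mem_univ _, hx⟩
          rcases Finset.mem_insert.1 hx' with rfl | hx'
          · exact hj.2 hxD
          · rw [Finset.mem_singleton] at hx'; subst hx'; exact hj'.2 hxD
        refine Or.inr ⟨Fin.snoc (α := fun _ => J × J) s (j, j'), fun i => ?_, fun i i' => ?_⟩
        · refine Fin.lastCases ?_ (fun i => ?_) i
          · simpa [hj.1, hj'.1] using hF
          · simpa using hs i
        · refine Fin.lastCases ?_ (fun i => ?_) i <;> refine Fin.lastCases ?_ (fun i' => ?_) i'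
          · simp
          · intro _; simpa using (hdis i').symm
          · intro _; simpa using hdis i
          · intro hne
            simpa using hd i i' fun h => hne (by rw [h])

/-- The dense classes of the cells outside D merge into one class. Its size is at least 0.54n(|C| -
2q), which is at least 0.53n|C| because |C| ≥ 108q. -/
theorem mem_dense_block {Γ : SimpleGraph (J × Fin n)} {C D : Finset J} {q : ℕ}
    (hD : D.card ≤ 2 * q) (hC : 108 * q ≤ C.card)
    (h : ∀ j ∈ C \ D, ∀ j' ∈ C \ D, Linked Γ j j') {j : J} (hj : j ∈ C \ D) {a : J × Fin n}
    (ha : a ∈ dense 0.54 Γ (block n {j})) : a ∈ dense 0.53 Γ (block n C) := by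
  have hjC : j ∈ C := (Finset.mem_sdiff.1 hj).1
  refine ⟨block_mono (by simpa using hjC) ha.1, ?_⟩
  have hex : ∀ j' : J, ∃ b, j' ∈ C \ D → b ∈ dense 0.54 Γ (block n {j'}) := by
    intro j'
    by_cases hj' : j' ∈ C \ D
    · obtain ⟨b, hb⟩ := (h j' hj' j' hj').1
      exact ⟨b, fun _ => hb⟩
    · exact ⟨a, fun h => absurd h hj'⟩
  choose b hb using hex
  have hsub : (C \ D).biUnion (fun j' => cls Γ (block n {j'}) (b j')) ⊆ cls Γ (block n C) a := by
    intro x hx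
    obtain ⟨j', hj', hx⟩ := Finset.mem_biUnion.1 hx
    have hj'C : j' ∈ C := (Finset.mem_sdiff.1 hj').1
    rw [mem_cls] at hx ⊢
    refine ⟨block_mono (by simpa using hj'C) hx.1, ?_⟩
    refine (((h j hj j' hj').2.2 a ha _ (hb j' hj')).mono (restr_mono _ ?_)).trans
      (hx.2.mono (restr_mono _ ?_))
    · exact_mod_cast block_mono (by
        intro y hy
        rcases Finset.mem_insert.1 hy with rfl | hy
        · exact hjC
        · rw [Finset.mem_singleton.1 hy]; exact hj'C)
    · exact_mod_cast block_mono (by simpa using hj'C)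
  have hcard := Finset.card_le_card hsub
  rw [Finset.card_biUnion] at hcard
  · have h1 : ∀ j' ∈ C \ D, 0.54 * (n : ℝ) ≤ (cls Γ (block n {j'}) (b j')).card := by
      intro j' hj'
      have := (hb j' hj').2
      rw [card_block] at this
      simpa using this
    have h2 : ((C \ D).card : ℝ) * (0.54 * n) ≤
        ((∑ j' ∈ C \ D, (cls Γ (block n {j'}) (b j')).card : ℕ) : ℝ) := by
      push_cast
      rw [← nsmul_eq_mul]
      exact Finset.card_nsmul_le_sum _ _ _ h1
    have h3 : ((∑ j' ∈ C \ D, (cls Γ (block n {j'}) (b j')).card : ℕ) : ℝ) ≤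
        (cls Γ (block n C) a).card := by exact_mod_cast hcard
    have h4 : (C.card : ℝ) - 2 * q ≤ (C \ D).card := by
      have := Finset.le_card_sdiff D C
      have h5 : C.card ≤ (C \ D).card + 2 * q := by omega
      have h6 : (C.card : ℝ) ≤ (C \ D).card + 2 * q := by exact_mod_cast h5
      linarith
    have h5 : 108 * (q : ℝ) ≤ C.card := by exact_mod_cast hC
    rw [card_block]
    push_cast
    refine le_trans ?_ (h2.trans h3)
    have hn : (0 : ℝ) ≤ n := Nat.cast_nonneg n
    calc 0.53 * ((C.card : ℝ) * n) = (0.53 * C.card) * n := by ring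
      _ ≤ (((C \ D).card : ℝ) * 0.54) * n := mul_le_mul_of_nonneg_right (by linarith) hn
      _ = _ := by ring
  · intro x _ y _ hxy
    rw [Function.onFun, Finset.disjoint_left]
    intro t ht ht'
    have h1 := mem_block.1 (mem_cls.1 ht).1
    have h2 := mem_block.1 (mem_cls.1 ht').1
    rw [Finset.mem_singleton] at h1 h2
    exact hxy (h1.symm.trans h2)

/-- All large blocks of cells of `C` have dense components, and these are nested. -/
def Coherent (M : ℕ) (C : Finset J) (Γ : SimpleGraph (J × Fin n)) : Prop :=
  ∀ A A' : Finset J, A ⊆ A' → A' ⊆ C → M ≤ A.card →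
    (dense 0.53 Γ (block n A)).Nonempty ∧ dense 0.53 Γ (block n A) ⊆ dense 0.53 Γ (block n A')

/-- One cell of A outside D supplies a spoke that is dense both in A and in A'. Uniqueness of the
dense component then carries the whole dense part of A into that of A'. -/
theorem coherent_of_cover {Γ : SimpleGraph (J × Fin n)} {C D : Finset J} {q M : ℕ}
    (hD : D.card ≤ 2 * q) (hM : 108 * q < M)
    (h : ∀ j ∈ C \ D, ∀ j' ∈ C \ D, Linked Γ j j') : Coherent M C Γ := by
  intro A A' hA hA' hcard
  have hsub : ∀ {B : Finset J}, B ⊆ C → ∀ j ∈ B \ D, ∀ j' ∈ B \ D, Linked Γ j j' :=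
    fun hB j hj j' hj' => h j (Finset.sdiff_subset_sdiff hB subset_rfl hj) j'
      (Finset.sdiff_subset_sdiff hB subset_rfl hj')
  have hne : (A \ D).Nonempty := by
    rw [← Finset.card_pos]
    have := Finset.le_card_sdiff D A
    omega
  obtain ⟨j, hj⟩ := hne
  obtain ⟨a, ha⟩ := (hsub (hA.trans hA') j hj j hj).1
  have h1 : a ∈ dense 0.53 Γ (block n A) :=
    mem_dense_block hD (by omega) (hsub (hA.trans hA')) hj ha
  have h2 : a ∈ dense 0.53 Γ (block n A') :=
    mem_dense_block hD ((by omega : 108 * q ≤ A.card).trans (Finset.card_le_card hA)) (hsub hA')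
      (Finset.sdiff_subset_sdiff hA subset_rfl hj) ha
  refine ⟨⟨a, h1⟩, fun b hb => mem_dense_of_reachable h2 (block_mono hA hb.1) ?_⟩
  refine (dense_reachable (by norm_num) h1 hb).mono (restr_mono _ ?_)
  exact_mod_cast block_mono hA

theorem card_dense_ge {Γ : SimpleGraph (J × Fin n)} {W : Finset (J × Fin n)} {c : ℝ}
    (h : (dense c Γ W).Nonempty) [DecidablePred (· ∈ dense c Γ W)] :
    c * W.card ≤ (W.filter (· ∈ dense c Γ W)).card := by
  obtain ⟨a, ha⟩ := h
  refine ha.2.trans ?_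
  refine Nat.cast_le.2 (Finset.card_le_card fun b hb => ?_)
  rw [mem_cls] at hb
  exact Finset.mem_filter.2 ⟨hb.1, mem_dense_of_reachable ha hb.1 hb.2⟩

end Cells

/-! ### Probability of coherence in a star. -/

namespace Star

set_option linter.unusedSectionVars false

variable {V J : Type*} [DecidableEq J] {n : ℕ} {G : SimpleGraph V} (S : Star G (J × Fin n))
  {μ : Measure (Config G)} [IsProbabilityMeasure μ]

theorem real_not_linked_le {j j' : J} {r : ℕ} (hn : n = 20 * r) {η : ℝ}
    (h : ∀ W : Finset (J × Fin n), W.card = n → W ⊆ block n {j, j'} →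
      μ.real {ω | dense 0.54 (S.adj ω) W = ∅} ≤ η) :
    μ.real {ω | ¬ Linked (S.adj ω) j j'} ≤ 21 * η := by
  have hsub : {ω | ¬ Linked (S.adj ω) j j'} ⊆ ⋃ k ∈ Finset.range 21,
      {ω | dense 0.54 (S.adj ω) (mixedCell n j j' (k * r)) = ∅} := by
    intro ω hω
    by_contra hcon
    refine hω (linked_of_mixed hn fun k hk => ?_)
    simp only [Set.mem_iUnion, not_exists] at hcon
    exact Set.nonempty_iff_ne_empty.2 (hcon k (Finset.mem_range.2 (by omega)))
  refine (measureReal_mono hsub (measure_ne_top _ _)).trans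
    ((measureReal_biUnion_finset_le _ _).trans ?_)
  refine (Finset.sum_le_card_nsmul _ _ η fun k _ => h _ (card_mixedCell _ _ _)
    (mixedCell_subset _ _ _)).trans (le_of_eq ?_)
  simp

/-- Failure of coherence is unlikely to a high order. -/
theorem real_not_coherent_le (h1 : OneIndependent μ) {C : Finset J} {r q M : ℕ} (hn : n = 20 * r)
    (hM : 108 * q < M) {η : ℝ} (hη : 0 ≤ η)
    (h : ∀ W : Finset (J × Fin n), W.card = n → W ⊆ block n C →
      μ.real {ω | dense 0.54 (S.adj ω) W = ∅} ≤ η) :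
    μ.real {ω | ¬ Coherent M C (S.adj ω)} ≤ (C.card ^ 2 * (21 * η)) ^ q := by
  classical
  let Q := (Fintype.piFinset fun _ : Fin q => C ×ˢ C).filter fun s =>
    ∀ i i', i ≠ i' → Disjoint ({(s i).1, (s i).2} : Finset J) {(s i').1, (s i').2}
  let E : J × J → Set (Config G) := fun x => {ω | ¬ Linked (S.adj ω) x.1 x.2}
  have hdet : ∀ x : J × J, DetBy (S.reg (block n {x.1, x.2})) (E x) := by
    intro x
    have := S.det_restr (block n {x.1, x.2}) fun Γ => ¬ Linked Γ x.1 x.2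
    simpa only [linked_restr] using this
  -- Incoherence forces q disjoint unlinked pairs, and these are independent. The resulting q-th
  -- power is needed because a later union bound runs over all rows, whose number exceeds n, whereas
  -- a single link failure is only bounded by order 1/n.
  have hsub : {ω | ¬ Coherent M C (S.adj ω)} ⊆ ⋃ s ∈ Q, ⋂ i ∈ (Finset.univ : Finset (Fin q)),
      E (s i) := by
    intro ω hω
    rcases exists_cover_or_matching C (fun j j' => ¬ Linked (S.adj ω) j j') q with
      ⟨D, hD, hcov⟩ | ⟨s, hs, hd⟩
    · refine absurd (coherent_of_cover hD hM fun j hj j' hj' => ?_) hω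
      exact not_not.1 (hcov j hj j' hj')
    · simp only [Set.mem_iUnion, Set.mem_iInter]
      refine ⟨s, ?_, fun i _ => (hs i).2⟩
      exact Finset.mem_filter.2 ⟨Fintype.mem_piFinset.2 fun i => (hs i).1, hd⟩
  refine (measureReal_mono hsub (measure_ne_top _ _)).trans
    ((measureReal_biUnion_finset_le _ _).trans ?_)
  have hterm : ∀ s ∈ Q, μ.real (⋂ i ∈ (Finset.univ : Finset (Fin q)), E (s i)) ≤
      (21 * η) ^ q := by
    intro s hs
    obtain ⟨hs1, hs2⟩ := Finset.mem_filter.1 hs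
    rw [DetBy.real_biInter h1 Finset.univ (fun i => S.reg (block n {(s i).1, (s i).2}))
      (fun i => E (s i)) (fun i _ => hdet (s i)) (fun i _ => S.reg_finite _)
      fun i _ i' _ hne => S.reg_disjoint (disjoint_block (hs2 i i' hne))]
    calc ∏ i, μ.real (E (s i)) ≤ ∏ _i : Fin q, 21 * η := by
          refine Finset.prod_le_prod (fun i _ => measureReal_nonneg) fun i _ => ?_
          refine S.real_not_linked_le hn fun W hW hW' => h W hW (hW'.trans (block_mono ?_))
          have := Finset.mem_product.1 (Fintype.mem_piFinset.1 hs1 i)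
          intro x hx
          rcases Finset.mem_insert.1 hx with rfl | hx
          · exact this.1
          · rw [Finset.mem_singleton.1 hx]; exact this.2
      _ = _ := by simp
  refine (Finset.sum_le_card_nsmul _ _ _ hterm).trans ?_
  rw [nsmul_eq_mul, mul_pow ((C.card : ℝ) ^ 2)]
  have h0 : 0 ≤ (21 * η) ^ q := by positivity
  refine mul_le_mul_of_nonneg_right ?_ h0
  have : Q.card ≤ (C.card ^ 2) ^ q := by
    refine (Finset.card_filter_le _ _).trans ?_
    rw [Fintype.card_piFinset_const, Finset.card_product, sq]
  exact_mod_cast this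

theorem det_coherent (M : ℕ) (C : Finset J) :
    DetBy (S.reg (block n C)) {ω | Coherent M C (S.adj ω)} := by
  have := S.det_restr (block n C) fun Γ => Coherent M C Γ
  have h2 : ∀ Γ : SimpleGraph (J × Fin n), Coherent M C (restr Γ (block n C)) ↔
      Coherent M C Γ := by
    intro Γ
    refine forall_congr' fun A => forall_congr' fun A' => forall_congr' fun hA =>
      forall_congr' fun hA' => ?_
    have e1 : (block n A : Set (J × Fin n)) ⊆ block n C := by
      exact_mod_cast block_mono (hA.trans hA')
    have e2 : (block n A' : Set (J × Fin n)) ⊆ block n C := by exact_mod_cast block_mono hA'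
    rw [dense_restr _ _ e1, dense_restr _ _ e2]
  simpa only [h2] using this

end Star

/-! ### Regular spokes -/

/-- Cells are indexed by a group, a binary code and a serial number. -/
abbrev Cell (H : Type*) (K M : ℕ) : Type _ := H × (Fin K → Bool) × Fin M

section Levels

variable {H : Type*} {K M n : ℕ}

/-- The cells of a group whose code agrees with `c` from position `i` on. -/
def levelCells (M : ℕ) (h : H) (i : ℕ) (c : Fin K → Bool) : Finset (Cell H K M) :=
  {h} ×ˢ ((Finset.univ.filter fun c' => ∀ k : Fin K, i ≤ k → c' k = c k) ×ˢ Finset.univ)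

theorem mem_levelCells {h : H} {i : ℕ} {c : Fin K → Bool} {j : Cell H K M} :
    j ∈ levelCells M h i c ↔ j.1 = h ∧ ∀ k : Fin K, i ≤ k → j.2.1 k = c k := by
  simp only [levelCells, Finset.mem_product, Finset.mem_singleton, Finset.mem_filter,
    Finset.mem_univ, true_and, and_true]

/-- All the cells of a group. -/
def groupCells (K M : ℕ) (h : H) : Finset (Cell H K M) := {h} ×ˢ Finset.univ

theorem mem_groupCells {h : H} {j : Cell H K M} : j ∈ groupCells K M h ↔ j.1 = h := by
  simp only [groupCells, Finset.mem_product, Finset.mem_singleton, Finset.mem_univ, and_true]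

theorem card_groupCells (h : H) : (groupCells K M h).card = 2 ^ K * M := by
  simp [groupCells]

theorem levelCells_subset (h : H) (i : ℕ) (c : Fin K → Bool) :
    levelCells M h i c ⊆ groupCells K M h :=
  fun _ hj => mem_groupCells.2 (mem_levelCells.1 hj).1

theorem le_card_levelCells (h : H) (i : ℕ) (c : Fin K → Bool) :
    M ≤ (levelCells M h i c).card := by
  calc M = (Finset.univ.map (⟨fun m : Fin M => ((h, c, m) : Cell H K M),
        fun _ _ h => by simpa using h⟩)).card := by simp
    _ ≤ _ := by
        refine Finset.card_le_card fun j hj => ?_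
        obtain ⟨m, -, rfl⟩ := Finset.mem_map.1 hj
        exact mem_levelCells.2 ⟨rfl, fun _ _ => rfl⟩

theorem levelCells_congr {h : H} {i : ℕ} {c c' : Fin K → Bool}
    (hc : ∀ k : Fin K, i ≤ k → c k = c' k) : levelCells M h i c = levelCells M h i c' := by
  ext j
  rw [mem_levelCells, mem_levelCells]
  exact and_congr_right fun _ => forall_congr' fun k => forall_congr' fun hk => by rw [hc k hk]

/-- Negation of one digit of a code. -/
def flipCode (i : Fin K) (c : Fin K → Bool) : Fin K → Bool := Function.update c i (!c i)

theorem flipCode_flipCode (i : Fin K) (c : Fin K → Bool) : flipCode i (flipCode i c) = c := by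
  simp [flipCode]

theorem levelCells_succ (h : H) (i : Fin K) (c : Fin K → Bool) :
    levelCells M h i c ⊆ levelCells M h (i + 1) c := fun j hj => by
  rw [mem_levelCells] at hj ⊢
  exact ⟨hj.1, fun k hk => hj.2 k (by omega)⟩

theorem levelCells_flip_succ (h : H) (i : Fin K) (c : Fin K → Bool) :
    levelCells M h i (flipCode i c) ⊆ levelCells M h (i + 1) c := fun j hj => by
  rw [mem_levelCells] at hj ⊢
  refine ⟨hj.1, fun k hk => ?_⟩
  rw [hj.2 k (by omega), flipCode, Function.update_of_ne]
  rintro rfl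
  omega

theorem disjoint_levelCells_flip (h : H) (i : Fin K) (c : Fin K → Bool) :
    Disjoint (levelCells M h i c) (levelCells M h i (flipCode i c)) := by
  rw [Finset.disjoint_left]
  intro j hj hj'
  have h1 := (mem_levelCells.1 hj).2 i le_rfl
  have h2 := (mem_levelCells.1 hj').2 i le_rfl
  rw [h1] at h2
  simp [flipCode] at h2

/-- The block of level `i` around a spoke. -/
def levelBlock (i : ℕ) (t : Cell H K M × Fin n) : Finset (Cell H K M × Fin n) :=
  block n (levelCells M t.1.1 i t.1.2.1)

/-- The spoke with one digit of the code negated. -/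
def flipSpoke (i : Fin K) (t : Cell H K M × Fin n) : Cell H K M × Fin n :=
  ((t.1.1, flipCode i t.1.2.1, t.1.2.2), t.2)

theorem flipSpoke_flipSpoke (i : Fin K) (t : Cell H K M × Fin n) :
    flipSpoke i (flipSpoke i t) = t := by simp [flipSpoke, flipCode_flipCode]

theorem mem_levelBlock_self (i : ℕ) (t : Cell H K M × Fin n) : t ∈ levelBlock i t :=
  mem_block.2 (mem_levelCells.2 ⟨rfl, fun _ _ => rfl⟩)

theorem levelBlock_eq {i : ℕ} {t t' : Cell H K M × Fin n} (h : t' ∈ levelBlock i t) :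
    levelBlock i t' = levelBlock i t := by
  obtain ⟨h1, h2⟩ := mem_levelCells.1 (mem_block.1 h)
  rw [levelBlock, levelBlock, h1, levelCells_congr h2]

/-- The sibling block depends only on the block, so the event that the centre reaches it is common
to all spokes of the block. -/
theorem levelBlock_flip_eq {i : Fin K} {t t' : Cell H K M × Fin n} (h : t' ∈ levelBlock i t) :
    levelBlock i (flipSpoke i t') = levelBlock i (flipSpoke i t) := by
  obtain ⟨h1, h2⟩ := mem_levelCells.1 (mem_block.1 h)
  rw [levelBlock, levelBlock]
  simp only [flipSpoke]
  rw [h1, levelCells_congr]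
  intro k hk
  by_cases hki : k = i
  · subst hki; simp [flipCode, h2 k le_rfl]
  · simp [flipCode, Function.update_of_ne hki, h2 k hk]

theorem levelBlock_subset_group (i : ℕ) (t : Cell H K M × Fin n) :
    levelBlock i t ⊆ block n (groupCells K M t.1.1) :=
  block_mono (levelCells_subset _ _ _)

/-- Averages over level blocks preserve sums. -/
theorem sum_average_levelBlock [DecidableEq H] (i : ℕ) (h : H) (f : Cell H K M × Fin n → ℝ) :
    ∑ t ∈ block n (groupCells K M h), (∑ t' ∈ levelBlock i t, f t') / (levelBlock i t).card =
      ∑ t ∈ block n (groupCells K M h), f t := by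
  have e1 : ∀ t ∈ block n (groupCells K M h),
      (∑ t' ∈ levelBlock i t, f t') / (levelBlock i t).card =
        ∑ t' ∈ levelBlock i t, f t' / (levelBlock i t').card := by
    intro t _
    rw [Finset.sum_div]
    exact Finset.sum_congr rfl fun t' ht' => by rw [levelBlock_eq ht']
  rw [Finset.sum_congr rfl e1,
    Finset.sum_comm' (s' := fun t' => levelBlock i t') (t' := block n (groupCells K M h))]
  · refine Finset.sum_congr rfl fun t _ => ?_
    have hpos : (0 : ℝ) < (levelBlock i t).card := by
      exact_mod_cast Finset.card_pos.2 ⟨t, mem_levelBlock_self i t⟩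
    rw [Finset.sum_const, nsmul_eq_mul]
    field_simp
  · intro t t'
    constructor
    · rintro ⟨h1, h2⟩
      refine ⟨by rw [levelBlock_eq h2]; exact mem_levelBlock_self i t, ?_⟩
      rw [mem_block, mem_groupCells] at h1 ⊢
      rw [← h1]; exact (mem_levelCells.1 (mem_block.1 h2)).1
    · rintro ⟨h1, h2⟩
      refine ⟨?_, by rw [levelBlock_eq h1]; exact mem_levelBlock_self i t'⟩
      rw [mem_block, mem_groupCells] at h2 ⊢
      rw [← h2]; exact (mem_levelCells.1 (mem_block.1 h1)).1

theorem card_filter_lt_mul_le {α : Type*} (F : Finset α) (f : α → ℝ) (hf : ∀ a ∈ F, 0 ≤ f a)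
    {c : ℝ} : (F.filter fun a => c < f a).card * c ≤ ∑ a ∈ F, f a := by
  rw [← nsmul_eq_mul]
  refine (Finset.card_nsmul_le_sum (F.filter fun a => c < f a) f c fun a ha =>
    (Finset.mem_filter.1 ha).2.le).trans ?_
  exact Finset.sum_le_sum_of_subset_of_nonneg (Finset.filter_subset _ _) fun a ha _ => hf a ha

end Levels

/-! ### The increment argument over the levels of a group. -/

namespace Star

variable {V H : Type*} {K M n : ℕ} {G : SimpleGraph V}
  (S : Star G (Cell H K M × Fin n)) (μ : Measure (Config G))

/-- The spoke `t` is regular in its group `h`: there are events local to the group which force the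
far end of `t`, respectively the centre, to be attached to the main component, with
probabilities that are jointly large. -/
def Regular (C : Finset (Cell H K M)) (h : H) (t : Cell H K M × Fin n) : Prop :=
  ∃ X Y : Set (Config G), DetBy (S.reg (block n (groupCells K M h))) X ∧
    DetBy (insert S.center (S.reg (block n (groupCells K M h)))) Y ∧
    (∀ ω ∈ X, Coherent M C (S.adj ω) → t ∈ dense 0.53 (S.adj ω) (block n C)) ∧
    (∀ ω ∈ Y, Coherent M C (S.adj ω) → ∃ s ∈ S.tip ω, s ∈ dense 0.53 (S.adj ω) (block n C)) ∧
    -- The constant comes from 2·(0.5847 - 0.03) - 1 = 0.1094, where 0.03 is the permitted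
    -- deviation.
    1 / 2 < μ.real X ∧ 1 / 2 < μ.real Y ∧ 0.109 ≤ (2 * μ.real X - 1) * (2 * μ.real Y - 1)

/-- The far end of `t` lies in the dense part of its block. -/
def inBlock (i : ℕ) (t : Cell H K M × Fin n) : Set (Config G) :=
  {ω | t ∈ dense 0.53 (S.adj ω) (levelBlock i t)}

/-- Some open spoke leads to the dense part of the block of `t`. -/
def tipMeets (i : ℕ) (t : Cell H K M × Fin n) : Set (Config G) :=
  {ω | ∃ s ∈ S.tip ω, s ∈ dense 0.53 (S.adj ω) (levelBlock i t)}

theorem det_inBlock (i : ℕ) (t : Cell H K M × Fin n) :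
    DetBy (S.reg (levelBlock i t)) (S.inBlock i t) :=
  S.det_dense 0.53 (levelBlock i t) fun A => t ∈ A

theorem det_tipMeets (i : ℕ) (t : Cell H K M × Fin n) :
    DetBy (insert S.center (S.reg (levelBlock i t))) (S.tipMeets i t) := by
  have : S.tipMeets i t = ⋃ s, ⋃ _ : s ∈ levelBlock i t, {ω | s ∈ S.tip ω} ∩
      {ω | s ∈ dense 0.53 (S.adj ω) (levelBlock i t)} := by
    ext ω
    simp only [tipMeets, Set.mem_ofPred_eq, Set.mem_iUnion, Set.mem_inter_iff]
    exact ⟨fun ⟨s, h1, h2⟩ => ⟨s, h2.1, h1, h2⟩, fun ⟨s, _, h1, h2⟩ => ⟨s, h1, h2⟩⟩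
  rw [this]
  refine DetBy.iUnion fun s => DetBy.iUnion fun hs => DetBy.inter ?_ ?_
  · refine (S.det_tip s).mono (Set.insert_subset_insert (S.reg_mono ?_))
    simpa using hs
  · exact (S.det_dense 0.53 (levelBlock i t) fun A => s ∈ A).mono (Set.subset_insert _ _)

/-- An open spoke whose two sides disagree. -/
def deviation (i : Fin K) (t : Cell H K M × Fin n) : Set (Config G) :=
  {ω | t ∈ S.tip ω ∧ (ω ∈ S.inBlock i t ↔ ω ∉ S.tipMeets i (flipSpoke i t))}

variable {μ} [IsProbabilityMeasure μ]

/-- A disagreement becomes progress one level up. If the centre reaches the sibling but t is not in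
its own dense part, then, absent a clash, t is joined to the dense part of the union. If t is dense
but the centre misses the sibling, the open spoke t itself attaches the centre to that union.
Coherence supplies the nesting of dense parts. -/
theorem real_deviation_le {C : Finset (Cell H K M)} {ε l : ℝ} (i : Fin K)
    (t : Cell H K M × Fin n) (hC : groupCells K M t.1.1 ⊆ C)
    (hclash : μ.real {ω | S.Clash ω} ≤ ε)
    (hcoh : μ.real {ω | ¬ Coherent M C (S.adj ω)} ≤ l) :
    μ.real (S.deviation i t) ≤ (μ.real (S.inBlock (i + 1) t) - μ.real (S.inBlock i t)) +
      (μ.real (S.tipMeets (i + 1) t) - μ.real (S.tipMeets i (flipSpoke i t))) + (ε + 2 * l) := by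
  have nest : ∀ ω, Coherent M C (S.adj ω) →
      dense 0.53 (S.adj ω) (levelBlock i t) ⊆ dense 0.53 (S.adj ω) (levelBlock (i + 1) t) :=
    fun ω hω => (hω _ _ (levelCells_succ _ i _) ((levelCells_subset _ _ _).trans hC)
      (le_card_levelCells _ _ _)).2
  have nest' : ∀ ω, Coherent M C (S.adj ω) →
      dense 0.53 (S.adj ω) (levelBlock i (flipSpoke i t)) ⊆
        dense 0.53 (S.adj ω) (levelBlock (i + 1) t) :=
    fun ω hω => (hω _ _ (levelCells_flip_succ _ i _) ((levelCells_subset _ _ _).trans hC)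
      (le_card_levelCells _ _ _)).2
  set D1 : Set (Config G) := {ω | t ∈ S.tip ω ∧ ω ∉ S.inBlock i t ∧
    ω ∈ S.tipMeets i (flipSpoke i t)} with hD1
  set D2 : Set (Config G) := {ω | t ∈ S.tip ω ∧ ω ∈ S.inBlock i t ∧
    ω ∉ S.tipMeets i (flipSpoke i t)} with hD2
  have hX : MeasurableSet (S.inBlock i t) := (S.det_inBlock _ _).measurableSet (S.reg_finite _)
  have hY : MeasurableSet (S.tipMeets i (flipSpoke i t)) :=
    (S.det_tipMeets _ _).measurableSet (S.finite_insert _)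
  have hdev : S.deviation i t ⊆ D1 ∪ D2 := by
    rintro ω ⟨h1, h2⟩
    by_cases hx : ω ∈ S.inBlock i t
    · exact Or.inr ⟨h1, hx, h2.1 hx⟩
    · exact Or.inl ⟨h1, hx, by by_contra hy; exact hx (h2.2 hy)⟩
  have hd1 : D1 ∪ S.inBlock i t ⊆ S.inBlock (i + 1) t ∪ ({ω | S.Clash ω} ∪
      {ω | ¬ Coherent M C (S.adj ω)}) := by
    intro ω hω
    by_cases hco : Coherent M C (S.adj ω)
    swap
    · exact Or.inr (Or.inr hco)
    by_cases hcl : S.Clash ω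
    · exact Or.inr (Or.inl hcl)
    left
    rcases hω with ⟨h1, -, s, hs, hs'⟩ | hω
    · have hs2 := nest' ω hco hs'
      refine mem_dense_of_reachable hs2 (mem_levelBlock_self _ _) ?_
      have hne : s ≠ t := by
        rintro rfl
        exact Finset.disjoint_left.1 (disjoint_levelCells_flip _ _ _)
          (mem_block.1 (mem_levelBlock_self i s)) (mem_block.1 hs'.1)
      refine SimpleGraph.Adj.reachable ⟨?_, hs2.1, mem_levelBlock_self _ _⟩
      by_contra hadj
      exact hcl ⟨s, hs, t, h1, hne, hadj⟩
    · exact nest ω hco hω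
  have hd2 : D2 ∪ S.tipMeets i (flipSpoke i t) ⊆ S.tipMeets (i + 1) t ∪
      {ω | ¬ Coherent M C (S.adj ω)} := by
    intro ω hω
    by_cases hco : Coherent M C (S.adj ω)
    swap
    · exact Or.inr hco
    left
    rcases hω with ⟨h1, h2, -⟩ | ⟨s, hs, hs'⟩
    · exact ⟨t, h1, nest ω hco h2⟩
    · exact ⟨s, hs, nest' ω hco hs'⟩
  have e1 : μ.real (D1 ∪ S.inBlock i t) = μ.real D1 + μ.real (S.inBlock i t) :=
    measureReal_union (Set.disjoint_left.2 fun ω h h' => h.2.1 h') hX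
  have e2 : μ.real (D2 ∪ S.tipMeets i (flipSpoke i t)) =
      μ.real D2 + μ.real (S.tipMeets i (flipSpoke i t)) :=
    measureReal_union (Set.disjoint_left.2 fun ω h h' => h.2.2 h') hY
  have f1 := measureReal_mono (μ := μ) hd1 (measure_ne_top _ _)
  have f2 := measureReal_mono (μ := μ) hd2 (measure_ne_top _ _)
  have f3 := measureReal_mono (μ := μ) hdev (measure_ne_top _ _)
  have g1 := measureReal_union_le (μ := μ) (S.inBlock (i + 1) t)
    ({ω | S.Clash ω} ∪ {ω | ¬ Coherent M C (S.adj ω)})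
  have g2 := measureReal_union_le (μ := μ) {ω | S.Clash ω} {ω | ¬ Coherent M C (S.adj ω)}
  have g3 := measureReal_union_le (μ := μ) (S.tipMeets (i + 1) t) {ω | ¬ Coherent M C (S.adj ω)}
  have g4 := measureReal_union_le (μ := μ) D1 D2
  linarith

/-- The total Φ of both probabilities over the group stays between 0 and twice the number of spokes,
so its K increments average at most 2/K per spoke. Flipping a digit permutes the group, which
replaces the sibling terms by Φ itself. -/
theorem exists_level {C : Finset (Cell H K M)} {ε l : ℝ} (h : H) (hK : 0 < K)
    (hC : groupCells K M h ⊆ C) (hclash : μ.real {ω | S.Clash ω} ≤ ε)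
    (hcoh : μ.real {ω | ¬ Coherent M C (S.adj ω)} ≤ l) :
    ∃ i : Fin K, ∑ t ∈ block n (groupCells K M h), μ.real (S.deviation i t) ≤
      (block n (groupCells K M h)).card * (2 / K + ε + 2 * l) := by
  set F := block n (groupCells K M h) with hF
  let Φ : ℕ → ℝ := fun i => ∑ t ∈ F, (μ.real (S.inBlock i t) + μ.real (S.tipMeets i t))
  have hstep : ∀ i : Fin K, ∑ t ∈ F, μ.real (S.deviation i t) ≤
      Φ (i + 1) - Φ i + F.card * (ε + 2 * l) := by
    intro i
    have hflip : ∑ t ∈ F, μ.real (S.tipMeets i (flipSpoke i t)) =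
        ∑ t ∈ F, μ.real (S.tipMeets i t) := by
      refine Finset.sum_nbij' (flipSpoke i) (flipSpoke i) ?_ ?_
        (fun t _ => flipSpoke_flipSpoke i t) (fun t _ => flipSpoke_flipSpoke i t) fun t _ => rfl
      all_goals
        intro t ht
        rw [hF, mem_block, mem_groupCells] at ht ⊢
        exact ht
    calc ∑ t ∈ F, μ.real (S.deviation i t) ≤ ∑ t ∈ F, ((μ.real (S.inBlock (i + 1) t) -
          μ.real (S.inBlock i t)) + (μ.real (S.tipMeets (i + 1) t) -
          μ.real (S.tipMeets i (flipSpoke i t))) + (ε + 2 * l)) := by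
          refine Finset.sum_le_sum fun t ht => S.real_deviation_le i t ?_ hclash hcoh
          rw [hF, mem_block, mem_groupCells] at ht
          rwa [ht]
      _ = _ := by
          simp only [Finset.sum_add_distrib, Finset.sum_sub_distrib, hflip, Finset.sum_const,
            nsmul_eq_mul, Φ]
          ring
  have hΦ0 : 0 ≤ Φ 0 := Finset.sum_nonneg fun t _ => by positivity
  have hΦK : Φ K ≤ 2 * F.card := by
    refine (Finset.sum_le_card_nsmul _ _ 2 fun t _ => ?_).trans (by rw [nsmul_eq_mul, mul_comm])
    have h1 : μ.real (S.inBlock K t) ≤ 1 := measureReal_le_one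
    have h2 : μ.real (S.tipMeets K t) ≤ 1 := measureReal_le_one
    linarith
  have htel : ∑ i : Fin K, (Φ (i + 1) - Φ i) = Φ K - Φ 0 := by
    rw [Fin.sum_univ_eq_sum_range (fun i => Φ (i + 1) - Φ i) K, Finset.sum_range_sub]
  have hsum : ∑ i : Fin K, ∑ t ∈ F, μ.real (S.deviation i t) ≤
      ∑ _i : Fin K, F.card * (2 / K + ε + 2 * l) := by
    refine (Finset.sum_le_sum fun i _ => hstep i).trans ?_
    rw [Finset.sum_add_distrib, htel, Finset.sum_const, Finset.sum_const, Finset.card_univ,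
      Fintype.card_fin, nsmul_eq_mul, nsmul_eq_mul]
    have hK' : (0 : ℝ) < K := by exact_mod_cast hK
    have : (K : ℝ) * (F.card * (2 / K + ε + 2 * l)) =
        2 * F.card + K * (F.card * (ε + 2 * l)) := by field_simp; ring
    rw [this]
    linarith
  have : Nonempty (Fin K) := ⟨⟨0, hK⟩⟩
  obtain ⟨i, -, hi⟩ := Finset.exists_le_of_sum_le Finset.univ_nonempty hsum
  exact ⟨i, hi⟩

theorem disjoint_reg_flip (i : Fin K) (t : Cell H K M × Fin n) :
    Disjoint (S.reg (levelBlock i t))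
      (insert S.center (S.reg (levelBlock i (flipSpoke i t)))) := by
  rw [Set.disjoint_insert_right]
  exact ⟨S.center_notMem _, S.reg_disjoint (disjoint_block (disjoint_levelCells_flip _ _ _))⟩

/-- An open spoke without deviation makes the two events agree. They are independent: they live on
the region of a block and on that of its sibling, with the centre belonging to the latter side only.
-/
theorem tip_le_agreement (h1 : OneIndependent μ) (i : Fin K) (t : Cell H K M × Fin n) :
    μ.real {ω | t ∈ S.tip ω} ≤ μ.real (S.deviation i t) +
      (μ.real (S.inBlock i t) * μ.real (S.tipMeets i (flipSpoke i t)) +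
      (1 - μ.real (S.inBlock i t)) * (1 - μ.real (S.tipMeets i (flipSpoke i t)))) := by
  have hX := S.det_inBlock i t
  have hY := S.det_tipMeets i (flipSpoke i t)
  have hd := S.disjoint_reg_flip i t
  have e1 := hX.real_inter h1 hY (S.reg_finite _) (S.finite_insert _) hd
  have e2 := hX.compl.real_inter h1 hY.compl (S.reg_finite _) (S.finite_insert _) hd
  rw [real_compl_eq hX (S.reg_finite _), real_compl_eq hY (S.finite_insert _)] at e2
  rw [← e1, ← e2]
  have hsub : {ω | t ∈ S.tip ω} ⊆ S.deviation i t ∪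
      ((S.inBlock i t ∩ S.tipMeets i (flipSpoke i t)) ∪
      ((S.inBlock i t)ᶜ ∩ (S.tipMeets i (flipSpoke i t))ᶜ)) := by
    intro ω hω
    by_cases hx : ω ∈ S.inBlock i t <;> by_cases hy : ω ∈ S.tipMeets i (flipSpoke i t)
    · exact Or.inr (Or.inl ⟨hx, hy⟩)
    · exact Or.inl ⟨hω, by simp [hx, hy]⟩
    · exact Or.inl ⟨hω, by simp [hx, hy]⟩
    · exact Or.inr (Or.inr ⟨hx, hy⟩)
  have f1 := measureReal_mono (μ := μ) hsub (measure_ne_top _ _)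
  have f2 := measureReal_union_le (μ := μ) (S.deviation i t)
    ((S.inBlock i t ∩ S.tipMeets i (flipSpoke i t)) ∪
      ((S.inBlock i t)ᶜ ∩ (S.tipMeets i (flipSpoke i t))ᶜ))
  have f3 := measureReal_union_le (μ := μ) (S.inBlock i t ∩ S.tipMeets i (flipSpoke i t))
      ((S.inBlock i t)ᶜ ∩ (S.tipMeets i (flipSpoke i t))ᶜ)
  linarith

/-- Agreement alone would allow both probabilities to be below 1/2. The value b for the sibling is
common to the block, while the values a average at least 0.53·0.95 > 1/2 by coherence. If b ≤ 1/2,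
averaging `tip_le_agreement` gives 0.5847 ≤ 0.05 + (2b-1)/2 + (1-b) = 0.55, a contradiction. -/
theorem half_lt_tipMeets [DecidableEq H] (h1 : OneIndependent μ) {C : Finset (Cell H K M)}
    {l : ℝ} (i : Fin K)
    (t : Cell H K M × Fin n) (hC : groupCells K M t.1.1 ⊆ C)
    (hcoh : μ.real {ω | ¬ Coherent M C (S.adj ω)} ≤ l) (hl : l ≤ 0.05)
    (htip : ∀ s ∈ block n (groupCells K M t.1.1), 0.5847 ≤ μ.real {ω | s ∈ S.tip ω})
    (hdev : (∑ s ∈ levelBlock i t, μ.real (S.deviation i s)) / (levelBlock i t).card ≤ 0.05) :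
    1 / 2 < μ.real (S.tipMeets i (flipSpoke i t)) := by
  classical
  set B := levelBlock (i : ℕ) t with hB
  set b := μ.real (S.tipMeets i (flipSpoke i t)) with hb
  by_contra! hcon
  have hpos : (0 : ℝ) < B.card := by
    exact_mod_cast Finset.card_pos.2 ⟨t, mem_levelBlock_self _ t⟩
  rw [div_le_iff₀ hpos] at hdev
  have hsame : ∀ s ∈ B, S.tipMeets i (flipSpoke i s) = S.tipMeets i (flipSpoke i t) := by
    intro s hs
    simp only [tipMeets, levelBlock_flip_eq hs]
  have hsum : (0.5847 : ℝ) * B.card ≤ ∑ s ∈ B, (μ.real (S.deviation i s) +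
      ((2 * b - 1) * μ.real (S.inBlock i s) + (1 - b))) := by
    rw [mul_comm, ← nsmul_eq_mul]
    refine Finset.card_nsmul_le_sum _ _ _ fun s hs => ?_
    have := S.tip_le_agreement h1 i s
    rw [hsame s hs, ← hb] at this
    have h2 := htip s (levelBlock_subset_group _ _ hs)
    linarith
  rw [Finset.sum_add_distrib, Finset.sum_add_distrib, ← Finset.mul_sum, Finset.sum_const,
    nsmul_eq_mul] at hsum
  have hcm : MeasurableSet {ω | Coherent M C (S.adj ω)} :=
    (S.det_coherent M C).measurableSet (S.reg_finite _)
  have hcr : 1 - l ≤ μ.real {ω | Coherent M C (S.adj ω)} := by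
    have e : {ω | ¬ Coherent M C (S.adj ω)} = {ω | Coherent M C (S.adj ω)}ᶜ := rfl
    rw [e, measureReal_compl hcm, probReal_univ] at hcoh
    linarith
  have hX : (0.53 * B.card : ℝ) * μ.real {ω | Coherent M C (S.adj ω)} ≤
      ∑ s ∈ B, μ.real (S.inBlock i s) := by
    refine le_sum_real_of_le_card B (fun s _ =>
      (S.det_inBlock _ s).measurableSet (S.reg_finite _)) hcm fun ω hω => ?_
    have hne : (dense 0.53 (S.adj ω) B).Nonempty :=
      (hω _ _ subset_rfl ((levelCells_subset _ _ _).trans hC) (le_card_levelCells _ _ _)).1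
    refine (card_dense_ge hne).trans (le_of_eq ?_)
    congr 2
    ext s
    simp only [Finset.mem_filter]
    refine and_congr_right fun hs => ?_
    simp only [inBlock, Set.mem_ofPred_eq, levelBlock_eq hs, hB]
  have hX2 : (1 / 2 : ℝ) * B.card ≤ ∑ s ∈ B, μ.real (S.inBlock i s) := by
    refine le_trans ?_ hX
    have : (0.95 : ℝ) ≤ μ.real {ω | Coherent M C (S.adj ω)} := by linarith
    nlinarith
  nlinarith

/-- Since (2a-1)(2b-1) = 2(ab+(1-a)(1-b)) - 1, near agreement bounds the product below, and b > 1/2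
then forces a > 1/2. -/
theorem regular_of_deviation [DecidableEq H] (h1 : OneIndependent μ) {C : Finset (Cell H K M)}
    {l : ℝ} (i : Fin K)
    (t : Cell H K M × Fin n) (hC : groupCells K M t.1.1 ⊆ C)
    (hcoh : μ.real {ω | ¬ Coherent M C (S.adj ω)} ≤ l) (hl : l ≤ 0.05)
    (htip : ∀ s ∈ block n (groupCells K M t.1.1), 0.5847 ≤ μ.real {ω | s ∈ S.tip ω})
    (hdev : (∑ s ∈ levelBlock i t, μ.real (S.deviation i s)) / (levelBlock i t).card ≤ 0.05)
    (hdev' : μ.real (S.deviation i t) ≤ 0.03) : S.Regular μ C t.1.1 t := by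
  have hY := S.half_lt_tipMeets h1 i t hC hcoh hl htip hdev
  have hag := S.tip_le_agreement h1 i t
  have ht := htip t (levelBlock_subset_group 0 t (mem_levelBlock_self 0 t))
  have hprod : 0.109 ≤ (2 * μ.real (S.inBlock i t) - 1) *
      (2 * μ.real (S.tipMeets i (flipSpoke i t)) - 1) := by linarith
  have hX : 1 / 2 < μ.real (S.inBlock i t) := by
    by_contra! hcon
    nlinarith
  refine ⟨S.inBlock i t, S.tipMeets i (flipSpoke i t), ?_, ?_, ?_, ?_, hX, hY, hprod⟩
  · exact (S.det_inBlock i t).mono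
      (S.reg_mono (Finset.coe_subset.2 (levelBlock_subset_group _ _)))
  · exact (S.det_tipMeets i (flipSpoke i t)).mono (Set.insert_subset_insert
      (S.reg_mono (Finset.coe_subset.2 (levelBlock_subset_group _ _))))
  · intro ω hω hco
    exact (hco _ _ ((levelCells_subset _ _ _).trans hC) subset_rfl (le_card_levelCells _ _ _)).2 hω
  · rintro ω ⟨s, hs, hs'⟩ hco
    exact ⟨s, hs, (hco _ _ ((levelCells_subset _ _ _).trans hC) subset_rfl
      (le_card_levelCells _ _ _)).2 hs'⟩

open Classical in
/-- All but a small fraction of the spokes of a group are regular. -/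
theorem card_not_regular_le (h1 : OneIndependent μ) {C : Finset (Cell H K M)} {ε l : ℝ} (h : H)
    (hK : 0 < K) (hC : groupCells K M h ⊆ C) (hclash : μ.real {ω | S.Clash ω} ≤ ε)
    (hcoh : μ.real {ω | ¬ Coherent M C (S.adj ω)} ≤ l)
    (htip : ∀ s ∈ block n (groupCells K M h), 0.5847 ≤ μ.real {ω | s ∈ S.tip ω})
    (hsmall : 2 / K + ε + 2 * l ≤ 0.00004) (hl : l ≤ 0.05) :
    (((block n (groupCells K M h)).filter fun t => ¬ S.Regular μ C h t).card : ℝ) ≤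
      (block n (groupCells K M h)).card / 400 := by
  obtain ⟨i, hi⟩ := S.exists_level h hK hC hclash hcoh
  set F := block n (groupCells K M h) with hF
  have hi' : ∑ t ∈ F, μ.real (S.deviation i t) ≤ F.card * 0.00004 :=
    hi.trans (mul_le_mul_of_nonneg_left hsmall (Nat.cast_nonneg _))
  have hav := sum_average_levelBlock (i : ℕ) h fun t => μ.real (S.deviation i t)
  rw [← hF] at hav
  -- Markov twice, for the deviation and for its block average, which has the same total:
  -- 0.00004/0.03 + 0.00004/0.05 < 1/400.
  have c1 := card_filter_lt_mul_le F (fun t => μ.real (S.deviation i t))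
    (fun t _ => measureReal_nonneg) (c := 0.03)
  have c2 := card_filter_lt_mul_le F (fun t => (∑ s ∈ levelBlock i t, μ.real (S.deviation i s)) /
    (levelBlock i t).card) (fun t _ => by positivity) (c := 0.05)
  rw [hav] at c2
  have hsub : (F.filter fun t => ¬ S.Regular μ C h t) ⊆
      (F.filter fun t => 0.03 < μ.real (S.deviation i t)) ∪
      (F.filter fun t => 0.05 < (∑ s ∈ levelBlock i t, μ.real (S.deviation i s)) /
        (levelBlock i t).card) := by
    intro t ht
    obtain ⟨ht, hr⟩ := Finset.mem_filter.1 ht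
    rw [Finset.mem_union, Finset.mem_filter, Finset.mem_filter]
    by_contra! hcon
    have hth : t.1.1 = h := mem_groupCells.1 (mem_block.1 ht)
    subst hth
    exact hr (S.regular_of_deviation h1 i t hC hcoh hl htip (hcon.2 ht) (hcon.1 ht))
  have c3 : ((F.filter fun t => ¬ S.Regular μ C h t).card : ℝ) ≤
      (F.filter fun t => 0.03 < μ.real (S.deviation i t)).card +
      (F.filter fun t => 0.05 < (∑ s ∈ levelBlock i t, μ.real (S.deviation i s)) /
        (levelBlock i t).card).card := by
    exact_mod_cast (Finset.card_le_card hsub).trans (Finset.card_union_le _ _)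
  linarith

end Star

/-! ### Bridges of bipartite graphs -/

theorem reachable_of_adj_reachable {V V' : Type*} {H : SimpleGraph V} {H' : SimpleGraph V'}
    (f : V → V') (h : ∀ a b, H.Adj a b → H'.Reachable (f a) (f b)) {a b : V}
    (hab : H.Reachable a b) : H'.Reachable (f a) (f b) := by
  rw [SimpleGraph.reachable_iff_reflTransGen] at hab
  induction hab with
  | refl => rfl
  | tail _ hbc ih => exact ih.trans (h _ _ hbc)

/-- The bipartite graph of a relation. -/
def bipartite {α β : Type*} (R : α → β → Prop) : SimpleGraph (α ⊕ β) where
  Adj a b := (∃ i j, R i j ∧ a = Sum.inl i ∧ b = Sum.inr j) ∨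
    ∃ i j, R i j ∧ b = Sum.inl i ∧ a = Sum.inr j
  symm := ⟨fun _ _ h => h.symm⟩
  loopless := ⟨by rintro a (⟨i, j, -, h, h'⟩ | ⟨i, j, -, h, h'⟩) <;> simp [h] at h'⟩

open Classical in
/-- A bipartite graph all of whose edges are bridges has few edges. -/
theorem card_le_of_bridges {α β : Type*} [Fintype α] [Fintype β] (R : α → β → Prop)
    (h : ∀ i j, R i j → ¬ ((bipartite R).deleteEdges {s(Sum.inl i, Sum.inr j)}).Reachable
      (Sum.inl i) (Sum.inr j)) :
    ((Finset.univ : Finset (α × β)).filter fun q => R q.1 q.2).card ≤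
      Fintype.card α + Fintype.card β := by
  rcases isEmpty_or_nonempty (α ⊕ β) with he | hne
  · have : IsEmpty α := ⟨fun a => he.elim (Sum.inl a)⟩
    simp
  have hac : (bipartite R).IsAcyclic := by
    rw [SimpleGraph.isAcyclic_iff_forall_adj_isBridge]
    rintro a b (⟨i, j, hij, rfl, rfl⟩ | ⟨i, j, hij, rfl, rfl⟩)
    · rw [SimpleGraph.isBridge_iff]; exact h i j hij
    · rw [Sym2.eq_swap, SimpleGraph.isBridge_iff]; exact h i j hij
  -- The acyclic graph is extended to a spanning tree of the complete graph, whose edge count is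
  -- known.
  obtain ⟨F, hF, -, hT⟩ := (SimpleGraph.connected_top (V := α ⊕ β)).exists_isTree_le_of_le_of_isAcyclic
    le_top hac
  have hcard := hT.card_edgeFinset
  rw [Fintype.card_sum] at hcard
  have : ((Finset.univ : Finset (α × β)).filter fun q => R q.1 q.2).card ≤ F.edgeFinset.card := by
    refine Finset.card_le_card_of_injOn (fun q => s(Sum.inl q.1, Sum.inr q.2)) ?_ ?_
    · intro q hq
      have hq' : R q.1 q.2 := by simpa using hq
      simp only [Finset.mem_coe, SimpleGraph.mem_edgeFinset, SimpleGraph.mem_edgeSet]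
      exact hF (Or.inl ⟨q.1, q.2, hq', rfl, rfl⟩)
    · rintro ⟨i, j⟩ _ ⟨i', j'⟩ _ heq
      simpa using heq
  omega

/-! ### The product of the grid with a power of a star -/

section BigGraph

set_option linter.unusedSectionVars false

variable {I : Type*} {N : ℕ}

/-- A site of the grid together with a partially filled list of labels. -/
abbrev Site (I : Type*) (N : ℕ) : Type _ := (ℤ × ℤ) × (I → Option (Fin N))

theorem finite_fiber [Finite I] (u : ℤ × ℤ) : {w : Site I N | w.1 = u}.Finite := by
  have : {w : Site I N | w.1 = u} = {u} ×ˢ Set.univ := by ext; simp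
  rw [this]
  exact (Set.finite_singleton u).prod Set.finite_univ

variable [DecidableEq I]

/-- The label of one slot is removed. -/
def erase (y : I → Option (Fin N)) (t : I) : I → Option (Fin N) := Function.update y t none

theorem erase_apply_self (y : I → Option (Fin N)) (t : I) : erase y t t = none := by simp [erase]

theorem erase_apply_of_ne (y : I → Option (Fin N)) {t s : I} (h : s ≠ t) :
    erase y t s = y s := by simp [erase, h]

theorem erase_of_eq_none {y : I → Option (Fin N)} {t : I} (h : y t = none) : erase y t = y := by
  rw [erase, ← h, Function.update_eq_self]

theorem erase_ne {y : I → Option (Fin N)} {t : I} (h : y t ≠ none) : erase y t ≠ y := fun he =>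
  h (by rw [← he, erase_apply_self])

theorem erase_comm (y : I → Option (Fin N)) (s t : I) : erase (erase y s) t = erase (erase y t) s := by
  by_cases h : s = t
  · rw [h]
  · exact (Function.update_comm h _ _ _)

/-- One moves in the grid, or removes or inserts a label. -/
def bigGraph (I : Type*) [DecidableEq I] (N : ℕ) : SimpleGraph (Site I N) where
  Adj v w := (gridGraph.Adj v.1 w.1 ∧ v.2 = w.2) ∨
    (v.1 = w.1 ∧ ∃ t, (v.2 t ≠ none ∧ w.2 = erase v.2 t) ∨ (w.2 t ≠ none ∧ v.2 = erase w.2 t))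
  symm := ⟨fun v w h => h.imp (fun h => ⟨h.1.symm, h.2.symm⟩)
    fun ⟨h, t, ht⟩ => ⟨h.symm, t, ht.symm⟩⟩
  loopless := ⟨by
    rintro v (⟨h, -⟩ | ⟨-, t, ⟨h, h'⟩ | ⟨h, h'⟩⟩)
    · exact gridGraph.loopless.irrefl _ h
    · exact erase_ne h h'.symm
    · exact erase_ne h h'.symm⟩

theorem bigGraph_adj_erase (u : ℤ × ℤ) {y : I → Option (Fin N)} {t : I} (h : y t ≠ none) :
    (bigGraph I N).Adj (u, y) (u, erase y t) := Or.inr ⟨rfl, t, Or.inl ⟨h, rfl⟩⟩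

theorem bigGraph_adj_grid {u u' : ℤ × ℤ} (h : gridGraph.Adj u u') (y : I → Option (Fin N)) :
    (bigGraph I N).Adj (u, y) (u', y) := Or.inl ⟨h, rfl⟩

/-- The sites other than `(u, y)` which agree with it away from `U`. -/
def region (u : ℤ × ℤ) (y : I → Option (Fin N)) (U : Set I) : Set (Site I N) :=
  {w | w ≠ (u, y) ∧ w.1 = u ∧ ∀ t ∉ U, w.2 t = y t}

theorem erase_mem_region (u : ℤ × ℤ) {y : I → Option (Fin N)} {t : I} (h : y t ≠ none)
    {U : Set I} (ht : t ∈ U) : (u, erase y t) ∈ region u y U :=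
  ⟨fun he => erase_ne h (Prod.ext_iff.1 he).2, rfl, fun s hs => erase_apply_of_ne _ fun h => by
    subst h; exact hs ht⟩

theorem erase_update_update (y : I → Option (Fin N)) {t t' : I} (i j : Fin N) :
    erase (Function.update (Function.update y t (some i)) t' (some j)) t' =
      erase (Function.update y t (some i)) t' := by
  simp [erase]

theorem erase_update_update' (y : I → Option (Fin N)) {t t' : I} (ht : t ≠ t') (i j : Fin N) :
    erase (Function.update (Function.update y t (some i)) t' (some j)) t =
      erase (Function.update y t' (some j)) t := by
  rw [Function.update_comm ht, erase_update_update]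

variable [Finite I]

/-- The star around the site `(u, y)`. -/
noncomputable def siteStar (u : ℤ × ℤ) (y : I → Option (Fin N)) : Star (bigGraph I N) I where
  center := (u, y)
  reg := region u y
  tip ω := {t | (openGraph ω).Adj (u, y) (u, erase y t)}
  adj ω :=
    { Adj t t' := t ≠ t' ∧ (openIn ω (region u y {t, t'})).Reachable (u, erase y t) (u, erase y t')
      symm := ⟨fun t t' h => ⟨h.1.symm, by rw [Set.pair_comm]; exact h.2.symm⟩⟩
      loopless := ⟨fun t h => h.1 rfl⟩ }
  reg_finite U := (finite_fiber u).subset fun w hw => hw.2.1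
  reg_mono h w hw := ⟨hw.1, hw.2.1, fun t ht => hw.2.2 t fun h' => ht (h h')⟩
  -- A site that agrees with the centre both off U and off U' is the centre itself, which regions
  -- exclude.
  reg_disjoint {U U'} h := Set.disjoint_left.2 fun w hw hw' => hw.1 (Prod.ext hw.2.1 (funext fun t => by
    by_cases ht : t ∈ U
    · exact hw'.2.2 t (Set.disjoint_left.1 h ht)
    · exact hw.2.2 t ht))
  center_notMem U h := h.1 rfl
  det_adj t t' := detBy_openIn (region u y {t, t'})
    fun H => t ≠ t' ∧ H.Reachable (u, erase y t) (u, erase y t')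
  det_tip t := (detBy_adj _ _).mono (by
    rintro _ (rfl | rfl)
    · exact Or.inl rfl
    · by_cases h : y t = none
      · exact Or.inl (by rw [erase_of_eq_none h])
      · exact Or.inr (erase_mem_region u h rfl))

theorem mem_siteStar_tip {u : ℤ × ℤ} {y : I → Option (Fin N)} {ω : Config (bigGraph I N)} {t : I} :
    t ∈ (siteStar u y).tip ω ↔ (openGraph ω).Adj (u, y) (u, erase y t) := Iff.rfl

theorem siteStar_adj {u : ℤ × ℤ} {y : I → Option (Fin N)} {ω : Config (bigGraph I N)} {t t' : I} :
    ((siteStar u y).adj ω).Adj t t' ↔ t ≠ t' ∧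
      (openIn ω (region u y {t, t'})).Reachable (u, erase y t) (u, erase y t') := Iff.rfl

theorem ne_none_of_mem_tip {u : ℤ × ℤ} {y : I → Option (Fin N)} {ω : Config (bigGraph I N)} {t : I}
    (h : t ∈ (siteStar u y).tip ω) : y t ≠ none := by
  intro h0
  rw [mem_siteStar_tip, erase_of_eq_none h0] at h
  exact h.ne rfl

theorem siteStar_reachable {u : ℤ × ℤ} {y : I → Option (Fin N)} {ω : Config (bigGraph I N)}
    {t t' : I} (h : ((siteStar u y).adj ω).Reachable t t') :
    (openIn ω {w | w.1 = u}).Reachable (u, erase y t) (u, erase y t') := by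
  refine reachable_of_adj_reachable (fun t => (u, erase y t)) (fun a b hab => ?_) h
  exact (siteStar_adj.1 hab).2.mono (openIn_mono ω fun w hw => hw.2.1)

theorem real_tip_ge {μ : Measure (Config (bigGraph I N))} {p : ℝ}
    (hp : ∀ e : (bigGraph I N).edgeSet, p ≤ μ.real {ω | ω e = true}) (u : ℤ × ℤ)
    {y : I → Option (Fin N)} {t : I} (h : y t ≠ none) :
    p ≤ μ.real {ω | t ∈ (siteStar u y).tip ω} := by
  have e : {ω | t ∈ (siteStar u y).tip ω} =
      {ω | ω ⟨s((u, y), (u, erase y t)), bigGraph_adj_erase u h⟩ = true} := by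
    ext ω
    simp only [Set.mem_ofPred_eq, mem_siteStar_tip, openGraph_adj]
    exact ⟨fun ⟨_, h⟩ => h, fun h' => ⟨_, h'⟩⟩
  rw [e]
  exact hp _

/-- Two given open spokes are not joined. -/
def clashAt (u : ℤ × ℤ) (y : I → Option (Fin N)) (t t' : I) : Set (Config (bigGraph I N)) :=
  {ω | t ∈ (siteStar u y).tip ω ∧ t' ∈ (siteStar u y).tip ω ∧ ¬ ((siteStar u y).adj ω).Adj t t'}

theorem measurableSet_clashAt (u : ℤ × ℤ) (y : I → Option (Fin N)) (t t' : I) :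
    MeasurableSet (clashAt u y t t') :=
  ((siteStar u y).measurableSet_tip t).inter (((siteStar u y).measurableSet_tip t').inter
    ((((siteStar u y).det_adj t t').compl).measurableSet ((siteStar u y).reg_finite _)))

open Classical in
-- Let the labels at t and t' vary. The far ends are indexed by a single label each, and the site
-- with labels (i,j) acts as an edge of K_{N,N} joining two of them when both its spokes are open. A
-- clash at (i,j) says that these ends are not joined avoiding that site, so the clashing pairs form
-- a graph in which every edge is a bridge.
theorem card_clashAt_le (u : ℤ × ℤ) (y : I → Option (Fin N)) {t t' : I} (ht : t ≠ t')
    (ω : Config (bigGraph I N)) :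
    ((Finset.univ : Finset (Fin N × Fin N)).filter fun q => ω ∈ clashAt u
      (Function.update (Function.update y t (some q.1)) t' (some q.2)) t t').card ≤ 2 * N := by
  let z : Fin N → Fin N → I → Option (Fin N) := fun i j =>
    Function.update (Function.update y t (some i)) t' (some j)
  have hz : ∀ i j, z i j t = some i ∧ z i j t' = some j := fun i j => by
    simp [z, Function.update_of_ne ht]
  have hz' : ∀ i j i' j' s, s ≠ t → s ≠ t' → z i j s = z i' j' s := fun i j i' j' s hs hs' => by
    simp [z, Function.update_of_ne hs, Function.update_of_ne hs']
  have := card_le_of_bridges (fun i j => ω ∈ clashAt u (z i j) t t') ?_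
  · rw [Fintype.card_fin] at this
    exact this.trans (by omega)
  intro i j hij hreach
  refine hij.2.2 (siteStar_adj.2 ⟨ht, ?_⟩)
  let f : Fin N ⊕ Fin N → Site I N := Sum.elim
    (fun i' => (u, erase (Function.update y t (some i')) t'))
    (fun j' => (u, erase (Function.update y t' (some j')) t))
  have hf1 : ∀ i' j', (u, erase (z i' j') t') = f (Sum.inl i') := fun i' j' => by
    simp only [f, z, Sum.elim_inl, erase_update_update]
  have hf2 : ∀ i' j', (u, erase (z i' j') t) = f (Sum.inr j') := fun i' j' => by
    simp only [f, z, Sum.elim_inr, erase_update_update' y ht]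
  rw [hf1 i j, hf2 i j]
  refine SimpleGraph.Reachable.symm (reachable_of_adj_reachable f ?_ hreach)
  -- Any other clashing pair gives a path of two open spokes through its own centre, which belongs
  -- to the region because it differs from the centre for (i,j).
  have hedge : ∀ i' j', ω ∈ clashAt u (z i' j') t t' → (i', j') ≠ (i, j) →
      (openIn ω (region u (z i j) {t, t'})).Reachable (f (Sum.inl i')) (f (Sum.inr j')) := by
    intro i' j' hc hne
    rw [← hf1 i' j', ← hf2 i' j']
    have hne' : z i' j' ≠ z i j := by
      intro he
      have e1 := congrFun he t
      have e2 := congrFun he t'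
      rw [(hz _ _).1, (hz _ _).1] at e1
      rw [(hz _ _).2, (hz _ _).2] at e2
      exact hne (Prod.ext (Option.some_injective _ e1) (Option.some_injective _ e2))
    have m0 : (u, z i' j') ∈ region u (z i j) {t, t'} :=
      ⟨fun he => hne' (Prod.ext_iff.1 he).2, rfl, fun s hs => by
        simp only [Set.mem_insert_iff, Set.mem_singleton_iff, not_or] at hs
        exact hz' _ _ _ _ s hs.1 hs.2⟩
    have m1 : ∀ r ∈ ({t, t'} : Set I), (u, erase (z i' j') r) ∈ region u (z i j) {t, t'} := by
      intro r hr
      refine ⟨fun he => ?_, rfl, fun s hs => ?_⟩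
      · have e : erase (z i' j') r r = z i j r := congrFun (Prod.ext_iff.1 he).2 r
        rw [erase_apply_self] at e
        rcases hr with rfl | rfl
        · rw [(hz _ _).1] at e; simp at e
        · rw [(hz _ _).2] at e; simp at e
      · have hsr : s ≠ r := fun h => hs (h ▸ hr)
        simp only [Set.mem_insert_iff, Set.mem_singleton_iff, not_or] at hs
        refine (erase_apply_of_ne _ hsr).trans ?_
        exact hz' _ _ _ _ s hs.1 hs.2
    have a1 : (openIn ω (region u (z i j) {t, t'})).Adj (u, z i' j') (u, erase (z i' j') t) :=
      ⟨hc.1, m0, m1 t (Or.inl rfl)⟩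
    have a2 : (openIn ω (region u (z i j) {t, t'})).Adj (u, z i' j') (u, erase (z i' j') t') :=
      ⟨hc.2.1, m0, m1 t' (Or.inr rfl)⟩
    exact a2.symm.reachable.trans a1.reachable
  intro a b hab
  rw [SimpleGraph.deleteEdges_adj] at hab
  obtain ⟨⟨i', j', hc, rfl, rfl⟩ | ⟨i', j', hc, rfl, rfl⟩, hne⟩ := hab
  · exact hedge i' j' hc fun he => hne (by
      obtain ⟨rfl, rfl⟩ := Prod.ext_iff.1 he; simp)
  · exact (hedge i' j' hc fun he => hne (by
      obtain ⟨rfl, rfl⟩ := Prod.ext_iff.1 he; simp)).symm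

theorem sum_real_clashAt_le {μ : Measure (Config (bigGraph I N))} [IsProbabilityMeasure μ]
    (u : ℤ × ℤ) (y : I → Option (Fin N)) {t t' : I} (ht : t ≠ t') :
    ∑ i, ∑ j, μ.real (clashAt u
      (Function.update (Function.update y t (some i)) t' (some j)) t t') ≤ 2 * N := by
  classical
  rw [← Finset.sum_product']
  refine sum_real_le_of_card_le _ (fun q _ => measurableSet_clashAt _ _ _ _) fun ω => ?_
  exact_mod_cast card_clashAt_le u y ht ω

end BigGraph

/-! ### Averaging over labels -/

section Labels

set_option linter.unusedSectionVars false

variable {I : Type*} [DecidableEq I] [Fintype I] {N : ℕ}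

/-- Resampling one coordinate preserves the uniform measure: exchanging x t with the fresh label is
an involution. -/
theorem sum_update_eq (g : (I → Fin N) → ℝ) (t : I) :
    ∑ x : I → Fin N, ∑ i : Fin N, g (Function.update x t i) = N * ∑ x, g x := by
  rw [← Fintype.sum_prod_type' (f := fun (x : I → Fin N) i => g (Function.update x t i))]
  let e : (I → Fin N) × Fin N → (I → Fin N) × Fin N := fun q => (Function.update q.1 t q.2, q.1 t)
  have he : Function.Involutive e := fun q => by simp [e]
  rw [← Equiv.sum_comp he.toPerm]
  simp only [Function.Involutive.coe_toPerm, e, Function.update_idem, Function.update_eq_self,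
    Fintype.sum_prod_type]
  rw [Finset.mul_sum]
  simp

/-- The labels `x`, with the labels in `D` removed. -/
def mask (D : Finset I) (x : I → Fin N) : I → Option (Fin N) :=
  fun t => if t ∈ D then none else some (x t)

theorem mask_insert (D : Finset I) (x : I → Fin N) (s : I) :
    mask (insert s D) x = erase (mask D x) s := by
  funext t
  by_cases h : t = s
  · subst h; simp [mask, erase]
  · simp [mask, erase_apply_of_ne _ h, h]

theorem mask_ne_none {D : Finset I} {x : I → Fin N} {t : I} : mask D x t ≠ none ↔ t ∉ D := by
  simp [mask]

theorem mask_update {D : Finset I} (x : I → Fin N) {t : I} (h : t ∉ D) (i : Fin N) :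
    mask D (Function.update x t i) = Function.update (mask D x) t (some i) := by
  funext s
  by_cases hs : s = t
  · subst hs; simp [mask, h]
  · simp [mask, hs]

theorem mask_congr {D : Finset I} {x x' : I → Fin N} (h : ∀ t ∉ D, x t = x' t) :
    mask D x = mask D x' := by
  funext t
  by_cases ht : t ∈ D
  · simp [mask, ht]
  · simp [mask, ht, h t ht]

/-- On average over the labels, clashes are rare. -/
theorem sum_real_clash_le {μ : Measure (Config (bigGraph I N))} [IsProbabilityMeasure μ]
    (hN : 0 < N) (u : ℤ × ℤ) (D : Finset I) :
    ∑ x : I → Fin N, μ.real {ω | (siteStar u (mask D x)).Clash ω} ≤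
      (Fintype.card I) ^ 2 * (2 / N) * Fintype.card (I → Fin N) := by
  have hN' : (0 : ℝ) < N := by exact_mod_cast hN
  let P := (Finset.univ : Finset (I × I)).filter fun q => q.1 ≠ q.2 ∧ q.1 ∉ D ∧ q.2 ∉ D
  have hone : ∀ q ∈ P, ∑ x : I → Fin N, μ.real (clashAt u (mask D x) q.1 q.2) ≤
      2 / N * Fintype.card (I → Fin N) := by
    rintro ⟨t, t'⟩ hq
    obtain ⟨-, hne, h1, h2⟩ := Finset.mem_filter.1 hq
    have e1 := sum_update_eq (N := N)
      (fun x => ∑ j, μ.real (clashAt u (mask D (Function.update x t' j)) t t')) t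
    have e2 := sum_update_eq (N := N) (fun x => μ.real (clashAt u (mask D x) t t')) t'
    rw [e2] at e1
    have hle : ∑ x : I → Fin N, ∑ i : Fin N, ∑ j, μ.real (clashAt u
        (mask D (Function.update (Function.update x t i) t' j)) t t') ≤
        Fintype.card (I → Fin N) * (2 * N) := by
      rw [← nsmul_eq_mul]
      refine Finset.sum_le_card_nsmul _ _ _ fun x _ => ?_
      simp only [mask_update _ h1, mask_update _ h2]
      exact sum_real_clashAt_le u (mask D x) hne
    rw [e1] at hle
    refine le_of_mul_le_mul_left (a := (N : ℝ) * N) ?_ (by positivity)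
    calc (N : ℝ) * N * ∑ x : I → Fin N, μ.real (clashAt u (mask D x) t t')
        ≤ Fintype.card (I → Fin N) * (2 * N) := by rw [mul_assoc]; exact hle
      _ = N * N * (2 / N * Fintype.card (I → Fin N)) := by field_simp
  calc ∑ x : I → Fin N, μ.real {ω | (siteStar u (mask D x)).Clash ω}
      ≤ ∑ x : I → Fin N, ∑ q ∈ P, μ.real (clashAt u (mask D x) q.1 q.2) := by
        refine Finset.sum_le_sum fun x _ => ?_
        refine le_trans (measureReal_mono ?_ (measure_ne_top _ _))
          (measureReal_biUnion_finset_le P fun q => clashAt u (mask D x) q.1 q.2)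
        rintro ω ⟨t, ht, t', ht', hne, hadj⟩
        simp only [Set.mem_iUnion]
        refine ⟨(t, t'), Finset.mem_filter.2 ⟨Finset.mem_univ _, hne, ?_, ?_⟩, ht, ht', hadj⟩
        · exact mask_ne_none.1 (ne_none_of_mem_tip ht)
        · exact mask_ne_none.1 (ne_none_of_mem_tip ht')
    _ = ∑ q ∈ P, ∑ x : I → Fin N, μ.real (clashAt u (mask D x) q.1 q.2) := Finset.sum_comm
    _ ≤ ∑ _q ∈ P, (2 / N * Fintype.card (I → Fin N) : ℝ) := Finset.sum_le_sum hone
    _ ≤ (Fintype.card I) ^ 2 * (2 / N) * Fintype.card (I → Fin N) := by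
        rw [Finset.sum_const, nsmul_eq_mul, mul_assoc]
        refine mul_le_mul_of_nonneg_right ?_ (by positivity)
        have : P.card ≤ Fintype.card I ^ 2 := by
          refine (Finset.card_filter_le _ _).trans (le_of_eq ?_)
          rw [Finset.card_univ, Fintype.card_prod, sq]
        exact_mod_cast this

end Labels

/-! ### Rows of a base point -/

/-- The slots: three row groups and `κ` link groups of spokes. -/
abbrev Slot (κ K M n : ℕ) : Type := Cell (Fin 3 ⊕ Fin κ) K M × Fin n

section Boxes

variable {I : Type*} {N : ℕ}

/-- The sites that agree with `(u, y)` away from `U`. -/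
def siteBox (u : ℤ × ℤ) (y : I → Option (Fin N)) (U : Set I) : Set (Site I N) :=
  {w | w.1 = u ∧ ∀ t ∉ U, w.2 t = y t}

theorem region_subset_siteBox (u : ℤ × ℤ) (y : I → Option (Fin N)) (U : Set I) :
    region u y U ⊆ siteBox u y U := fun _ hw => hw.2

theorem insert_region_subset_siteBox (u : ℤ × ℤ) (y : I → Option (Fin N)) (U : Set I) :
    insert (u, y) (region u y U) ⊆ siteBox u y U := by
  rintro w (rfl | hw)
  · exact ⟨rfl, fun _ _ => rfl⟩
  · exact hw.2

theorem disjoint_siteBox {u u' : ℤ × ℤ} {y y' : I → Option (Fin N)} {U U' : Set I} (r : I)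
    (hU : r ∉ U) (hU' : r ∉ U') (h : y r ≠ y' r) :
    Disjoint (siteBox u y U) (siteBox u' y' U') :=
  Set.disjoint_left.2 fun _ hw hw' => h ((hw.2 r hU).symm.trans (hw'.2 r hU'))

theorem disjoint_siteBox_of_ne {u u' : ℤ × ℤ} (h : u ≠ u') (y y' : I → Option (Fin N))
    (U U' : Set I) : Disjoint (siteBox u y U) (siteBox u' y' U') :=
  Set.disjoint_left.2 fun _ hw hw' => h (hw.1.symm.trans hw'.1)

theorem finite_siteBox [Finite I] (u : ℤ × ℤ) (y : I → Option (Fin N)) (U : Set I) :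
    (siteBox u y U).Finite := (finite_fiber u).subset fun _ hw => hw.1

end Boxes

/-- A site of the grid with labels `labels`, those in `erased` being removed. -/
structure Base (κ K M n N : ℕ) where
  site : ℤ × ℤ
  erased : Finset (Slot κ K M n)
  labels : Slot κ K M n → Fin N

/-- All spokes of a group. -/
def groupSpokes (κ K M n : ℕ) (h : Fin 3 ⊕ Fin κ) : Finset (Slot κ K M n) :=
  block n (groupCells K M h)

theorem mem_groupSpokes {κ K M n : ℕ} {h : Fin 3 ⊕ Fin κ} {t : Slot κ K M n} :
    t ∈ groupSpokes κ K M n h ↔ t.1.1 = h := by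
  rw [groupSpokes, mem_block, mem_groupCells]

theorem card_groupSpokes {κ K M n : ℕ} (h : Fin 3 ⊕ Fin κ) :
    (groupSpokes κ K M n h).card = 2 ^ K * M * n := by
  rw [groupSpokes, card_block, card_groupCells]

/-- Numerical requirements on the parameters. -/
structure Params (κ K M n q : ℕ) (ε δ l : ℝ) : Prop where
  dvd : 20 ∣ n
  n_pos : 0 < n
  K_pos : 0 < K
  M_large : 108 * q < M
  ε_nonneg : 0 ≤ ε
  δ_pos : 0 < δ
  -- Moments of order nine already give a component of density 0.54.
  num : (0.54 : ℝ) ^ 8 ≤ 0.5847 ^ 9 - ε - δ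
  l_large : ((((3 + κ) * (2 ^ K * M) : ℕ) : ℝ) ^ 2 * (21 * ((8 + 1) ^ 2 / δ ^ 2 / n))) ^ q ≤ l
  small : 2 / K + ε + 2 * l ≤ 0.00004

/-! ### Rows of a base point: coherence, regularity and fairness. -/

namespace Base

set_option linter.unusedSectionVars false

variable {κ K M n N q : ℕ} {ε δ l : ℝ} (B : Base κ K M n N)

/-- The labels of the row `s`: the slot `s` is removed. -/
def rowLabels (s : Slot κ K M n) : Slot κ K M n → Option (Fin N) :=
  mask (insert s B.erased) B.labels

/-- The star around the centre of the row `s`. -/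
noncomputable def row (s : Slot κ K M n) : Star (bigGraph (Slot κ K M n) N) (Slot κ K M n) :=
  siteStar B.site (B.rowLabels s)

/-- The cells of the groups none of whose labels is removed. -/
def cells (s : Slot κ K M n) : Finset (Cell (Fin 3 ⊕ Fin κ) K M) :=
  Finset.univ.filter fun j => ∀ t ∈ insert s B.erased, j.1 ≠ t.1.1

/-- The main component of a row. -/
def core (ω : Config (bigGraph (Slot κ K M n) N)) (s : Slot κ K M n) : Set (Slot κ K M n) :=
  dense 0.53 ((B.row s).adj ω) (block n (B.cells s))

/-- The far end of a spoke. -/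
def tipSite (s t : Slot κ K M n) : Site (Slot κ K M n) N := (B.site, erase (B.rowLabels s) t)

/-- Rows s and t cross at the vertex with both slots emptied. This is how different rows get
connected. -/
theorem tipSite_comm (s t : Slot κ K M n) : B.tipSite s t = B.tipSite t s := by
  rw [tipSite, tipSite, rowLabels, rowLabels, mask_insert, mask_insert, erase_comm]

/-- The row `s` is coherent. -/
def Coh (ω : Config (bigGraph (Slot κ K M n) N)) (s : Slot κ K M n) : Prop :=
  Coherent M (B.cells s) ((B.row s).adj ω)

/-- No label of the group is removed. -/
def Avail (h : Fin 3 ⊕ Fin κ) : Prop := ∀ t ∈ B.erased, t.1.1 ≠ h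

theorem Avail.notMem {B : Base κ K M n N} {t : Slot κ K M n} (h : B.Avail t.1.1) : t ∉ B.erased :=
  fun ht => h t ht rfl

theorem mem_cells {s : Slot κ K M n} {j : Cell (Fin 3 ⊕ Fin κ) K M} :
    j ∈ B.cells s ↔ j.1 ≠ s.1.1 ∧ B.Avail j.1 := by
  simp only [cells, Finset.mem_filter, Finset.mem_univ, true_and, Finset.mem_insert, Avail]
  constructor
  · exact fun h => ⟨h s (Or.inl rfl), fun t ht => (h t (Or.inr ht)).symm⟩
  · rintro ⟨h1, h2⟩ t (rfl | ht)
    · exact h1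
    · exact (h2 t ht).symm

theorem groupCells_subset {s : Slot κ K M n} {h : Fin 3 ⊕ Fin κ} (hs : h ≠ s.1.1)
    (hA : B.Avail h) : groupCells K M h ⊆ B.cells s := fun j hj => by
  rw [mem_groupCells] at hj
  rw [mem_cells, hj]
  exact ⟨hs, hA⟩

theorem rowLabels_self (s : Slot κ K M n) : B.rowLabels s s = none := by
  simp [rowLabels, mask]

theorem rowLabels_ne_none {s t : Slot κ K M n} (h : t ≠ s) (ht : t ∉ B.erased) :
    B.rowLabels s t ≠ none := by
  rw [rowLabels, mask_ne_none, Finset.mem_insert, not_or]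
  exact ⟨h, ht⟩

variable (μ : Measure (Config (bigGraph (Slot κ K M n) N)))

/-- Clashes are rare in all rows. -/
def Sound (ε : ℝ) : Prop :=
  B.erased.card ≤ 1 ∧ ∀ s, μ.real {ω | (B.row s).Clash ω} ≤ ε

/-- The spoke `t` is regular in the row `s`. -/
def Reg (s t : Slot κ K M n) : Prop := (B.row s).Regular μ (B.cells s) t.1.1 t

variable {μ} [IsProbabilityMeasure μ] {B}

theorem real_tip_ge_of_mem_cells (hp : ∀ e : (bigGraph (Slot κ K M n) N).edgeSet,
    0.5847 ≤ μ.real {ω | ω e = true}) {s t : Slot κ K M n} (ht : t.1 ∈ B.cells s) :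
    0.5847 ≤ μ.real {ω | t ∈ (B.row s).tip ω} := by
  obtain ⟨h1, h2⟩ := B.mem_cells.1 ht
  refine real_tip_ge hp B.site (B.rowLabels_ne_none ?_ (Avail.notMem h2))
  rintro rfl
  exact h1 rfl

theorem real_not_coh_le (P : Params κ K M n q ε δ l) (h1 : OneIndependent μ)
    (hp : ∀ e : (bigGraph (Slot κ K M n) N).edgeSet, 0.5847 ≤ μ.real {ω | ω e = true})
    (hB : B.Sound μ ε) (s : Slot κ K M n) : μ.real {ω | ¬ B.Coh ω s} ≤ l := by
  obtain ⟨r, hr⟩ := P.dvd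
  refine ((B.row s).real_not_coherent_le h1 hr P.M_large
    (η := (8 + 1) ^ 2 / δ ^ 2 / n) (by positivity) fun W hW hWC => ?_).trans (le_trans ?_ P.l_large)
  · have := (B.row s).real_dense_empty_le (c := 0.54) h1 W (by rw [hW]; exact P.n_pos) 8
      (by norm_num) P.δ_pos
      (fun t ht => real_tip_ge_of_mem_cells hp (mem_block.1 (hWC ht))) (hB.2 s) P.num
    rw [hW] at this
    exact_mod_cast this
  · refine pow_le_pow_left₀ (by positivity) ?_ q
    refine mul_le_mul_of_nonneg_right ?_ (by positivity)
    refine pow_le_pow_left₀ (by positivity) (Nat.cast_le.2 ?_) 2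
    refine (Finset.card_le_univ _).trans (le_of_eq ?_)
    simp

open Classical in
theorem card_not_reg_le (P : Params κ K M n q ε δ l) (h1 : OneIndependent μ)
    (hp : ∀ e : (bigGraph (Slot κ K M n) N).edgeSet, 0.5847 ≤ μ.real {ω | ω e = true})
    (hB : B.Sound μ ε) (s : Slot κ K M n) {h : Fin 3 ⊕ Fin κ} (hs : h ≠ s.1.1)
    (hA : B.Avail h) :
    400 * ((groupSpokes κ K M n h).filter fun t => ¬ B.Reg μ s t).card ≤ 2 ^ K * M * n := by
  have hl0 := real_not_coh_le P h1 hp hB s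
  have hl : l ≤ 0.05 := by
    have := P.small
    have h2 : (0 : ℝ) ≤ 2 / K := by positivity
    have := P.ε_nonneg
    linarith
  have := (B.row s).card_not_regular_le h1 h P.K_pos (B.groupCells_subset hs hA) (hB.2 s)
    hl0 (fun t ht => real_tip_ge_of_mem_cells hp (B.groupCells_subset hs hA (mem_block.1 ht)))
    P.small hl
  rw [card_block, card_groupCells, le_div_iff₀ (by norm_num)] at this
  have e : ((groupSpokes κ K M n h).filter fun t => ¬ B.Reg μ s t) =
      (block n (groupCells K M h)).filter fun t => ¬ (B.row s).Regular μ (B.cells s) h t := by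
    rw [groupSpokes]
    refine Finset.filter_congr fun t ht => ?_
    rw [Reg, mem_groupCells.1 (mem_block.1 ht)]
  rw [e, mul_comm]
  exact_mod_cast this

variable (B)

open Classical in
/-- The spokes of the available link groups. -/
noncomputable def links : Finset (Slot κ K M n) :=
  Finset.univ.filter fun k => (∃ j, k.1.1 = Sum.inr j) ∧ B.Avail k.1.1

theorem mem_links {k : Slot κ K M n} : k ∈ B.links ↔ (∃ j, k.1.1 = Sum.inr j) ∧ B.Avail k.1.1 := by
  simp [links]

open Classical in
/-- The available link groups. -/
noncomputable def linkGroups : Finset (Fin κ) := Finset.univ.filter fun j => B.Avail (Sum.inr j)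

theorem mem_linkGroups {j : Fin κ} : j ∈ B.linkGroups ↔ B.Avail (Sum.inr j) := by
  simp [linkGroups]

open Classical in
theorem links_eq : B.links = B.linkGroups.biUnion fun j => groupSpokes κ K M n (Sum.inr j) := by
  ext k
  simp only [mem_links, Finset.mem_biUnion, mem_linkGroups, mem_groupSpokes]
  constructor
  · rintro ⟨⟨j, hj⟩, h⟩
    exact ⟨j, hj ▸ h, hj⟩
  · rintro ⟨j, hj, hk⟩
    exact ⟨⟨j, hk⟩, hk ▸ hj⟩

theorem card_links : B.links.card = B.linkGroups.card * (2 ^ K * M * n) := by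
  classical
  rw [links_eq, Finset.card_biUnion]
  · simp [card_groupSpokes]
  · intro j _ j' _ hne
    rw [Function.onFun, Finset.disjoint_left]
    intro t ht ht'
    rw [mem_groupSpokes] at ht ht'
    exact hne (Sum.inr_injective (ht.symm.trans ht'))

theorem le_card_linkGroups (hB : B.erased.card ≤ 1) : κ ≤ B.linkGroups.card + 1 := by
  classical
  have h2 : ((Finset.univ : Finset (Fin κ)) \ B.linkGroups).card ≤ 1 := by
    rw [Finset.card_le_one]
    intro j hj j' hj'
    simp only [Finset.mem_sdiff, Finset.mem_univ, true_and, mem_linkGroups, Avail, not_forall,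
      not_not] at hj hj'
    obtain ⟨t, ht, ht1⟩ := hj
    obtain ⟨t', ht', ht1'⟩ := hj'
    have := Finset.card_le_one.1 hB t ht t' ht'
    subst this
    exact Sum.inr_injective (ht1.symm.trans ht1')
  have := Finset.le_card_sdiff B.linkGroups (Finset.univ : Finset (Fin κ))
  rw [Finset.card_univ, Fintype.card_fin] at this
  omega

/-- One removed label disables at most one group. Three row groups are provided so that, besides a,
an available one always remains. -/
theorem exists_avail_row (hB : B.erased.card ≤ 1) (a : Fin 3) :
    ∃ b, b ≠ a ∧ B.Avail (Sum.inl b) := by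
  have h2 : ∃ b c : Fin 3, b ≠ a ∧ c ≠ a ∧ b ≠ c := by decide +revert
  obtain ⟨b, c, hb, hc, hbc⟩ := h2
  by_contra! hcon
  have e1 := hcon b hb
  have e2 := hcon c hc
  simp only [Avail, not_forall, not_not] at e1 e2
  obtain ⟨t, ht, ht1⟩ := e1
  obtain ⟨t', ht', ht1'⟩ := e2
  have := Finset.card_le_one.1 hB t ht t' ht'
  subst this
  exact hbc (Sum.inl_injective (ht1.symm.trans ht1'))

variable (μ)

open Classical in
/-- A row of an available row group which is a regular spoke of most link rows. -/
def Fair (s : Slot κ K M n) : Prop :=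
  (∃ a, s.1.1 = Sum.inl a) ∧ B.Avail s.1.1 ∧
    40 * (B.links.filter fun k => ¬ B.Reg μ k s).card ≤ B.links.card

variable {μ} {B}

open Classical in
-- Double counting: at most 1/400 of the pairs of a link row and a spoke of the group are irregular,
-- so at most 1/10 of the spokes are irregular for more than 1/40 of the link rows.
theorem card_not_fair_le (P : Params κ K M n q ε δ l) (hκ : 2 ≤ κ) (h1 : OneIndependent μ)
    (hp : ∀ e : (bigGraph (Slot κ K M n) N).edgeSet, 0.5847 ≤ μ.real {ω | ω e = true})
    (hB : B.Sound μ ε) {a : Fin 3} (ha : B.Avail (Sum.inl a)) :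
    10 * ((groupSpokes κ K M n (Sum.inl a)).filter fun s => ¬ B.Fair μ s).card ≤
      2 ^ K * M * n := by
  set F := groupSpokes κ K M n (Sum.inl a) with hF
  set g := 2 ^ K * M * n with hg
  have hM : 0 < M := by have := P.M_large; omega
  have hgpos : 0 < g := by have := P.n_pos; positivity
  have hLpos : 0 < B.links.card := by
    rw [card_links]
    have := B.le_card_linkGroups hB.1
    exact Nat.mul_pos (by omega) hgpos
  have hcount : ∑ s ∈ F, (B.links.filter fun k => ¬ B.Reg μ k s).card =
      ∑ k ∈ B.links, (F.filter fun s => ¬ B.Reg μ k s).card := by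
    simp only [Finset.card_filter]
    exact Finset.sum_comm
  have hup : 400 * ∑ k ∈ B.links, (F.filter fun s => ¬ B.Reg μ k s).card ≤ B.links.card * g := by
    rw [Finset.mul_sum, ← smul_eq_mul]
    refine Finset.sum_le_card_nsmul _ _ _ fun k hk => ?_
    obtain ⟨⟨j, hj⟩, -⟩ := B.mem_links.1 hk
    exact card_not_reg_le P h1 hp hB k (by rw [hj]; simp) ha
  have hlow : (F.filter fun s => ¬ B.Fair μ s).card * B.links.card ≤
      40 * ∑ s ∈ F, (B.links.filter fun k => ¬ B.Reg μ k s).card := by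
    rw [Finset.mul_sum, ← smul_eq_mul]
    refine (Finset.card_nsmul_le_sum _ _ _ fun s hs => ?_).trans
      (Finset.sum_le_sum_of_subset (Finset.filter_subset (fun s => ¬ B.Fair μ s) F))
    obtain ⟨hs1, hs2⟩ := Finset.mem_filter.1 hs
    rw [hF, mem_groupSpokes] at hs1
    by_contra! hcon
    exact hs2 ⟨⟨a, hs1⟩, hs1 ▸ ha, hcon.le⟩
  rw [hcount] at hlow
  have h3 : 10 * ((F.filter fun s => ¬ B.Fair μ s).card * B.links.card) ≤ B.links.card * g := by
    linarith
  refine Nat.le_of_mul_le_mul_left ?_ hLpos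
  calc B.links.card * (10 * (F.filter fun s => ¬ B.Fair μ s).card) =
      10 * ((F.filter fun s => ¬ B.Fair μ s).card * B.links.card) := by ring
    _ ≤ _ := h3

/-- Two fair rows have many common link rows. -/
theorem exists_common_links (P : Params κ K M n q ε δ l) (h1 : OneIndependent μ)
    (hp : ∀ e : (bigGraph (Slot κ K M n) N).edgeSet, 0.5847 ≤ μ.real {ω | ω e = true})
    (hB : B.Sound μ ε) {s s' : Slot κ K M n} (hs : B.Fair μ s) (hs' : B.Fair μ s') :
    ∃ (A : Finset (Fin κ)) (k : Fin κ → Slot κ K M n), B.linkGroups.card ≤ 2 * A.card ∧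
      ∀ j ∈ A, B.Avail (Sum.inr j) ∧ (k j).1.1 = Sum.inr j ∧ B.Reg μ s (k j) ∧
        B.Reg μ (k j) s ∧ B.Reg μ s' (k j) ∧ B.Reg μ (k j) s' := by
  classical
  set g := 2 ^ K * M * n with hg
  have hM : 0 < M := by have := P.M_large; omega
  have hgpos : 0 < g := by have := P.n_pos; positivity
  let Q : Slot κ K M n → Prop := fun k =>
    B.Reg μ s k ∧ B.Reg μ k s ∧ B.Reg μ s' k ∧ B.Reg μ k s'
  let A := B.linkGroups.filter fun j => ∃ k, k.1.1 = Sum.inr j ∧ Q k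
  have hex : ∀ j, ∃ k : Slot κ K M n, j ∈ A → k.1.1 = Sum.inr j ∧ Q k := by
    intro j
    by_cases hj : j ∈ A
    · obtain ⟨k, hk⟩ := (Finset.mem_filter.1 hj).2
      exact ⟨k, fun _ => hk⟩
    · exact ⟨s, fun h => absurd h hj⟩
  choose k hk using hex
  refine ⟨A, k, ?_, fun j hj => ⟨B.mem_linkGroups.1 (Finset.mem_filter.1 hj).1, (hk j hj).1,
    (hk j hj).2⟩⟩
  have hsp : ∀ s, B.Fair μ s → 400 * (B.links.filter fun k => ¬ B.Reg μ s k).card ≤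
      B.links.card := by
    intro s hs
    rw [card_links, links_eq, Finset.filter_biUnion]
    refine (Nat.mul_le_mul_left _ Finset.card_biUnion_le).trans ?_
    rw [Finset.mul_sum, ← smul_eq_mul]
    refine Finset.sum_le_card_nsmul _ _ _ fun j hj => ?_
    obtain ⟨a, ha⟩ := hs.1
    exact card_not_reg_le P h1 hp hB s (by rw [ha]; simp) (B.mem_linkGroups.1 hj)
  -- For each of the two rows, 1/400 is lost to irregular spokes and 1/40 to fairness: 2/400 + 2/40
  -- = 55/1000. A link group without a good spoke is wholly bad, so such groups are few as well.
  have hbad : 1000 * (B.links.filter fun k => ¬ Q k).card ≤ 55 * B.links.card := by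
    have hsub : (B.links.filter fun k => ¬ Q k) ⊆
        ((B.links.filter fun k => ¬ B.Reg μ s k) ∪ (B.links.filter fun k => ¬ B.Reg μ k s)) ∪
        ((B.links.filter fun k => ¬ B.Reg μ s' k) ∪ (B.links.filter fun k => ¬ B.Reg μ k s')) := by
      intro k hk
      simp only [Finset.mem_union, Finset.mem_filter, Q] at hk ⊢
      tauto
    have c1 := Finset.card_le_card hsub
    have c2 := Finset.card_union_le
      ((B.links.filter fun k => ¬ B.Reg μ s k) ∪ (B.links.filter fun k => ¬ B.Reg μ k s))
      ((B.links.filter fun k => ¬ B.Reg μ s' k) ∪ (B.links.filter fun k => ¬ B.Reg μ k s'))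
    have c3 := Finset.card_union_le
      (B.links.filter fun k => ¬ B.Reg μ s k) (B.links.filter fun k => ¬ B.Reg μ k s)
    have c4 := Finset.card_union_le
      (B.links.filter fun k => ¬ B.Reg μ s' k) (B.links.filter fun k => ¬ B.Reg μ k s')
    have d1 := hsp s hs
    have d2 := hsp s' hs'
    have d3 := hs.2.2
    have d4 := hs'.2.2
    omega
  have hrest : ((B.linkGroups \ A).card) * g ≤ (B.links.filter fun k => ¬ Q k).card := by
    have : ((B.linkGroups \ A).biUnion fun j => groupSpokes κ K M n (Sum.inr j)) ⊆
        B.links.filter fun k => ¬ Q k := by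
      intro k hk
      obtain ⟨j, hj, hk⟩ := Finset.mem_biUnion.1 hk
      obtain ⟨hj1, hj2⟩ := Finset.mem_sdiff.1 hj
      rw [mem_groupSpokes] at hk
      refine Finset.mem_filter.2 ⟨B.mem_links.2 ⟨⟨j, hk⟩, hk ▸ B.mem_linkGroups.1 hj1⟩, ?_⟩
      exact fun hQ => hj2 (Finset.mem_filter.2 ⟨hj1, k, hk, hQ⟩)
    refine le_trans (le_of_eq ?_) (Finset.card_le_card this)
    rw [Finset.card_biUnion]
    · simp [card_groupSpokes, hg]
    · intro j _ j' _ hne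
      rw [Function.onFun, Finset.disjoint_left]
      intro t ht ht'
      rw [mem_groupSpokes] at ht ht'
      exact hne (Sum.inr_injective (ht.symm.trans ht'))
  have hcard : (B.linkGroups \ A).card + A.card = B.linkGroups.card :=
    Finset.card_sdiff_add_card_eq_card (Finset.filter_subset _ _)
  rw [card_links] at hbad
  have h5 : 1000 * (B.linkGroups \ A).card * g ≤ 55 * B.linkGroups.card * g := by
    calc 1000 * (B.linkGroups \ A).card * g = 1000 * ((B.linkGroups \ A).card * g) := by ring
      _ ≤ 1000 * (B.links.filter fun k => ¬ Q k).card := Nat.mul_le_mul_left _ hrest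
      _ ≤ _ := by rw [mul_assoc]; exact hbad
  have h6 := Nat.le_of_mul_le_mul_right h5 hgpos
  omega

end Base

theorem real_adj_ge {V : Type*} {G : SimpleGraph V} {μ : Measure (Config G)} {p : ℝ}
    (h : ∀ e : G.edgeSet, p ≤ μ.real {ω | ω e = true}) {a b : V} (hab : G.Adj a b) :
    p ≤ μ.real {ω | (openGraph ω).Adj a b} := by
  have h3 : {ω : Config G | (openGraph ω).Adj a b} = {ω | ω ⟨s(a, b), hab⟩ = true} := by
    ext ω; simp [openGraph_adj, hab]
  rw [h3]; exact h _

namespace Base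

set_option linter.unusedSectionVars false

variable {κ K M n N q : ℕ} {ε δ l : ℝ} (B B' : Base κ K M n N)

/-! ### Joining the rows of a base point -/

/-- The main components of two rows are connected. -/
def RowJoin (ω : Config (bigGraph (Slot κ K M n) N)) (s s' : Slot κ K M n) : Prop :=
  ∀ t ∈ B.core ω s, ∀ t' ∈ B.core ω s',
    (openIn ω {w | w.1 = B.site}).Reachable (B.tipSite s t) (B.tipSite s' t')

variable {B B'}

theorem core_reachable {ω : Config (bigGraph (Slot κ K M n) N)} {s t t' : Slot κ K M n}
    (ht : t ∈ B.core ω s) (ht' : t' ∈ B.core ω s) :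
    (openIn ω {w | w.1 = B.site}).Reachable (B.tipSite s t) (B.tipSite s t') :=
  siteStar_reachable ((dense_reachable (by norm_num) ht ht').mono (restr_le _ _))

theorem rowJoin_of_mem {ω : Config (bigGraph (Slot κ K M n) N)} {s k : Slot κ K M n}
    (h : k ∈ B.core ω s) (h' : s ∈ B.core ω k) : B.RowJoin ω s k := fun t ht t' ht' => by
  refine (core_reachable ht h).trans ?_
  rw [tipSite_comm]
  exact core_reachable h' ht'

theorem RowJoin.symm {ω : Config (bigGraph (Slot κ K M n) N)} {s s' : Slot κ K M n}
    (h : B.RowJoin ω s s') : B.RowJoin ω s' s := fun t ht t' ht' => (h t' ht' t ht).symm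

theorem RowJoin.trans {ω : Config (bigGraph (Slot κ K M n) N)} {s s' s'' : Slot κ K M n}
    (h : B.RowJoin ω s s') (h' : B.RowJoin ω s' s'') (hne : (B.core ω s').Nonempty) :
    B.RowJoin ω s s'' := fun t ht t' ht' => by
  obtain ⟨r, hr⟩ := hne
  exact (h t ht r hr).trans (h' r hr t' ht')

theorem core_nonempty (hB : B.erased.card ≤ 1) {ω : Config (bigGraph (Slot κ K M n) N)}
    {s : Slot κ K M n} (h : B.Coh ω s) : (B.core ω s).Nonempty := by
  refine (h (B.cells s) (B.cells s) subset_rfl subset_rfl ?_).1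
  obtain ⟨b, hb, hA⟩ : ∃ b, Sum.inl b ≠ s.1.1 ∧ B.Avail (Sum.inl b) := by
    rcases hs : s.1.1 with a | j
    · obtain ⟨b, hb, hA⟩ := B.exists_avail_row hB a
      exact ⟨b, fun h => hb (Sum.inl_injective h), hA⟩
    · obtain ⟨b, -, hA⟩ := B.exists_avail_row hB 0
      exact ⟨b, by simp, hA⟩
  refine le_trans ?_ (Finset.card_le_card (B.groupCells_subset hb hA))
  rw [card_groupCells]
  exact Nat.le_mul_of_pos_left _ (by positivity)

/-- Slot s is empty throughout the region in row s and filled throughout the one in row s', since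
neither region varies it. -/
theorem disjoint_reg_of_ne {s s' : Slot κ K M n} (hne : s ≠ s') (hs : s ∉ B.erased)
    {U U' : Set (Slot κ K M n)} (h : s ∉ U) (h' : s ∉ U') :
    Disjoint ((B.row s).reg U) ((B.row s').reg U') := by
  refine Disjoint.mono (region_subset_siteBox _ _ _) (region_subset_siteBox _ _ _)
    (disjoint_siteBox s h h' ?_)
  rw [rowLabels_self]
  exact (B.rowLabels_ne_none hne hs).symm

variable {μ : Measure (Config (bigGraph (Slot κ K M n) N))} [IsProbabilityMeasure μ]

/-- The event that a regular spoke is attached to the main component. -/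
theorem Reg.exists_event {s t : Slot κ K M n} (h : B.Reg μ s t) :
    ∃ X : Set (Config (bigGraph (Slot κ K M n) N)),
      DetBy ((B.row s).reg (groupSpokes κ K M n t.1.1)) X ∧
      (∀ ω ∈ X, B.Coh ω s → t ∈ B.core ω s) ∧ 0.55 ≤ μ.real X := by
  obtain ⟨X, Y, hX, -, hX', -, h1, h2, h3⟩ := h
  refine ⟨X, hX, hX', ?_⟩
  have : μ.real Y ≤ 1 := measureReal_le_one
  nlinarith

/-- Each common link row k j offers a detour from s to s' through two crossings, with probability at
least 0.01. Detours in different link groups use disjoint regions, so they are independent attempts.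
-/
theorem real_not_rowJoin_le (P : Params κ K M n q ε δ l) (h1 : OneIndependent μ)
    (hp : ∀ e : (bigGraph (Slot κ K M n) N).edgeSet, 0.5847 ≤ μ.real {ω | ω e = true})
    (hB : B.Sound μ ε) {s s' : Slot κ K M n} (hs : B.Fair μ s) (hs' : B.Fair μ s')
    (hne : s.1.1 ≠ s'.1.1) {m : ℕ} (hm : 2 * m + 1 ≤ κ) :
    μ.real {ω | (∀ k, B.Coh ω k) ∧ ¬ B.RowJoin ω s s'} ≤ 0.99 ^ m := by
  obtain ⟨A, k, hA, hk⟩ := exists_common_links P h1 hp hB hs hs'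
  have hAm : m ≤ A.card := by
    have := B.le_card_linkGroups hB.1
    omega
  obtain ⟨⟨a, ha⟩, hav, -⟩ := hs
  obtain ⟨⟨b, hb⟩, hav', -⟩ := hs'
  have hss : s ≠ s' := fun h => hne (by rw [h])
  have hse : s ∉ B.erased := Avail.notMem hav
  have hse' : s' ∉ B.erased := Avail.notMem hav'
  have hex : ∀ j, ∃ X1 X2 X3 X4 : Set (Config (bigGraph (Slot κ K M n) N)), j ∈ A →
      (DetBy ((B.row s).reg (groupSpokes κ K M n (Sum.inr j))) X1 ∧
      (∀ ω ∈ X1, B.Coh ω s → k j ∈ B.core ω s) ∧ 0.55 ≤ μ.real X1) ∧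
      (DetBy ((B.row (k j)).reg (groupSpokes κ K M n s.1.1)) X2 ∧
      (∀ ω ∈ X2, B.Coh ω (k j) → s ∈ B.core ω (k j)) ∧ 0.55 ≤ μ.real X2) ∧
      (DetBy ((B.row s').reg (groupSpokes κ K M n (Sum.inr j))) X3 ∧
      (∀ ω ∈ X3, B.Coh ω s' → k j ∈ B.core ω s') ∧ 0.55 ≤ μ.real X3) ∧
      (DetBy ((B.row (k j)).reg (groupSpokes κ K M n s'.1.1)) X4 ∧
      (∀ ω ∈ X4, B.Coh ω (k j) → s' ∈ B.core ω (k j)) ∧ 0.55 ≤ μ.real X4) := by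
    intro j
    by_cases hj : j ∈ A
    · obtain ⟨-, hkj, r1, r2, r3, r4⟩ := hk j hj
      obtain ⟨X1, h1⟩ := r1.exists_event
      obtain ⟨X2, h2⟩ := r2.exists_event
      obtain ⟨X3, h3⟩ := r3.exists_event
      obtain ⟨X4, h4⟩ := r4.exists_event
      rw [hkj] at h1 h3
      exact ⟨X1, X2, X3, X4, fun _ => ⟨h1, h2, h3, h4⟩⟩
    · exact ⟨∅, ∅, ∅, ∅, fun h => absurd h hj⟩
  choose X1 X2 X3 X4 hX using hex
  -- The two parts of each union share the crossing vertex, so the events there are combined by 0.55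
  -- + 0.55 - 1 = 0.1 only. The regions for s and for s' are disjoint, and the probabilities
  -- multiply.
  let R1 : Fin κ → Set (Site (Slot κ K M n) N) := fun j =>
    (B.row s).reg (groupSpokes κ K M n (Sum.inr j)) ∪
      (B.row (k j)).reg (groupSpokes κ K M n s.1.1)
  let R2 : Fin κ → Set (Site (Slot κ K M n) N) := fun j =>
    (B.row s').reg (groupSpokes κ K M n (Sum.inr j)) ∪
      (B.row (k j)).reg (groupSpokes κ K M n s'.1.1)
  have fin1 : ∀ j, (R1 j).Finite := fun j =>
    ((B.row s).reg_finite _).union ((B.row (k j)).reg_finite _)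
  have fin2 : ∀ j, (R2 j).Finite := fun j =>
    ((B.row s').reg_finite _).union ((B.row (k j)).reg_finite _)
  have det1 : ∀ j ∈ A, DetBy (R1 j) (X1 j ∩ X2 j) := fun j hj =>
    ((hX j hj).1.1.mono Set.subset_union_left).inter
      ((hX j hj).2.1.1.mono Set.subset_union_right)
  have det2 : ∀ j ∈ A, DetBy (R2 j) (X3 j ∩ X4 j) := fun j hj =>
    ((hX j hj).2.2.1.1.mono Set.subset_union_left).inter
      ((hX j hj).2.2.2.1.mono Set.subset_union_right)
  have memG : ∀ {t : Slot κ K M n} {h}, t ∈ (groupSpokes κ K M n h : Set (Slot κ K M n)) ↔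
      t.1.1 = h := fun {t h} => by rw [Finset.mem_coe, mem_groupSpokes]
  have disG : ∀ {h h' : Fin 3 ⊕ Fin κ}, h ≠ h' →
      Disjoint (groupSpokes κ K M n h : Set (Slot κ K M n)) (groupSpokes κ K M n h') :=
    fun hne => Set.disjoint_left.2 fun t ht ht' => hne ((memG.1 ht).symm.trans (memG.1 ht'))
  have hkg : ∀ j ∈ A, (k j).1.1 = Sum.inr j := fun j hj => (hk j hj).2.1
  have hke : ∀ j ∈ A, k j ∉ B.erased := fun j hj =>
    Avail.notMem (by rw [hkg j hj]; exact (hk j hj).1)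
  have hks : ∀ j ∈ A, k j ≠ s := fun j hj h => by
    have := hkg j hj; rw [h, ha] at this; simp at this
  have hks' : ∀ j ∈ A, k j ≠ s' := fun j hj h => by
    have := hkg j hj; rw [h, hb] at this; simp at this
  have disj12 : ∀ j ∈ A, Disjoint (R1 j) (R2 j) := by
    intro j hj
    refine Disjoint.union_left (Disjoint.union_right ?_ ?_) (Disjoint.union_right ?_ ?_)
    · exact disjoint_reg_of_ne hss hse (by rw [memG, ha]; simp) (by rw [memG, ha]; simp)
    · exact disjoint_reg_of_ne (hks j hj).symm hse (by rw [memG, ha]; simp) (by rwa [memG])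
    · exact (disjoint_reg_of_ne (hks' j hj).symm hse' (by rw [memG, hb]; simp)
        (by rw [memG]; exact hne.symm)).symm
    · exact (B.row (k j)).reg_disjoint (disG hne)
  have disjj : ∀ i ∈ A, ∀ j ∈ A, i ≠ j → Disjoint (R1 i ∪ R2 i) (R1 j ∪ R2 j) := by
    intro i hi j hj hij
    have hij' : (Sum.inr i : Fin 3 ⊕ Fin κ) ≠ Sum.inr j := fun h => hij (Sum.inr_injective h)
    have hkk : k i ≠ k j := fun h => hij' (by rw [← hkg i hi, ← hkg j hj, h])
    have kk : ∀ h h' : Fin 3 ⊕ Fin κ, (∃ c, h = Sum.inl c) → (∃ c, h' = Sum.inl c) →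
        Disjoint ((B.row (k i)).reg (groupSpokes κ K M n h))
          ((B.row (k j)).reg (groupSpokes κ K M n h')) := by
      rintro _ _ ⟨c, rfl⟩ ⟨c', rfl⟩
      exact disjoint_reg_of_ne hkk (hke i hi) (by rw [memG, hkg i hi]; simp)
        (by rw [memG, hkg i hi]; simp)
    have sk : ∀ i ∈ A, ∀ j ∈ A, i ≠ j → ∀ r, k j ≠ r → ∀ h : Fin 3 ⊕ Fin κ,
        (∃ c, h = Sum.inl c) → Disjoint ((B.row r).reg (groupSpokes κ K M n (Sum.inr i)))
          ((B.row (k j)).reg (groupSpokes κ K M n h)) := by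
      rintro i hi j hj hij r hr _ ⟨c, rfl⟩
      exact (disjoint_reg_of_ne hr (hke j hj) (by rw [memG, hkg j hj]; simp)
        (by rw [memG, hkg j hj]; simpa using hij.symm)).symm
    refine Disjoint.union_left (Disjoint.union_left ?_ ?_) (Disjoint.union_left ?_ ?_) <;>
      refine Disjoint.union_right (Disjoint.union_right ?_ ?_) (Disjoint.union_right ?_ ?_)
    · exact (B.row s).reg_disjoint (disG hij')
    · exact sk i hi j hj hij s (hks j hj) _ ⟨a, ha⟩
    · exact disjoint_reg_of_ne hss hse (by rw [memG, ha]; simp) (by rw [memG, ha]; simp)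
    · exact sk i hi j hj hij s (hks j hj) _ ⟨b, hb⟩
    · exact (sk j hj i hi hij.symm s (hks i hi) _ ⟨a, ha⟩).symm
    · exact kk _ _ ⟨a, ha⟩ ⟨a, ha⟩
    · exact (sk j hj i hi hij.symm s' (hks' i hi) _ ⟨a, ha⟩).symm
    · exact kk _ _ ⟨a, ha⟩ ⟨b, hb⟩
    · exact (disjoint_reg_of_ne hss hse (by rw [memG, ha]; simp) (by rw [memG, ha]; simp)).symm
    · exact sk i hi j hj hij s' (hks' j hj) _ ⟨a, ha⟩
    · exact (B.row s').reg_disjoint (disG hij')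
    · exact sk i hi j hj hij s' (hks' j hj) _ ⟨b, hb⟩
    · exact (sk j hj i hi hij.symm s (hks i hi) _ ⟨b, hb⟩).symm
    · exact kk _ _ ⟨b, hb⟩ ⟨a, ha⟩
    · exact (sk j hj i hi hij.symm s' (hks' i hi) _ ⟨b, hb⟩).symm
    · exact kk _ _ ⟨b, hb⟩ ⟨b, hb⟩
  let E : Fin κ → Set (Config (bigGraph (Slot κ K M n) N)) := fun j =>
    (X1 j ∩ X2 j) ∩ (X3 j ∩ X4 j)
  have hE : ∀ j ∈ A, 0.01 ≤ μ.real (E j) := by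
    intro j hj
    obtain ⟨⟨d1, -, p1⟩, ⟨d2, -, p2⟩, ⟨d3, -, p3⟩, ⟨d4, -, p4⟩⟩ := hX j hj
    rw [(det1 j hj).real_inter h1 (det2 j hj) (fin1 j) (fin2 j) (disj12 j hj)]
    have e1 := real_inter_ge (μ := μ) (X1 j) (X2 j) (d2.measurableSet ((B.row _).reg_finite _))
    have e2 := real_inter_ge (μ := μ) (X3 j) (X4 j) (d4.measurableSet ((B.row _).reg_finite _))
    nlinarith
  have hfail := DetBy.real_forall_not_le h1 A (fun j => R1 j ∪ R2 j) E
    (fun j hj => ((det1 j hj).mono Set.subset_union_left).inter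
      ((det2 j hj).mono Set.subset_union_right))
    (fun j _ => (fin1 j).union (fin2 j)) disjj hE
  refine (measureReal_mono ?_ (measure_ne_top _ _)).trans (hfail.trans ?_)
  · rintro ω ⟨hco, hnj⟩ j hj ⟨⟨x1, x2⟩, ⟨x3, x4⟩⟩
    obtain ⟨⟨-, c1, -⟩, ⟨-, c2, -⟩, ⟨-, c3, -⟩, ⟨-, c4, -⟩⟩ := hX j hj
    refine hnj ((rowJoin_of_mem (c1 ω x1 (hco _)) (c2 ω x2 (hco _))).trans
      (rowJoin_of_mem (c3 ω x3 (hco _)) (c4 ω x4 (hco _))).symm (core_nonempty hB.1 (hco _)))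
  · have : (1 - 0.01 : ℝ) = 0.99 := by norm_num
    rw [this]
    exact pow_le_pow_of_le_one (by norm_num) (by norm_num) hAm

variable (μ B) in
/-- All rows are coherent, and all fair rows are joined. -/
def Uniform (ω : Config (bigGraph (Slot κ K M n) N)) : Prop :=
  (∀ k, B.Coh ω k) ∧ ∀ s s', B.Fair μ s → B.Fair μ s' → B.RowJoin ω s s'

theorem exists_fair (P : Params κ K M n q ε δ l) (hκ : 2 ≤ κ) (h1 : OneIndependent μ)
    (hp : ∀ e : (bigGraph (Slot κ K M n) N).edgeSet, 0.5847 ≤ μ.real {ω | ω e = true})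
    (hB : B.Sound μ ε) {a : Fin 3} (ha : B.Avail (Sum.inl a)) :
    ∃ s, s.1.1 = Sum.inl a ∧ B.Fair μ s := by
  classical
  have hM : 0 < M := by have := P.M_large; omega
  have hgpos : 0 < 2 ^ K * M * n := by have := P.n_pos; positivity
  have hc := card_not_fair_le P hκ h1 hp hB ha
  by_contra! hcon
  rw [Finset.filter_true_of_mem (fun s hs => hcon s (mem_groupSpokes.1 hs)),
    card_groupSpokes] at hc
  omega

theorem real_not_uniform_le (P : Params κ K M n q ε δ l) (hκ : 2 ≤ κ) (h1 : OneIndependent μ)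
    (hp : ∀ e : (bigGraph (Slot κ K M n) N).edgeSet, 0.5847 ≤ μ.real {ω | ω e = true})
    (hB : B.Sound μ ε) {m : ℕ} (hm : 2 * m + 1 ≤ κ) :
    μ.real {ω | ¬ B.Uniform μ ω} ≤ Fintype.card (Slot κ K M n) * l +
      (Fintype.card (Slot κ K M n)) ^ 2 * 0.99 ^ m := by
  classical
  let Q := (Finset.univ : Finset (Slot κ K M n × Slot κ K M n)).filter fun x =>
    B.Fair μ x.1 ∧ B.Fair μ x.2 ∧ x.1.1.1 ≠ x.2.1.1
  have hsub : {ω | ¬ B.Uniform μ ω} ⊆ (⋃ k ∈ (Finset.univ : Finset (Slot κ K M n)),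
      {ω | ¬ B.Coh ω k}) ∪ ⋃ x ∈ Q, {ω | (∀ k, B.Coh ω k) ∧ ¬ B.RowJoin ω x.1 x.2} := by
    intro ω hω
    by_cases hco : ∀ k, B.Coh ω k
    swap
    · push Not at hco
      obtain ⟨k, hk⟩ := hco
      exact Or.inl (Set.mem_iUnion₂.2 ⟨k, Finset.mem_univ k, hk⟩)
    right
    by_contra hcon
    simp only [Set.mem_iUnion, not_exists] at hcon
    have hj : ∀ s s', B.Fair μ s → B.Fair μ s' → s.1.1 ≠ s'.1.1 → B.RowJoin ω s s' := by
      intro s s' hs hs' hne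
      by_contra hnj
      exact hcon (s, s') (Finset.mem_filter.2 ⟨Finset.mem_univ _, hs, hs', hne⟩) ⟨hco, hnj⟩
    refine hω ⟨hco, fun s s' hs hs' => ?_⟩
    by_cases hne : s.1.1 = s'.1.1
    · obtain ⟨a, ha⟩ := hs.1
      -- Rows of the same group are joined through a fair row of another available group, since the
      -- detour estimate requires distinct groups.
      obtain ⟨b, hba, hb⟩ := B.exists_avail_row hB.1 a
      obtain ⟨r, hr, hrf⟩ := exists_fair P hκ h1 hp hB hb
      have hsr : s.1.1 ≠ r.1.1 := by
        rw [ha, hr]; exact fun h => hba (Sum.inl_injective h).symm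
      exact (hj s r hs hrf hsr).trans (hj r s' hrf hs' (by rw [← hne]; exact hsr.symm))
        (core_nonempty hB.1 (hco r))
    · exact hj s s' hs hs' hne
  refine (measureReal_mono hsub (measure_ne_top _ _)).trans ((measureReal_union_le _ _).trans
    (add_le_add ?_ ?_))
  · refine (measureReal_biUnion_finset_le _ _).trans ?_
    refine (Finset.sum_le_card_nsmul _ _ l fun k _ => real_not_coh_le P h1 hp hB k).trans ?_
    rw [nsmul_eq_mul, Finset.card_univ]
  · refine (measureReal_biUnion_finset_le _ _).trans ?_
    refine (Finset.sum_le_card_nsmul _ _ ((0.99 : ℝ) ^ m) fun x hx => ?_).trans ?_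
    · obtain ⟨-, hx1, hx2, hx3⟩ := Finset.mem_filter.1 hx
      exact real_not_rowJoin_le P h1 hp hB hx1 hx2 hx3 hm
    · rw [nsmul_eq_mul]
      refine mul_le_mul_of_nonneg_right ?_ (by positivity)
      have : Q.card ≤ Fintype.card (Slot κ K M n) ^ 2 := by
        refine (Finset.card_filter_le _ _).trans (le_of_eq ?_)
        rw [Finset.card_univ, Fintype.card_prod, sq]
      exact_mod_cast this

/-! ### Joining neighbouring base points -/

variable (B B') in
/-- The base points differ by a step in the grid or by the removal of a label. -/
def Neighbour : Prop := (∀ t ∉ B'.erased, B'.labels t = B.labels t) ∧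
  ((gridGraph.Adj B.site B'.site ∧ B'.erased = B.erased) ∨
    (B'.site = B.site ∧ B.erased = ∅ ∧ ∃ g, B'.erased = {g}))

theorem Neighbour.subset (h : B.Neighbour B') : B.erased ⊆ B'.erased := by
  rcases h.2 with ⟨-, h⟩ | ⟨-, h, -⟩
  · rw [h]
  · rw [h]; exact Finset.empty_subset _

theorem Neighbour.avail (h : B.Neighbour B') {a : Fin 3 ⊕ Fin κ} (ha : B'.Avail a) : B.Avail a :=
  fun t ht => ha t (h.subset ht)

theorem rowLabels_eq (hl : ∀ t ∉ B'.erased, B'.labels t = B.labels t)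
    (he : B'.erased = B.erased) {s : Slot κ K M n} : B'.rowLabels s = B.rowLabels s := by
  rw [rowLabels, rowLabels, ← he]
  exact mask_congr fun t ht => hl t fun h => ht (Finset.mem_insert_of_mem h)

theorem rowLabels_eq_erase (hl : ∀ t ∉ B'.erased, B'.labels t = B.labels t) (h0 : B.erased = ∅)
    {g : Slot κ K M n} (hg : B'.erased = {g}) {s : Slot κ K M n} :
    B'.rowLabels s = erase (B.rowLabels s) g := by
  rw [rowLabels, rowLabels, ← mask_insert, h0, hg, Finset.pair_comm]
  refine mask_congr fun t ht => hl t fun h => ht ?_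
  rw [hg, Finset.mem_singleton] at h
  rw [h]
  exact Finset.mem_insert_self _ _

theorem Neighbour.adj (h : B.Neighbour B') {s : Slot κ K M n} (hs : s ∉ B'.erased) :
    (bigGraph (Slot κ K M n) N).Adj (B.site, B.rowLabels s) (B'.site, B'.rowLabels s) := by
  obtain ⟨hl, ⟨hg, he⟩ | ⟨hu, h0, g, hg⟩⟩ := h
  · have : B'.rowLabels s = B.rowLabels s := rowLabels_eq hl he
    rw [this]
    exact bigGraph_adj_grid hg _
  · have hgs : g ≠ s := by rintro rfl; exact hs (by rw [hg]; exact Finset.mem_singleton_self _)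
    have : B'.rowLabels s = erase (B.rowLabels s) g := by
      exact rowLabels_eq_erase hl h0 hg
    rw [hu, this]
    exact bigGraph_adj_erase _ (B.rowLabels_ne_none hgs (by rw [h0]; exact Finset.notMem_empty _))

theorem Neighbour.adj_tip (h : B.Neighbour B') {s t : Slot κ K M n} (hs : s ∉ B'.erased)
    (ht : t ∉ B'.erased) : (bigGraph (Slot κ K M n) N).Adj (B.tipSite s t) (B'.tipSite s t) := by
  obtain ⟨hl, ⟨hg, he⟩ | ⟨hu, h0, g, hg⟩⟩ := h
  · have : B'.rowLabels s = B.rowLabels s := rowLabels_eq hl he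
    rw [tipSite, tipSite, this]
    exact bigGraph_adj_grid hg _
  · have hgs : g ≠ s := by rintro rfl; exact hs (by rw [hg]; exact Finset.mem_singleton_self _)
    have hgt : g ≠ t := by rintro rfl; exact ht (by rw [hg]; exact Finset.mem_singleton_self _)
    have : B'.rowLabels s = erase (B.rowLabels s) g := by
      exact rowLabels_eq_erase hl h0 hg
    rw [tipSite, tipSite, hu, this, erase_comm]
    refine bigGraph_adj_erase _ ?_
    rw [erase_apply_of_ne _ hgt]
    exact B.rowLabels_ne_none hgs (by rw [h0]; exact Finset.notMem_empty _)

theorem Neighbour.disjoint (h : B.Neighbour B') {s : Slot κ K M n} (hs : s ∉ B'.erased)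
    {U : Set (Slot κ K M n)} (hU : ∀ t ∈ B'.erased, t ∉ U) :
    Disjoint (siteBox B.site (B.rowLabels s) U) (siteBox B'.site (B'.rowLabels s) U) := by
  obtain ⟨hl, ⟨hg, he⟩ | ⟨hu, h0, g, hg⟩⟩ := h
  · exact disjoint_siteBox_of_ne hg.ne _ _ _ _
  · have hgm : g ∈ B'.erased := by rw [hg]; exact Finset.mem_singleton_self _
    have hgs : g ≠ s := by rintro rfl; exact hs hgm
    refine disjoint_siteBox g (hU g hgm) (hU g hgm) ?_
    have : B'.rowLabels s g = none := by
      simp [rowLabels, mask, hgm]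
    rw [this]
    exact B.rowLabels_ne_none hgs (by rw [h0]; exact Finset.notMem_empty _)

variable (μ B B') in
/-- The main components of a common fair row are connected. -/
def BaseJoin (ω : Config (bigGraph (Slot κ K M n) N)) : Prop :=
  ∃ s, B.Fair μ s ∧ B'.Fair μ s ∧ ∀ t ∈ B.core ω s, ∀ t' ∈ B'.core ω s,
    (openIn ω {w | w.1 = B.site ∨ w.1 = B'.site}).Reachable (B.tipSite s t) (B'.tipSite s t')

/-- If both products were below 0.4353 = 1.02 - 0.5847, then (2a-1)(2a'-1) and (2b-1)(2b'-1) would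
be below 0.1022, against the lower bound 0.109² for the product of all four factors. -/
theorem product_bound {a b a' b' : ℝ} (ha : 1 / 2 < a) (hb : 1 / 2 < b) (ha' : 1 / 2 < a')
    (hb' : 1 / 2 < b') (h : 0.109 ≤ (2 * a - 1) * (2 * b - 1))
    (h' : 0.109 ≤ (2 * a' - 1) * (2 * b' - 1)) : 0.4353 ≤ a * a' ∨ 0.4353 ≤ b * b' := by
  have key : ∀ x y : ℝ, 1 / 2 < x → 1 / 2 < y → x * y < 0.4353 →
      (2 * x - 1) * (2 * y - 1) < 0.1022 := by
    intro x y hx hy hxy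
    by_contra! hcon
    -- By AM-GM a smaller sum has product at most 0.6393²/4 < 0.1022. With this sum, 4xy is at least
    -- 0.1022 + 0.6393 + 1 > 4·0.4353.
    have h1 : 0.6393 ≤ (2 * x - 1) + (2 * y - 1) := by
      by_contra! h2
      nlinarith [sq_nonneg ((2 * x - 1) - (2 * y - 1))]
    nlinarith
  by_contra! hcon
  have k1 := key a a' ha ha' hcon.1
  have k2 := key b b' hb hb' hcon.2
  have p1 : 0 < (2 * a - 1) * (2 * a' - 1) := mul_pos (by linarith) (by linarith)
  have p2 : 0 < (2 * b - 1) * (2 * b' - 1) := mul_pos (by linarith) (by linarith)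
  have l1 : (2 * a - 1) * (2 * a' - 1) * ((2 * b - 1) * (2 * b' - 1)) ≤ 0.1022 * 0.1022 :=
    mul_le_mul k1.le k2.le p2.le (by norm_num)
  have l2 : 0.109 * 0.109 ≤ (2 * a - 1) * (2 * b - 1) * ((2 * a' - 1) * (2 * b' - 1)) :=
    mul_le_mul h h' (by norm_num) (by linarith)
  nlinarith

/-- A spoke that is regular on both sides gives a chance of joining the two rows. -/
theorem exists_join_event (h1 : OneIndependent μ)
    (hp : ∀ e : (bigGraph (Slot κ K M n) N).edgeSet, 0.5847 ≤ μ.real {ω | ω e = true})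
    (hN : B.Neighbour B') {s t : Slot κ K M n} (hs : s ∉ B'.erased) (ht : B'.Avail t.1.1)
    (hr : B.Reg μ s t) (hr' : B'.Reg μ s t) :
    ∃ E : Set (Config (bigGraph (Slot κ K M n) N)),
      DetBy (siteBox B.site (B.rowLabels s) (groupSpokes κ K M n t.1.1) ∪
        siteBox B'.site (B'.rowLabels s) (groupSpokes κ K M n t.1.1)) E ∧ 0.02 ≤ μ.real E ∧
      ∀ ω ∈ E, B.Coh ω s → B'.Coh ω s → ∀ r ∈ B.core ω s, ∀ r' ∈ B'.core ω s,
        (openIn ω {w | w.1 = B.site ∨ w.1 = B'.site}).Reachable (B.tipSite s r)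
          (B'.tipSite s r') := by
  set U := (groupSpokes κ K M n t.1.1 : Set (Slot κ K M n)) with hU
  have htU : t ∈ U := by rw [hU, Finset.mem_coe, mem_groupSpokes]
  have hdis : Disjoint (siteBox B.site (B.rowLabels s) U) (siteBox B'.site (B'.rowLabels s) U) :=
    hN.disjoint hs fun r hr hrU => by
      rw [hU, Finset.mem_coe, mem_groupSpokes] at hrU
      exact ht r hr hrU
  have fin1 := finite_siteBox B.site (B.rowLabels s) U
  have fin2 := finite_siteBox B'.site (B'.rowLabels s) U
  have core1 : ∀ {ω r r'}, r ∈ B.core ω s → r' ∈ B.core ω s →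
      (openIn ω {w | w.1 = B.site ∨ w.1 = B'.site}).Reachable (B.tipSite s r) (B.tipSite s r') :=
    fun h h' => (core_reachable h h').mono (openIn_mono _ fun _ hw => Or.inl hw)
  have core2 : ∀ {ω r r'}, r ∈ B'.core ω s → r' ∈ B'.core ω s →
      (openIn ω {w | w.1 = B.site ∨ w.1 = B'.site}).Reachable (B'.tipSite s r) (B'.tipSite s r') :=
    fun h h' => (core_reachable h h').mono (openIn_mono _ fun _ hw => Or.inr hw)
  obtain ⟨X, Y, hX, hY, hX', hY', a1, a2, a3⟩ := hr
  obtain ⟨Z, W, hZ, hW, hZ', hW', b1, b2, b3⟩ := hr'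
  have dX : DetBy (siteBox B.site (B.rowLabels s) U) X := hX.mono (region_subset_siteBox _ _ _)
  have dZ : DetBy (siteBox B'.site (B'.rowLabels s) U) Z := hZ.mono (region_subset_siteBox _ _ _)
  have dY : DetBy (siteBox B.site (B.rowLabels s) U) Y :=
    hY.mono (insert_region_subset_siteBox _ _ _)
  have dW : DetBy (siteBox B'.site (B'.rowLabels s) U) W :=
    hW.mono (insert_region_subset_siteBox _ _ _)
  have hsite : ∀ (C : Base κ K M n N) r, r ∈ U →
      C.tipSite s r ∈ siteBox C.site (C.rowLabels s) U := fun C r hr =>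
    ⟨rfl, fun r' hr' => erase_apply_of_ne _ fun h => hr' (h ▸ hr)⟩
  -- The bridge is the edge between the far ends if these are likely attached on both sides, and
  -- otherwise the edge between the centres. Either way the chance is at least 0.5847 + 0.4353 - 1 =
  -- 0.02.
  rcases product_bound a1 a2 b1 b2 a3 b3 with hprod | hprod
  · refine ⟨{ω | (openGraph ω).Adj (B.tipSite s t) (B'.tipSite s t)} ∩ (X ∩ Z), ?_, ?_, ?_⟩
    · refine DetBy.inter ((detBy_adj _ _).mono ?_) ((dX.mono Set.subset_union_left).inter
        (dZ.mono Set.subset_union_right))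
      rintro _ (rfl | rfl)
      · exact Or.inl (hsite B t htU)
      · exact Or.inr (hsite B' t htU)
    · have e1 := real_adj_ge hp (hN.adj_tip hs (Avail.notMem ht))
      have e2 := real_inter_ge (μ := μ) {ω | (openGraph ω).Adj (B.tipSite s t) (B'.tipSite s t)}
        (X ∩ Z) ((dX.measurableSet fin1).inter (dZ.measurableSet fin2))
      rw [dX.real_inter h1 dZ fin1 fin2 hdis] at e2
      linarith
    · rintro ω ⟨hadj, hx, hz⟩ hco hco' r hr r' hr'
      refine (core1 hr (hX' ω hx hco)).trans (SimpleGraph.Reachable.trans ?_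
        (core2 (hZ' ω hz hco') hr'))
      exact SimpleGraph.Adj.reachable ⟨hadj, Or.inl rfl, Or.inr rfl⟩
  · refine ⟨{ω | (openGraph ω).Adj (B.site, B.rowLabels s) (B'.site, B'.rowLabels s)} ∩
      (Y ∩ W), ?_, ?_, ?_⟩
    · refine DetBy.inter ((detBy_adj _ _).mono ?_) ((dY.mono Set.subset_union_left).inter
        (dW.mono Set.subset_union_right))
      rintro _ (rfl | rfl)
      · exact Or.inl ⟨rfl, fun _ _ => rfl⟩
      · exact Or.inr ⟨rfl, fun _ _ => rfl⟩
    · have e1 := real_adj_ge hp (hN.adj hs)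
      have e2 := real_inter_ge (μ := μ)
        {ω | (openGraph ω).Adj (B.site, B.rowLabels s) (B'.site, B'.rowLabels s)}
        (Y ∩ W) ((dY.measurableSet fin1).inter (dW.measurableSet fin2))
      rw [dY.real_inter h1 dW fin1 fin2 hdis] at e2
      linarith
    · rintro ω ⟨hadj, hy, hw⟩ hco hco' r hr r' hr'
      obtain ⟨c, hc, hcc⟩ := hY' ω hy hco
      obtain ⟨d, hd, hdc⟩ := hW' ω hw hco'
      have s1 : (openIn ω {w | w.1 = B.site ∨ w.1 = B'.site}).Adj (B.site, B.rowLabels s)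
          (B.tipSite s c) := ⟨hc, Or.inl rfl, Or.inl rfl⟩
      have s2 : (openIn ω {w | w.1 = B.site ∨ w.1 = B'.site}).Adj (B'.site, B'.rowLabels s)
          (B'.tipSite s d) := ⟨hd, Or.inr rfl, Or.inr rfl⟩
      have s3 : (openIn ω {w | w.1 = B.site ∨ w.1 = B'.site}).Adj (B.site, B.rowLabels s)
          (B'.site, B'.rowLabels s) := ⟨hadj, Or.inl rfl, Or.inr rfl⟩
      exact (core1 hr hcc).trans (s1.symm.reachable.trans (s3.reachable.trans
        (s2.reachable.trans (core2 hdc hr'))))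

/-- In an available row group at least four fifths of the rows are fair for both base points, and
each makes an attempt through a spoke of one fixed link group. The attempts are independent because
slot s is empty only in row s. -/
theorem real_not_baseJoin_le (P : Params κ K M n q ε δ l) (hκ : 2 ≤ κ) (h1 : OneIndependent μ)
    (hp : ∀ e : (bigGraph (Slot κ K M n) N).edgeSet, 0.5847 ≤ μ.real {ω | ω e = true})
    (hB : B.Sound μ ε) (hB' : B'.Sound μ ε) (hN : B.Neighbour B') {m : ℕ}
    (hm : 2 * m ≤ 2 ^ K * M * n) :
    μ.real {ω | (∀ k, B.Coh ω k) ∧ (∀ k, B'.Coh ω k) ∧ ¬ BaseJoin B B' μ ω} ≤ 0.98 ^ m := by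
  classical
  set g := 2 ^ K * M * n with hg
  have hM : 0 < M := by have := P.M_large; omega
  have hgpos : 0 < g := by have := P.n_pos; positivity
  obtain ⟨a, -, ha'⟩ := B'.exists_avail_row hB'.1 0
  have ha := hN.avail ha'
  obtain ⟨j, hj'⟩ : ∃ j, B'.Avail (Sum.inr j) := by
    have := B'.le_card_linkGroups hB'.1
    obtain ⟨j, hj⟩ := Finset.card_pos.1 (by omega : 0 < B'.linkGroups.card)
    exact ⟨j, B'.mem_linkGroups.1 hj⟩
  have hj := hN.avail hj'
  let A := (groupSpokes κ K M n (Sum.inl a)).filter fun s => B.Fair μ s ∧ B'.Fair μ s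
  have hA : m ≤ A.card := by
    have c1 := card_not_fair_le P hκ h1 hp hB ha
    have c2 := card_not_fair_le P hκ h1 hp hB' ha'
    have hsub : groupSpokes κ K M n (Sum.inl a) ⊆ A ∪
        (((groupSpokes κ K M n (Sum.inl a)).filter fun s => ¬ B.Fair μ s) ∪
        ((groupSpokes κ K M n (Sum.inl a)).filter fun s => ¬ B'.Fair μ s)) := by
      intro s hs
      simp only [A, Finset.mem_union, Finset.mem_filter, hs, true_and]
      tauto
    have c3 := (Finset.card_le_card hsub).trans (Finset.card_union_le _ _)
    have c4 := Finset.card_union_le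
      ((groupSpokes κ K M n (Sum.inl a)).filter fun s => ¬ B.Fair μ s)
      ((groupSpokes κ K M n (Sum.inl a)).filter fun s => ¬ B'.Fair μ s)
    rw [card_groupSpokes] at c3
    omega
  have hAs : ∀ s ∈ A, s.1.1 = Sum.inl a ∧ B.Fair μ s ∧ B'.Fair μ s := fun s hs => by
    simpa only [A, Finset.mem_filter, mem_groupSpokes] using hs
  have hex : ∀ s, ∃ E : Set (Config (bigGraph (Slot κ K M n) N)), s ∈ A →
      DetBy (siteBox B.site (B.rowLabels s) (groupSpokes κ K M n (Sum.inr j)) ∪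
        siteBox B'.site (B'.rowLabels s) (groupSpokes κ K M n (Sum.inr j))) E ∧ 0.02 ≤ μ.real E ∧
      ∀ ω ∈ E, B.Coh ω s → B'.Coh ω s → ∀ r ∈ B.core ω s, ∀ r' ∈ B'.core ω s,
        (openIn ω {w | w.1 = B.site ∨ w.1 = B'.site}).Reachable (B.tipSite s r)
          (B'.tipSite s r') := by
    intro s
    by_cases hs : s ∈ A
    swap
    · exact ⟨∅, fun h => absurd h hs⟩
    obtain ⟨hsa, -, hsf⟩ := hAs s hs
    have hne : (Sum.inr j : Fin 3 ⊕ Fin κ) ≠ s.1.1 := by rw [hsa]; simp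
    obtain ⟨t, ht, hr, hr'⟩ : ∃ t : Slot κ K M n, t.1.1 = Sum.inr j ∧ B.Reg μ s t ∧
        B'.Reg μ s t := by
      by_contra! hcon
      have c1 := card_not_reg_le P h1 hp hB s hne hj
      have c2 := card_not_reg_le P h1 hp hB' s hne hj'
      have hsub : groupSpokes κ K M n (Sum.inr j) ⊆
          ((groupSpokes κ K M n (Sum.inr j)).filter fun t => ¬ B.Reg μ s t) ∪
          ((groupSpokes κ K M n (Sum.inr j)).filter fun t => ¬ B'.Reg μ s t) := by
        intro t ht
        have := hcon t (mem_groupSpokes.1 ht)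
        simp only [Finset.mem_union, Finset.mem_filter, ht, true_and]
        tauto
      have c3 := (Finset.card_le_card hsub).trans (Finset.card_union_le _ _)
      rw [card_groupSpokes] at c3
      omega
    obtain ⟨E, hE⟩ := exists_join_event h1 hp hN (Avail.notMem hsf.2.1) (ht ▸ hj') hr hr'
    rw [ht] at hE
    exact ⟨E, fun _ => hE⟩
  choose E hE using hex
  have hsU : ∀ s ∈ A, s ∉ (groupSpokes κ K M n (Sum.inr j) : Set (Slot κ K M n)) := by
    intro s hs h
    rw [Finset.mem_coe, mem_groupSpokes, (hAs s hs).1] at h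
    simp at h
  have hfail := DetBy.real_forall_not_le h1 A
    (fun s => siteBox B.site (B.rowLabels s) (groupSpokes κ K M n (Sum.inr j)) ∪
        siteBox B'.site (B'.rowLabels s) (groupSpokes κ K M n (Sum.inr j))) E
    (fun s hs => (hE s hs).1) (fun s _ => (finite_siteBox _ _ _).union (finite_siteBox _ _ _))
    (fun s hs s' hs' hne => by
      have d : ∀ C C' : Base κ K M n N, s ∉ C'.erased →
          Disjoint (siteBox C.site (C.rowLabels s) (groupSpokes κ K M n (Sum.inr j)))
            (siteBox C'.site (C'.rowLabels s') (groupSpokes κ K M n (Sum.inr j))) := by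
        intro C C' hsC
        refine disjoint_siteBox s (hsU s hs) (hsU s hs) ?_
        rw [rowLabels_self]
        exact (C'.rowLabels_ne_none hne hsC).symm
      have n1 : s ∉ B.erased := Avail.notMem (hAs s hs).2.1.2.1
      have n2 : s ∉ B'.erased := Avail.notMem (hAs s hs).2.2.2.1
      exact Disjoint.union_left (Disjoint.union_right (d _ _ n1) (d _ _ n2))
        (Disjoint.union_right (d _ _ n1) (d _ _ n2)))
    (fun s hs => (hE s hs).2.1)
  refine (measureReal_mono ?_ (measure_ne_top _ _)).trans (hfail.trans ?_)
  · rintro ω ⟨hco, hco', hnj⟩ s hs hω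
    exact hnj ⟨s, (hAs s hs).2.1, (hAs s hs).2.2, (hE s hs).2.2 ω hω (hco s) (hco' s)⟩
  · have : (1 - 0.02 : ℝ) = 0.98 := by norm_num
    rw [this]
    exact pow_le_pow_of_le_one (by norm_num) (by norm_num) hA

end Base

namespace Base

set_option linter.unusedSectionVars false

variable {κ K M n N q : ℕ} {ε δ l : ℝ} {B B' B'' : Base κ K M n N}
  {μ : Measure (Config (bigGraph (Slot κ K M n) N))} [IsProbabilityMeasure μ]

/-! ### Paths of base points -/

variable (μ B B') in
/-- All main components of fair rows of `B` and `B'` are connected inside `S`. -/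
def Joined (S : Set (Site (Slot κ K M n) N)) (ω : Config (bigGraph (Slot κ K M n) N)) : Prop :=
  ∀ s s', B.Fair μ s → B'.Fair μ s' → ∀ t ∈ B.core ω s, ∀ t' ∈ B'.core ω s',
    (openIn ω S).Reachable (B.tipSite s t) (B'.tipSite s' t')

variable (μ B) in
/-- Some fair row has a main component. -/
def HasCore (ω : Config (bigGraph (Slot κ K M n) N)) : Prop :=
  ∃ s, B.Fair μ s ∧ (B.core ω s).Nonempty

theorem Joined.symm {S : Set (Site (Slot κ K M n) N)} {ω : Config (bigGraph (Slot κ K M n) N)}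
    (h : Joined B B' μ S ω) : Joined B' B μ S ω :=
  fun s s' hs hs' t ht t' ht' => (h s' s hs' hs t' ht' t ht).symm

theorem Joined.trans {S : Set (Site (Slot κ K M n) N)} {ω : Config (bigGraph (Slot κ K M n) N)}
    (h : Joined B B' μ S ω) (h' : Joined B' B'' μ S ω) (hc : B'.HasCore μ ω) :
    Joined B B'' μ S ω := fun s s' hs hs' t ht t' ht' => by
  obtain ⟨r, hr, c, hc⟩ := hc
  exact (h s r hs hr t ht c hc).trans (h' r s' hr hs' c hc t' ht')

theorem Joined.mono {S S' : Set (Site (Slot κ K M n) N)}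
    {ω : Config (bigGraph (Slot κ K M n) N)} (h : Joined B B' μ S ω) (hS : S ⊆ S') :
    Joined B B' μ S' ω :=
  fun s s' hs hs' t ht t' ht' => (h s s' hs hs' t ht t' ht').mono (openIn_mono ω hS)

theorem Uniform.hasCore (P : Params κ K M n q ε δ l) (hκ : 2 ≤ κ) (h1 : OneIndependent μ)
    (hp : ∀ e : (bigGraph (Slot κ K M n) N).edgeSet, 0.5847 ≤ μ.real {ω | ω e = true})
    (hB : B.Sound μ ε) {ω : Config (bigGraph (Slot κ K M n) N)} (h : B.Uniform μ ω) :
    B.HasCore μ ω := by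
  obtain ⟨a, -, ha⟩ := B.exists_avail_row hB.1 0
  obtain ⟨s, -, hs⟩ := exists_fair P hκ h1 hp hB ha
  exact ⟨s, hs, core_nonempty hB.1 (h.1 s)⟩

theorem Uniform.joined_self {ω : Config (bigGraph (Slot κ K M n) N)} (h : B.Uniform μ ω) :
    Joined B B μ {w | w.1 = B.site} ω := fun s s' hs hs' => h.2 s s' hs hs'

theorem joined_of_baseJoin (hB : B.erased.card ≤ 1) (hB' : B'.erased.card ≤ 1)
    {ω : Config (bigGraph (Slot κ K M n) N)} (h : B.Uniform μ ω) (h' : B'.Uniform μ ω)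
    (hj : BaseJoin B B' μ ω) : Joined B B' μ {w | w.1 = B.site ∨ w.1 = B'.site} ω := by
  intro s s' hs hs' t ht t' ht'
  obtain ⟨r, hr, hr', hrr⟩ := hj
  obtain ⟨c, hc⟩ := core_nonempty hB (h.1 r)
  obtain ⟨c', hc'⟩ := core_nonempty hB' (h'.1 r)
  refine ((h.2 s r hs hr t ht c hc).mono (openIn_mono _ fun _ hw => Or.inl hw)).trans
    ((hrr c hc c' hc').trans ?_)
  exact (h'.2 r s' hr' hs' c' hc' t' ht').mono (openIn_mono _ fun _ hw => Or.inr hw)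

/-- The labels of `x'` in the first `j` slots and those of `x` in the others. -/
noncomputable def mixLabels (j : ℕ) (x x' : Slot κ K M n → Fin N) : Slot κ K M n → Fin N :=
  fun t => if (Fintype.equivFin (Slot κ K M n) t : ℕ) < j then x' t else x t

theorem mixLabels_zero (x x' : Slot κ K M n → Fin N) : mixLabels 0 x x' = x := by
  funext t; simp [mixLabels]

theorem mixLabels_card (x x' : Slot κ K M n → Fin N) :
    mixLabels (Fintype.card (Slot κ K M n)) x x' = x' := by
  funext t
  rw [mixLabels, if_pos (Fintype.equivFin (Slot κ K M n) t).2]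

theorem mixLabels_mixLabels (j : ℕ) (x x' : Slot κ K M n → Fin N) :
    mixLabels j (mixLabels j x x') (mixLabels j x' x) = x := by
  funext t
  by_cases h : (Fintype.equivFin (Slot κ K M n) t : ℕ) < j <;> simp [mixLabels, h]

/-- The base points with all labels along the path from `x` to `x'`. -/
noncomputable def full (u : ℤ × ℤ) (x x' : Slot κ K M n → Fin N) (j : ℕ) : Base κ K M n N :=
  ⟨u, ∅, mixLabels j x x'⟩

/-- The base points with one label missing along the path from `x` to `x'`. -/
noncomputable def half (u : ℤ × ℤ) (x x' : Slot κ K M n → Fin N)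
    (j : Fin (Fintype.card (Slot κ K M n))) : Base κ K M n N :=
  ⟨u, {(Fintype.equivFin (Slot κ K M n)).symm j}, mixLabels j x x'⟩

theorem neighbour_full_half (u : ℤ × ℤ) (x x' : Slot κ K M n → Fin N)
    (j : Fin (Fintype.card (Slot κ K M n))) : (full u x x' j).Neighbour (half u x x' j) :=
  ⟨fun _ _ => rfl, Or.inr ⟨rfl, rfl, _, rfl⟩⟩

/-- The labels at stages j and j+1 differ only in the slot that is removed halfway, so both stages
are neighbours of the same half point. -/
theorem neighbour_full_succ_half (u : ℤ × ℤ) (x x' : Slot κ K M n → Fin N)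
    (j : Fin (Fintype.card (Slot κ K M n))) : (full u x x' (j + 1)).Neighbour (half u x x' j) := by
  refine ⟨fun t ht => ?_, Or.inr ⟨rfl, rfl, _, rfl⟩⟩
  have hne : Fintype.equivFin (Slot κ K M n) t ≠ j := fun h =>
    ht (by rw [half, Finset.mem_singleton, ← h, Equiv.symm_apply_apply])
  have : (Fintype.equivFin (Slot κ K M n) t : ℕ) ≠ j := fun h => hne (Fin.ext h)
  simp only [half, full, mixLabels]
  congr 1
  exact propext ⟨fun h => by omega, fun h => by omega⟩

variable (μ) in
/-- All base points on the path are sound. -/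
def PathSound (ε : ℝ) (u : ℤ × ℤ) (x x' : Slot κ K M n → Fin N) : Prop :=
  (∀ j ≤ Fintype.card (Slot κ K M n), (full u x x' j).Sound μ ε) ∧
    ∀ j, (half u x x' j).Sound μ ε

variable (μ) in
/-- All base points on the path are uniform and successive ones are joined. -/
def PathOpen (u : ℤ × ℤ) (x x' : Slot κ K M n → Fin N)
    (ω : Config (bigGraph (Slot κ K M n) N)) : Prop :=
  (∀ j ≤ Fintype.card (Slot κ K M n), (full u x x' j).Uniform μ ω) ∧
    ∀ j : Fin (Fintype.card (Slot κ K M n)), (half u x x' j).Uniform μ ω ∧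
      BaseJoin (full u x x' j) (half u x x' j) μ ω ∧
      BaseJoin (full u x x' (j + 1)) (half u x x' j) μ ω

theorem PathOpen.joined (P : Params κ K M n q ε δ l) (hκ : 2 ≤ κ) (h1 : OneIndependent μ)
    (hp : ∀ e : (bigGraph (Slot κ K M n) N).edgeSet, 0.5847 ≤ μ.real {ω | ω e = true})
    {u : ℤ × ℤ} {x x' : Slot κ K M n → Fin N} (hs : PathSound μ ε u x x')
    {ω : Config (bigGraph (Slot κ K M n) N)} (h : PathOpen μ u x x' ω) :
    Joined (full u x x' 0) (full u x x' (Fintype.card (Slot κ K M n))) μ {w | w.1 = u} ω := by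
  have key : ∀ j ≤ Fintype.card (Slot κ K M n),
      Joined (full u x x' 0) (full u x x' j) μ {w | w.1 = u} ω := by
    intro j
    induction j with
    | zero => exact fun _ => (h.1 0 (Nat.zero_le _)).joined_self
    | succ j ih =>
      intro hj
      obtain ⟨hU, hj1, hj2⟩ := h.2 ⟨j, hj⟩
      have hF := h.1 j (by omega)
      have hF' := h.1 (j + 1) hj
      have s0 := hs.1 j (by omega)
      have s1 := hs.1 (j + 1) hj
      have s2 := hs.2 ⟨j, hj⟩
      have j1 : Joined (full u x x' j) (half u x x' ⟨j, hj⟩) μ {w | w.1 = u} ω :=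
        (joined_of_baseJoin s0.1 s2.1 hF hU hj1).mono (by rintro w (hw | hw) <;> exact hw)
      have j2 : Joined (full u x x' (j + 1)) (half u x x' ⟨j, hj⟩) μ {w | w.1 = u} ω :=
        (joined_of_baseJoin s1.1 s2.1 hF' hU hj2).mono (by rintro w (hw | hw) <;> exact hw)
      exact ((ih (by omega)).trans j1 (hF.hasCore P hκ h1 hp s0)).trans j2.symm
        (hU.hasCore P hκ h1 hp s2)
  exact key _ le_rfl

theorem real_not_join_le (P : Params κ K M n q ε δ l) (hκ : 2 ≤ κ) (h1 : OneIndependent μ)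
    (hp : ∀ e : (bigGraph (Slot κ K M n) N).edgeSet, 0.5847 ≤ μ.real {ω | ω e = true})
    {u : ℤ × ℤ} {x x' : Slot κ K M n → Fin N} (hs : PathSound μ ε u x x') {m : ℕ}
    (hm : 2 * m + 1 ≤ κ) (hm' : 2 * m ≤ 2 ^ K * M * n) {c : ℝ}
    (hc : Fintype.card (Slot κ K M n) * l + (Fintype.card (Slot κ K M n)) ^ 2 * 0.99 ^ m +
      0.98 ^ m ≤ c) :
    μ.real {ω | ¬ PathOpen μ u x x' ω} ≤ (3 * Fintype.card (Slot κ K M n) + 1) * c := by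
  set d := Fintype.card (Slot κ K M n) with hd
  set a : ℝ := d * l + d ^ 2 * 0.99 ^ m with ha
  have hb0 : (0 : ℝ) ≤ 0.98 ^ m := by positivity
  have ha0 : 0 ≤ a := by
    have := real_not_uniform_le P hκ h1 hp (hs.1 0 (Nat.zero_le _)) hm
    exact measureReal_nonneg.trans this
  have hsub : {ω | ¬ PathOpen μ u x x' ω} ⊆
      (⋃ j ∈ Finset.range (d + 1), {ω | ¬ (full u x x' j).Uniform μ ω}) ∪
      ⋃ j ∈ (Finset.univ : Finset (Fin d)), ({ω | ¬ (half u x x' j).Uniform μ ω} ∪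
        ({ω | (∀ k, (full u x x' j).Coh ω k) ∧ (∀ k, (half u x x' j).Coh ω k) ∧
          ¬ BaseJoin (full u x x' j) (half u x x' j) μ ω} ∪
        {ω | (∀ k, (full u x x' (j + 1)).Coh ω k) ∧ (∀ k, (half u x x' j).Coh ω k) ∧
          ¬ BaseJoin (full u x x' (j + 1)) (half u x x' j) μ ω})) := by
    intro ω hω
    by_contra hcon
    rw [Set.mem_union, not_or] at hcon
    simp only [Set.mem_iUnion, not_exists, Set.mem_union, not_or, Set.mem_ofPred_eq,
      not_not, Finset.mem_range, Finset.mem_univ, true_implies] at hcon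
    have hf : ∀ j ≤ d, (full u x x' j).Uniform μ ω := fun j hj => hcon.1 j (by omega)
    refine hω ⟨hf, fun j => ⟨(hcon.2 j).1, ?_, ?_⟩⟩
    · by_contra hj
      exact (hcon.2 j).2.1 ⟨(hf j j.2.le).1, (hcon.2 j).1.1, hj⟩
    · by_contra hj
      exact (hcon.2 j).2.2 ⟨(hf (j + 1) j.2).1, (hcon.2 j).1.1, hj⟩
  have b1 : μ.real (⋃ j ∈ Finset.range (d + 1), {ω | ¬ (full u x x' j).Uniform μ ω}) ≤
      (d + 1) * a := by
    refine (measureReal_biUnion_finset_le _ _).trans ?_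
    refine (Finset.sum_le_card_nsmul _ _ a fun j hj => ?_).trans (le_of_eq ?_)
    · exact real_not_uniform_le P hκ h1 hp
        (hs.1 j (Nat.lt_succ_iff.1 (Finset.mem_range.1 hj))) hm
    · rw [Finset.card_range, nsmul_eq_mul]; push_cast; ring
  have b2 : μ.real (⋃ j ∈ (Finset.univ : Finset (Fin d)), ({ω | ¬ (half u x x' j).Uniform μ ω} ∪
        ({ω | (∀ k, (full u x x' j).Coh ω k) ∧ (∀ k, (half u x x' j).Coh ω k) ∧
          ¬ BaseJoin (full u x x' j) (half u x x' j) μ ω} ∪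
        {ω | (∀ k, (full u x x' (j + 1)).Coh ω k) ∧ (∀ k, (half u x x' j).Coh ω k) ∧
          ¬ BaseJoin (full u x x' (j + 1)) (half u x x' j) μ ω}))) ≤ d * (a + 2 * 0.98 ^ m) := by
    refine (measureReal_biUnion_finset_le _ _).trans ?_
    refine (Finset.sum_le_card_nsmul _ _ (a + 2 * 0.98 ^ m) fun j _ => ?_).trans (le_of_eq ?_)
    · refine (measureReal_union_le _ _).trans (add_le_add
        (real_not_uniform_le P hκ h1 hp (hs.2 j) hm) ((measureReal_union_le _ _).trans ?_))
      have e1 := real_not_baseJoin_le P hκ h1 hp (hs.1 j j.2.le) (hs.2 j)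
        (neighbour_full_half u x x' j) hm'
      have e2 := real_not_baseJoin_le P hκ h1 hp (hs.1 (j + 1) j.2) (hs.2 j)
        (neighbour_full_succ_half u x x' j) hm'
      linarith
    · rw [Finset.card_univ, Fintype.card_fin, nsmul_eq_mul]
  refine (measureReal_mono hsub (measure_ne_top _ _)).trans ((measureReal_union_le _ _).trans ?_)
  have hd0 : (0 : ℝ) ≤ d := Nat.cast_nonneg _
  have : (d + 1) * a + d * (a + 2 * 0.98 ^ m) ≤ (3 * d + 1) * (a + 0.98 ^ m) := by nlinarith
  refine (add_le_add b1 b2).trans (this.trans ?_)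
  exact mul_le_mul_of_nonneg_left hc (by positivity)

/-! ### Choice of labels -/

open Classical in
-- Markov's inequality for the clash probabilities summed over all rows, whose average over the
-- labels is at most d·d²·(2/N), where d is the number of slots.
theorem card_not_sound_le (hε : 0 < ε) (hN : 0 < N) (u : ℤ × ℤ) {D : Finset (Slot κ K M n)}
    (hD : D.card ≤ 1) :
    (((Finset.univ : Finset (Slot κ K M n → Fin N)).filter fun x =>
      ¬ (⟨u, D, x⟩ : Base κ K M n N).Sound μ ε).card : ℝ) ≤
      (Fintype.card (Slot κ K M n)) ^ 3 * (2 / N) / ε * Fintype.card (Slot κ K M n → Fin N) := by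
  set d := Fintype.card (Slot κ K M n) with hd
  set T := Fintype.card (Slot κ K M n → Fin N) with hT
  have hcnt := card_filter_lt_mul_le (c := ε) (Finset.univ : Finset (Slot κ K M n → Fin N))
    (fun x => ∑ s, μ.real {ω | ((⟨u, D, x⟩ : Base κ K M n N).row s).Clash ω})
    fun x _ => Finset.sum_nonneg fun s _ => measureReal_nonneg
  have hsum : ∑ x : Slot κ K M n → Fin N,
      ∑ s, μ.real {ω | ((⟨u, D, x⟩ : Base κ K M n N).row s).Clash ω} ≤ d * (d ^ 2 * (2 / N) * T) := by
    rw [Finset.sum_comm]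
    refine (Finset.sum_le_card_nsmul _ _ (d ^ 2 * (2 / N) * T : ℝ) fun s _ => ?_).trans
      (le_of_eq ?_)
    · exact sum_real_clash_le hN u (insert s D)
    · rw [Finset.card_univ, nsmul_eq_mul]
  have hsub : ((Finset.univ : Finset (Slot κ K M n → Fin N)).filter fun x =>
      ¬ (⟨u, D, x⟩ : Base κ K M n N).Sound μ ε) ⊆ Finset.univ.filter fun x =>
        ε < ∑ s, μ.real {ω | ((⟨u, D, x⟩ : Base κ K M n N).row s).Clash ω} := by
    intro x hx
    rw [Finset.mem_filter] at hx ⊢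
    refine ⟨hx.1, ?_⟩
    by_contra! hcon
    refine hx.2 ⟨hD, fun s => le_trans ?_ hcon⟩
    exact Finset.single_le_sum
      (f := fun s => μ.real {ω | ((⟨u, D, x⟩ : Base κ K M n N).row s).Clash ω})
      (fun s _ => measureReal_nonneg) (Finset.mem_univ s)
  have hle : (((Finset.univ : Finset (Slot κ K M n → Fin N)).filter fun x =>
      ¬ (⟨u, D, x⟩ : Base κ K M n N).Sound μ ε).card : ℝ) ≤ (Finset.univ.filter fun x =>
        ε < ∑ s, μ.real {ω | ((⟨u, D, x⟩ : Base κ K M n N).row s).Clash ω}).card := by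
    exact_mod_cast Finset.card_le_card hsub
  have e : (d : ℝ) ^ 3 * (2 / N) / ε * T = d * (d ^ 2 * (2 / N) * T) / ε := by ring
  rw [e, le_div_iff₀ hε]
  exact (mul_le_mul_of_nonneg_right hle hε.le).trans (hcnt.trans hsum)

/-- Exchanging the first j slots of x and x' is an involution on pairs, so every intermediate stage
between uniform labels is itself uniform. -/
theorem card_mixLabels (j : ℕ) (Q : (Slot κ K M n → Fin N) → Prop) [DecidablePred Q] :
    (((Finset.univ : Finset (Slot κ K M n → Fin N)) ×ˢ (Finset.univ : Finset (Slot κ K M n → Fin N))).filter fun y =>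
      Q (mixLabels j y.1 y.2)).card = (Finset.univ.filter Q).card *
        Fintype.card (Slot κ K M n → Fin N) := by
  rw [← Finset.card_univ, ← Finset.card_product]
  refine Finset.card_nbij' (fun y => (mixLabels j y.1 y.2, mixLabels j y.2 y.1))
    (fun y => (mixLabels j y.1 y.2, mixLabels j y.2 y.1)) ?_ ?_ ?_ ?_
  · intro y hy
    simpa using hy
  · intro y hy
    simpa [mixLabels_mixLabels] using hy
  · intro y _; simp [mixLabels_mixLabels]
  · intro y _; simp [mixLabels_mixLabels]

open Classical in
/-- From some labels, most other labels are reached by sound paths. -/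
theorem exists_center (hε : 0 < ε) (hN : 0 < N) (u : ℤ × ℤ)
    (hsmall : (2 * Fintype.card (Slot κ K M n) + 1) *
      ((Fintype.card (Slot κ K M n)) ^ 3 * (2 / N) / ε) ≤ (1 / 4 : ℝ)) :
    ∃ x : Slot κ K M n → Fin N, 4 * ((Finset.univ : Finset (Slot κ K M n → Fin N)).filter
      fun x' => ¬ PathSound μ ε u x x').card ≤ Fintype.card (Slot κ K M n → Fin N) := by
  set d := Fintype.card (Slot κ K M n) with hd
  set T := Fintype.card (Slot κ K M n → Fin N) with hT
  have : Nonempty (Fin N) := ⟨⟨0, hN⟩⟩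
  let Z := ((Finset.univ : Finset (Slot κ K M n → Fin N)) ×ˢ
    (Finset.univ : Finset (Slot κ K M n → Fin N))).filter
    fun y => ¬ PathSound μ ε u y.1 y.2
  have hZ : (Z.card : ℝ) ≤ 1 / 4 * T * T := by
    -- A path has 2d+1 base points, each of them uniform. The union bound leaves at most a quarter
    -- of the pairs unsound, and some x does no worse than average.
    have hsub : Z ⊆ ((Finset.range (d + 1)).biUnion fun j => ((Finset.univ : Finset (Slot κ K M n → Fin N)) ×ˢ
        (Finset.univ : Finset (Slot κ K M n → Fin N))).filter fun y =>
        ¬ (⟨u, ∅, mixLabels j y.1 y.2⟩ : Base κ K M n N).Sound μ ε) ∪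
        ((Finset.univ : Finset (Fin d)).biUnion fun j => ((Finset.univ : Finset (Slot κ K M n → Fin N)) ×ˢ
        (Finset.univ : Finset (Slot κ K M n → Fin N))).filter fun y =>
        ¬ (⟨u, {(Fintype.equivFin (Slot κ K M n)).symm j}, mixLabels j y.1 y.2⟩ :
          Base κ K M n N).Sound μ ε) := by
      intro y hy
      have hy' := (Finset.mem_filter.1 hy).2
      by_contra hcon
      simp only [Finset.mem_union, Finset.mem_biUnion, Finset.mem_filter, Finset.mem_univ,
        true_and, Finset.mem_product, not_or, not_exists, not_and, not_not, Finset.mem_range] at hcon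
      exact hy' ⟨fun j hj => hcon.1 j (by omega), fun j => hcon.2 j⟩
    have hone : ∀ (D : Finset (Slot κ K M n)) (j : ℕ), D.card ≤ 1 →
        ((((Finset.univ : Finset (Slot κ K M n → Fin N)) ×ˢ (Finset.univ : Finset (Slot κ K M n → Fin N))).filter
          fun y => ¬ (⟨u, D, mixLabels j y.1 y.2⟩ : Base κ K M n N).Sound μ ε).card : ℝ) ≤
        (d : ℝ) ^ 3 * (2 / N) / ε * T * T := by
      intro D j hD
      rw [card_mixLabels j fun x => ¬ (⟨u, D, x⟩ : Base κ K M n N).Sound μ ε]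
      push_cast
      exact mul_le_mul_of_nonneg_right (card_not_sound_le hε hN u hD) (Nat.cast_nonneg _)
    have hc : (Z.card : ℝ) ≤ (d + 1) * ((d : ℝ) ^ 3 * (2 / N) / ε * T * T) +
        d * ((d : ℝ) ^ 3 * (2 / N) / ε * T * T) := by
      have c1 := (Finset.card_le_card hsub).trans (Finset.card_union_le _ _)
      have c2 := c1.trans (add_le_add Finset.card_biUnion_le Finset.card_biUnion_le)
      refine (Nat.cast_le.2 c2).trans ?_
      push_cast
      refine add_le_add ?_ ?_
      · refine (Finset.sum_le_card_nsmul _ _ _ fun j _ => hone ∅ j (by simp)).trans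
          (le_of_eq ?_)
        rw [Finset.card_range, nsmul_eq_mul]; push_cast; ring
      · refine (Finset.sum_le_card_nsmul _ _ _ fun (j : Fin d) _ =>
          hone {(Fintype.equivFin (Slot κ K M n)).symm j} j (by simp)).trans
          (le_of_eq ?_)
        rw [Finset.card_univ, Fintype.card_fin, nsmul_eq_mul]
    calc (Z.card : ℝ) ≤ (2 * d + 1) * ((d : ℝ) ^ 3 * (2 / N) / ε) * T * T := by
          refine hc.trans (le_of_eq ?_); ring
      _ ≤ 1 / 4 * T * T := by gcongr
  have hZsum : Z.card = ∑ x : Slot κ K M n → Fin N,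
      ((Finset.univ : Finset (Slot κ K M n → Fin N)).filter
        fun x' => ¬ PathSound μ ε u x x').card := by
    simp only [Z, Finset.card_filter, Finset.sum_product]
  have hle : ∑ x : Slot κ K M n → Fin N, 4 * ((Finset.univ : Finset (Slot κ K M n → Fin N)).filter
        fun x' => ¬ PathSound μ ε u x x').card ≤ ∑ _x : Slot κ K M n → Fin N, T := by
    rw [← Finset.mul_sum, ← hZsum, Finset.sum_const, Finset.card_univ, smul_eq_mul]
    have : (4 * Z.card : ℝ) ≤ T * T := by linarith
    exact_mod_cast this
  obtain ⟨x, -, hx⟩ := Finset.exists_le_of_sum_le Finset.univ_nonempty hle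
  exact ⟨x, hx⟩

theorem exists_common_labels (hN : 0 < N) {u v : ℤ × ℤ} {x y : Slot κ K M n → Fin N}
    (hx : open Classical in 4 * ((Finset.univ : Finset (Slot κ K M n → Fin N)).filter
      fun x' => ¬ PathSound μ ε u x x').card ≤ Fintype.card (Slot κ K M n → Fin N))
    (hy : open Classical in 4 * ((Finset.univ : Finset (Slot κ K M n → Fin N)).filter
      fun x' => ¬ PathSound μ ε v y x').card ≤ Fintype.card (Slot κ K M n → Fin N)) :
    ∃ z, PathSound μ ε u x z ∧ PathSound μ ε v y z := by
  classical
  have : Nonempty (Fin N) := ⟨⟨0, hN⟩⟩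
  have hT : 0 < Fintype.card (Slot κ K M n → Fin N) := Fintype.card_pos
  by_contra! hcon
  have hsub : (Finset.univ : Finset (Slot κ K M n → Fin N)) ⊆
      (Finset.univ.filter fun x' => ¬ PathSound μ ε u x x') ∪
      (Finset.univ.filter fun x' => ¬ PathSound μ ε v y x') := by
    intro z _
    simp only [Finset.mem_union, Finset.mem_filter, Finset.mem_univ, true_and]
    by_cases h : PathSound μ ε u x z
    · exact Or.inr (hcon z h)
    · exact Or.inl h
  have c1 := (Finset.card_le_card hsub).trans (Finset.card_union_le _ _)
  rw [Finset.card_univ] at c1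
  omega

end Base

/-! ### Transfer of percolation -/

theorem exists_infinite_supp_iff {V : Type*} (H : SimpleGraph V) :
    (∃ C : H.ConnectedComponent, C.supp.Infinite) ↔ ∃ v, {w | H.Reachable v w}.Infinite := by
  have key : ∀ v, (H.connectedComponentMk v).supp = {w | H.Reachable v w} := by
    intro v
    ext w
    rw [SimpleGraph.ConnectedComponent.mem_supp_iff, SimpleGraph.ConnectedComponent.eq]
    exact ⟨fun h => h.symm, fun h => h.symm⟩
  constructor
  · rintro ⟨C, hC⟩
    induction C using SimpleGraph.ConnectedComponent.ind with
    | _ v => exact ⟨v, key v ▸ hC⟩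
  · rintro ⟨v, hv⟩
    exact ⟨H.connectedComponentMk v, (key v).symm ▸ hv⟩

theorem measurableSet_reachable {V : Type*} [Countable V] {G : SimpleGraph V} (a b : V) :
    MeasurableSet {ω : Config G | (openGraph ω).Reachable a b} := by
  have hadj : ∀ a b, MeasurableSet {ω : Config G | (openGraph ω).Adj a b} := fun a b =>
    (detBy_adj a b).measurableSet (Set.toFinite _)
  have hwalk : ∀ (k : ℕ) (a : V),
      MeasurableSet {ω : Config G | ∃ w : (openGraph ω).Walk a b, w.length = k} := by
    intro k
    induction k with
    | zero =>
      intro a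
      have : {ω : Config G | ∃ w : (openGraph ω).Walk a b, w.length = 0} = {_ω | a = b} := by
        ext ω
        exact ⟨fun ⟨w, hw⟩ => SimpleGraph.Walk.eq_of_length_eq_zero hw,
          fun h => by subst h; exact ⟨.nil, rfl⟩⟩
      rw [this]
      exact MeasurableSet.const _
    | succ k ih =>
      intro a
      have : {ω : Config G | ∃ w : (openGraph ω).Walk a b, w.length = k + 1} =
          ⋃ c, {ω : Config G | (openGraph ω).Adj a c} ∩
            {ω | ∃ w : (openGraph ω).Walk c b, w.length = k} := by
        ext ω
        simp only [Set.mem_iUnion, Set.mem_inter_iff, Set.mem_ofPred_eq]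
        constructor
        · rintro ⟨w, hw⟩
          cases w with
          | nil => simp at hw
          | cons h w => exact ⟨_, h, w, by simpa using hw⟩
        · rintro ⟨c, h, w, hw⟩
          exact ⟨w.cons h, by rw [SimpleGraph.Walk.length_cons, hw]⟩
      rw [this]
      exact MeasurableSet.iUnion fun c => (hadj a c).inter (ih c)
  have : {ω : Config G | (openGraph ω).Reachable a b} =
      ⋃ k : ℕ, {ω : Config G | ∃ w : (openGraph ω).Walk a b, w.length = k} := by
    ext ω
    simp only [Set.mem_iUnion, Set.mem_ofPred_eq]
    exact ⟨fun ⟨w⟩ => ⟨_, w, rfl⟩, fun ⟨_, w, _⟩ => ⟨w⟩⟩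
  rw [this]
  exact MeasurableSet.iUnion fun k => hwalk k a

/-- Measurability is needed to evaluate an image measure on the percolation event in
`Percolates.of_map`. -/
theorem measurableSet_exists_infinite {V : Type*} [Countable V] (G : SimpleGraph V) :
    MeasurableSet {ω : Config G | ∃ C : (openGraph ω).ConnectedComponent, C.supp.Infinite} := by
  have : {ω : Config G | ∃ C : (openGraph ω).ConnectedComponent, C.supp.Infinite} =
      ⋃ v, ⋂ F : Finset V, ⋃ w, {ω | w ∉ F} ∩ {ω : Config G | (openGraph ω).Reachable v w} := by
    ext ω
    simp only [Set.mem_iUnion, Set.mem_iInter, Set.mem_inter_iff, Set.mem_ofPred_eq,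
      exists_infinite_supp_iff]
    refine exists_congr fun v => ⟨fun h F => ?_, fun h hfin => ?_⟩
    · obtain ⟨w, hw, hF⟩ := h.exists_notMem_finset F
      exact ⟨w, hF, hw⟩
    · obtain ⟨w, hw, hw'⟩ := h hfin.toFinset
      exact hw (hfin.mem_toFinset.2 hw')
  rw [this]
  exact MeasurableSet.iUnion fun v => MeasurableSet.iInter fun F => MeasurableSet.iUnion fun w =>
    (MeasurableSet.const _).inter (measurableSet_reachable v w)

theorem Percolates.of_map {V V' : Type*} [Countable V'] {G : SimpleGraph V}
    {G' : SimpleGraph V'} {μ : Measure (Config G)} {f : Config G → Config G'} (hf : Measurable f)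
    (h : Percolates (μ.map f))
    (hc : ∀ ω v, {w | (openGraph (f ω)).Reachable v w}.Infinite →
      ∃ v', {w | (openGraph ω).Reachable v' w}.Infinite) : Percolates μ := by
  rw [Percolates, Measure.map_apply hf (measurableSet_exists_infinite G')] at h
  refine h.trans_le (measure_mono fun ω hω => ?_)
  simp only [Set.mem_preimage, Set.mem_ofPred_eq, exists_infinite_supp_iff] at hω ⊢
  obtain ⟨v, hv⟩ := hω
  exact hc ω v hv

namespace Base

set_option linter.unusedSectionVars false

variable {κ K M n N q : ℕ} {ε δ l : ℝ} {B B' : Base κ K M n N}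
  {μ : Measure (Config (bigGraph (Slot κ K M n) N))} [IsProbabilityMeasure μ]

/-! ### The renormalized grid -/

theorem core_congr {ω ω' : Config (bigGraph (Slot κ K M n) N)}
    (h : ∀ e : (bigGraph (Slot κ K M n) N).edgeSet,
      (∀ w ∈ (e : Sym2 (Site (Slot κ K M n) N)), w.1 = B.site) → ω e = ω' e)
    (s : Slot κ K M n) : B.core ω s = B.core ω' s := by
  rw [core, core, ← dense_restr 0.53 ((B.row s).adj ω) subset_rfl,
    ← dense_restr 0.53 ((B.row s).adj ω') subset_rfl,
    (B.row s).restr_congr fun e he => h e fun w hw => (he w hw).2.1]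

variable (μ B B') in
/-- The main components at two base points are connected inside their fibres. -/
def Conn (ω : Config (bigGraph (Slot κ K M n) N)) : Prop :=
  -- `Joined` holds vacuously when main components are missing. Requiring them makes the relation
  -- chain along coarse paths.
  B.HasCore μ ω ∧ B'.HasCore μ ω ∧ Joined B B' μ {w | w.1 = B.site ∨ w.1 = B'.site} ω

theorem Conn.symm {ω : Config (bigGraph (Slot κ K M n) N)} (h : Conn B B' μ ω) :
    Conn B' B μ ω :=
  ⟨h.2.1, h.1, h.2.2.symm.mono fun _ hw => Or.symm hw⟩

theorem detBy_conn (B B' : Base κ K M n N) :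
    DetBy {w | w.1 = B.site ∨ w.1 = B'.site} {ω | Conn B B' μ ω} := by
  intro ω ω' h hω
  have c1 : ∀ s, B.core ω s = B.core ω' s :=
    core_congr fun e he => h e fun w hw => Or.inl (he w hw)
  have c2 : ∀ s, B'.core ω s = B'.core ω' s :=
    core_congr fun e he => h e fun w hw => Or.inr (he w hw)
  simpa only [Set.mem_ofPred_eq, Conn, HasCore, Joined, c1, c2, openIn_congr h] using hω

/-- The route changes x into z over u, steps across the grid edge at the common labels z, and
changes z back into y over v. Adjacent base points need equal labels, which is why the detour
through z is made. -/
theorem real_conn_ge (P : Params κ K M n q ε δ l) (hκ : 2 ≤ κ) (h1 : OneIndependent μ)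
    (hp : ∀ e : (bigGraph (Slot κ K M n) N).edgeSet, 0.5847 ≤ μ.real {ω | ω e = true})
    {u v : ℤ × ℤ} (huv : gridGraph.Adj u v) {x y z : Slot κ K M n → Fin N}
    (hx : PathSound μ ε u x z) (hy : PathSound μ ε v y z) {m : ℕ}
    (hm : 2 * m + 1 ≤ κ) (hm' : 2 * m ≤ 2 ^ K * M * n) {c : ℝ}
    (hc : Fintype.card (Slot κ K M n) * l + (Fintype.card (Slot κ K M n)) ^ 2 * 0.99 ^ m +
      0.98 ^ m ≤ c) :
    1 - (6 * Fintype.card (Slot κ K M n) + 3) * c ≤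
      μ.real {ω | Conn ⟨u, ∅, x⟩ ⟨v, ∅, y⟩ μ ω} := by
  set d := Fintype.card (Slot κ K M n) with hd
  have sx := hx.1 d le_rfl
  have sy := hy.1 d le_rfl
  have hnb : (full u x z d).Neighbour (full v y z d) := by
    refine ⟨fun t _ => ?_, Or.inl ⟨huv, rfl⟩⟩
    simp only [full, hd, mixLabels_card]
  have e1 := real_not_join_le P hκ h1 hp hx hm hm' hc
  have e2 := real_not_join_le P hκ h1 hp hy hm hm' hc
  have e3 := real_not_baseJoin_le P hκ h1 hp sx sy hnb hm'
  have hcov : (Set.univ : Set (Config (bigGraph (Slot κ K M n) N))) ⊆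
      {ω | Conn ⟨u, ∅, x⟩ ⟨v, ∅, y⟩ μ ω} ∪ ({ω | ¬ PathOpen μ u x z ω} ∪
        ({ω | ¬ PathOpen μ v y z ω} ∪ {ω | (∀ k, (full u x z d).Coh ω k) ∧
          (∀ k, (full v y z d).Coh ω k) ∧ ¬ BaseJoin (full u x z d) (full v y z d) μ ω})) := by
    intro ω _
    by_contra hcon
    simp only [Set.mem_union, Set.mem_ofPred_eq, not_or, not_not] at hcon
    obtain ⟨hn, ho, ho', hj⟩ := hcon
    have ux := ho.1 d le_rfl
    have uy := ho'.1 d le_rfl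
    have hbj : BaseJoin (full u x z d) (full v y z d) μ ω := by
      by_contra hb
      exact hj ⟨ux.1, uy.1, hb⟩
    have ex : (⟨u, ∅, x⟩ : Base κ K M n N) = full u x z 0 := by rw [full, mixLabels_zero]
    have ey : (⟨v, ∅, y⟩ : Base κ K M n N) = full v y z 0 := by rw [full, mixLabels_zero]
    refine hn ?_
    rw [ex, ey]
    refine ⟨(ho.1 0 (Nat.zero_le _)).hasCore P hκ h1 hp (hx.1 0 (Nat.zero_le _)),
      (ho'.1 0 (Nat.zero_le _)).hasCore P hκ h1 hp (hy.1 0 (Nat.zero_le _)), ?_⟩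
    have j1 := (ho.joined P hκ h1 hp hx).mono
      (S' := {w | w.1 = (full u x z 0).site ∨ w.1 = (full v y z 0).site}) fun _ hw => Or.inl hw
    have j2 := (ho'.joined P hκ h1 hp hy).mono
      (S' := {w | w.1 = (full u x z 0).site ∨ w.1 = (full v y z 0).site}) fun _ hw => Or.inr hw
    have j3 := joined_of_baseJoin sx.1 sy.1 ux uy hbj
    exact (j1.trans j3 (ux.hasCore P hκ h1 hp sx)).trans j2.symm (uy.hasCore P hκ h1 hp sy)
  have hle := measureReal_mono (μ := μ) hcov (measure_ne_top _ _)
  rw [probReal_univ] at hle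
  have hu := hle.trans ((measureReal_union_le _ _).trans (add_le_add le_rfl
    ((measureReal_union_le _ _).trans (add_le_add e1 ((measureReal_union_le _ _).trans
      (add_le_add e2 e3))))))
  have hc0 : (0.98 : ℝ) ^ m ≤ c := by
    have := measureReal_nonneg.trans (real_not_uniform_le P hκ h1 hp sx hm)
    linarith
  linarith

/-- The state of the edges of the renormalized grid. -/
noncomputable def coarse (μ : Measure (Config (bigGraph (Slot κ K M n) N)))
    (X : ℤ × ℤ → Slot κ K M n → Fin N) (ω : Config (bigGraph (Slot κ K M n) N)) :
    Config gridGraph := fun e =>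
  open Classical in decide (∀ u v, (e : Sym2 (ℤ × ℤ)) = s(u, v) →
    Conn ⟨u, ∅, X u⟩ ⟨v, ∅, X v⟩ μ ω)

theorem coarse_eq_true {X : ℤ × ℤ → Slot κ K M n → Fin N}
    {ω : Config (bigGraph (Slot κ K M n) N)} {u v : ℤ × ℤ} (h : s(u, v) ∈ gridGraph.edgeSet) :
    coarse μ X ω ⟨s(u, v), h⟩ = true ↔ Conn ⟨u, ∅, X u⟩ ⟨v, ∅, X v⟩ μ ω := by
  rw [coarse, @decide_eq_true_iff _ (Classical.propDecidable _)]
  refine ⟨fun H => H u v rfl, fun H a b hab => ?_⟩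
  rcases Sym2.eq_iff.1 hab with ⟨rfl, rfl⟩ | ⟨rfl, rfl⟩
  · exact H
  · exact H.symm

theorem detBy_coarse (X : ℤ × ℤ → Slot κ K M n → Fin N) (e : gridGraph.edgeSet) :
    DetBy {w | w.1 ∈ (e : Sym2 (ℤ × ℤ))} {ω | coarse μ X ω e = true} := by
  obtain ⟨e, he⟩ := e
  induction e using Sym2.ind with
  | _ u v =>
    simp only [coarse_eq_true]
    exact (detBy_conn ⟨u, ∅, X u⟩ ⟨v, ∅, X v⟩).mono fun w hw => Sym2.mem_iff.2 hw

theorem finite_fibres (e : Sym2 (ℤ × ℤ)) : {w : Site (Slot κ K M n) N | w.1 ∈ e}.Finite := by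
  induction e using Sym2.ind with
  | _ u v =>
    refine ((finite_fiber u).union (finite_fiber v)).subset fun w hw => ?_
    exact Sym2.mem_iff.1 hw

theorem measurable_coarse (X : ℤ × ℤ → Slot κ K M n → Fin N) : Measurable (coarse μ X) :=
  measurable_of_detBy _ (fun e => {w | w.1 ∈ (e : Sym2 (ℤ × ℤ))})
    (fun e => finite_fibres (e : Sym2 (ℤ × ℤ))) (detBy_coarse X)

/-- The coarse cluster lifts to one open cluster meeting the fibre over each of its sites, and its
projection to the grid is therefore infinite. -/
theorem infinite_of_coarse (X : ℤ × ℤ → Slot κ K M n → Fin N)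
    (ω : Config (bigGraph (Slot κ K M n) N)) (u : ℤ × ℤ)
    (h : {v | (openGraph (coarse μ X ω)).Reachable u v}.Infinite) :
    ∃ a, {b | (openGraph ω).Reachable a b}.Infinite := by
  have hadj : ∀ {v w}, (openGraph (coarse μ X ω)).Adj v w →
      Conn ⟨v, ∅, X v⟩ ⟨w, ∅, X w⟩ μ ω := fun hvw => by
    obtain ⟨hg, ht⟩ := openGraph_adj.1 hvw
    exact (coarse_eq_true hg).1 ht
  have hcore : (⟨u, ∅, X u⟩ : Base κ K M n N).HasCore μ ω := by
    obtain ⟨v, hv, hne⟩ := h.exists_notMem_finset {u}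
    rw [Finset.mem_singleton] at hne
    have hv' := hv
    rw [Set.mem_ofPred_eq, SimpleGraph.reachable_iff_reflTransGen] at hv'
    rcases hv'.cases_head with rfl | ⟨c, hc, -⟩
    · exact absurd rfl hne
    · exact (hadj hc).1
  obtain ⟨s, hs, t, ht⟩ := hcore
  refine ⟨(⟨u, ∅, X u⟩ : Base κ K M n N).tipSite s t, Set.Infinite.of_image Prod.fst
    (h.mono fun v hv => ?_)⟩
  have key : ∃ s' t', (⟨v, ∅, X v⟩ : Base κ K M n N).Fair μ s' ∧
      t' ∈ (⟨v, ∅, X v⟩ : Base κ K M n N).core ω s' ∧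
      (openGraph ω).Reachable ((⟨u, ∅, X u⟩ : Base κ K M n N).tipSite s t)
        ((⟨v, ∅, X v⟩ : Base κ K M n N).tipSite s' t') := by
    rw [Set.mem_ofPred_eq, SimpleGraph.reachable_iff_reflTransGen] at hv
    induction hv with
    | refl => exact ⟨s, t, hs, ht, SimpleGraph.Reachable.rfl⟩
    | tail _ hbc ih =>
      obtain ⟨r, c, hr, hc, hreach⟩ := ih
      obtain ⟨-, ⟨s', hs', t', ht'⟩, hj⟩ := hadj hbc
      exact ⟨s', t', hs', ht', hreach.trans
        ((hj r s' hr hs' c hc t' ht').mono (openIn_le _ _))⟩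
  obtain ⟨s', t', -, -, hr⟩ := key
  exact ⟨_, hr, rfl⟩

theorem percolates (P : Params κ K M n q ε δ l) (hκ : 2 ≤ κ) (h1 : OneIndependent μ)
    (hp : ∀ e : (bigGraph (Slot κ K M n) N).edgeSet, 0.5847 ≤ μ.real {ω | ω e = true})
    (hε : 0 < ε) (hN : 0 < N)
    (hsmall : (2 * Fintype.card (Slot κ K M n) + 1) *
      ((Fintype.card (Slot κ K M n)) ^ 3 * (2 / N) / ε) ≤ (1 / 4 : ℝ)) {m : ℕ}
    (hm : 2 * m + 1 ≤ κ) (hm' : 2 * m ≤ 2 ^ K * M * n)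
    (hc : (6 * Fintype.card (Slot κ K M n) + 3) * (Fintype.card (Slot κ K M n) * l +
      (Fintype.card (Slot κ K M n)) ^ 2 * 0.99 ^ m + 0.98 ^ m) ≤ (1 / 1296 : ℝ)) :
    Percolates μ := by
  choose X hX using fun u => exists_center (μ := μ) hε hN u hsmall
  have hmeas := measurable_coarse (μ := μ) X
  have hperc : Percolates (μ.map (coarse μ X)) := by
    have : IsProbabilityMeasure (μ.map (coarse μ X)) :=
      Measure.isProbabilityMeasure_map hmeas.aemeasurable
    refine grid_percolates (oneIndependent_map h1 _ hmeas _ (detBy_coarse X) ?_) ?_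
    · intro e e' he
      exact Set.disjoint_left.2 fun w hw hw' => he w.1 hw hw'
    · rintro ⟨e, he⟩
      induction e using Sym2.ind with
      | _ u v =>
        have hs : MeasurableSet {ω : Config gridGraph | ω ⟨s(u, v), he⟩ = true} :=
          measurableSet_eq_fun (measurable_pi_apply _) measurable_const
        rw [map_measureReal_apply hmeas hs]
        have e : coarse μ X ⁻¹' {ω | ω ⟨s(u, v), he⟩ = true} =
            {ω | Conn ⟨u, ∅, X u⟩ ⟨v, ∅, X v⟩ μ ω} := by
          ext ω
          exact coarse_eq_true he
        obtain ⟨z, hz, hz'⟩ := exists_common_labels hN (hX u) (hX v)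
        have := real_conn_ge P hκ h1 hp he hz hz' hm hm' le_rfl
        rw [e]
        linarith
  exact hperc.of_map hmeas fun ω u hu => infinite_of_coarse X ω u hu

end Base

/-! ### Choice of the parameters -/

theorem card_slot (κ K M n : ℕ) :
    Fintype.card (Slot κ K M n) = (3 + κ) * (2 ^ K * M) * n := by
  simp

/-- The number d of slots grows at most like X⁷ with X = 2m+1, so d²·(C/X)¹⁵ is of order 1/X, which
explains the exponent 15. The remaining terms are polynomials of degree at most 21 times 0.99^m. -/
theorem eventually_error_le {A C : ℝ} (hA : 1 ≤ A) (hC : 0 ≤ C) :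
    ∀ᶠ m : ℕ in atTop, ∀ d : ℝ, 0 ≤ d → d ≤ 80 * A * (2 * m + 1) ^ 7 →
      (6 * d + 3) * (d * (C / (2 * m + 1)) ^ 15 + d ^ 2 * 0.99 ^ m + 0.98 ^ m) ≤ 1 / 1296 := by
  have t1 : Tendsto (fun m : ℕ => 57600 * A ^ 2 * C ^ 15 * ((m : ℝ))⁻¹) atTop (𝓝 0) := by
    have := (tendsto_inv_atTop_nhds_zero_nat (𝕜 := ℝ)).const_mul (57600 * A ^ 2 * C ^ 15)
    rwa [mul_zero] at this
  have t2 : Tendsto (fun m : ℕ => 18 * (80 * A) ^ 3 * 3 ^ 21 * ((m : ℝ) ^ 21 * 0.99 ^ m))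
      atTop (𝓝 0) := by
    simpa using (tendsto_pow_const_mul_const_pow_of_abs_lt_one 21
      (r := (0.99 : ℝ)) (by rw [abs_of_nonneg] <;> norm_num)).const_mul
        (18 * (80 * A) ^ 3 * 3 ^ 21)
  have t := t1.add t2
  rw [add_zero] at t
  filter_upwards [t.eventually_le_const (show (0 : ℝ) < 1 / 1296 by norm_num),
    eventually_ge_atTop 1] with m hm hm1 d hd0 hd
  have hmr : (1 : ℝ) ≤ m := by exact_mod_cast hm1
  obtain ⟨X, hX⟩ : ∃ X : ℝ, X = 2 * m + 1 := ⟨_, rfl⟩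
  rw [← hX] at hd ⊢
  have hX1 : 1 ≤ X := by linarith
  obtain ⟨D, hD⟩ : ∃ D, D = 80 * A * X ^ 7 := ⟨_, rfl⟩
  have hD1 : 1 ≤ D := by
    have : (1 : ℝ) ≤ X ^ 7 := one_le_pow₀ hX1
    rw [hD]; nlinarith
  rw [← hD] at hd
  have hl : 0 ≤ (C / X) ^ 15 := by positivity
  have h98 : (0.98 : ℝ) ^ m ≤ 0.99 ^ m := pow_le_pow_left₀ (by norm_num) (by norm_num) m
  have h99 : (0 : ℝ) ≤ 0.99 ^ m := by positivity
  have s1 : 6 * d + 3 ≤ 9 * D := by linarith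
  have s2 : d * (C / X) ^ 15 + d ^ 2 * 0.99 ^ m + 0.98 ^ m ≤
      D * (C / X) ^ 15 + 2 * D ^ 2 * 0.99 ^ m := by
    have a1 : d * (C / X) ^ 15 ≤ D * (C / X) ^ 15 := mul_le_mul_of_nonneg_right hd hl
    have a2 : d ^ 2 * 0.99 ^ m ≤ D ^ 2 * 0.99 ^ m :=
      mul_le_mul_of_nonneg_right (pow_le_pow_left₀ hd0 hd 2) h99
    have a3 : (1 : ℝ) * 0.99 ^ m ≤ D ^ 2 * 0.99 ^ m :=
      mul_le_mul_of_nonneg_right (one_le_pow₀ hD1) h99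
    linarith
  have e1 : 9 * D * (D * (C / X) ^ 15) = 57600 * A ^ 2 * C ^ 15 * X⁻¹ := by
    have hX0 : X ≠ 0 := by linarith
    rw [hD]
    field_simp
    ring
  have e2 : 9 * D * (2 * D ^ 2 * 0.99 ^ m) ≤ 18 * (80 * A) ^ 3 * 3 ^ 21 * ((m : ℝ) ^ 21 * 0.99 ^ m) := by
    have : X ^ 21 ≤ (3 * m) ^ 21 := pow_le_pow_left₀ (by linarith) (by linarith) 21
    calc 9 * D * (2 * D ^ 2 * 0.99 ^ m) = 18 * (80 * A) ^ 3 * 0.99 ^ m * X ^ 21 := by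
          rw [hD]; ring
      _ ≤ 18 * (80 * A) ^ 3 * 0.99 ^ m * (3 * m) ^ 21 :=
          mul_le_mul_of_nonneg_left this (by positivity)
      _ = _ := by ring
  have e3 : 57600 * A ^ 2 * C ^ 15 * X⁻¹ ≤ 57600 * A ^ 2 * C ^ 15 * (m : ℝ)⁻¹ := by
    refine mul_le_mul_of_nonneg_left ?_ (by positivity)
    exact inv_anti₀ (by linarith) (by linarith)
  calc (6 * d + 3) * (d * (C / X) ^ 15 + d ^ 2 * 0.99 ^ m + 0.98 ^ m)
      ≤ 9 * D * (D * (C / X) ^ 15 + 2 * D ^ 2 * 0.99 ^ m) := by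
        refine mul_le_mul s1 s2 (by positivity) (by positivity)
    _ = 9 * D * (D * (C / X) ^ 15) + 9 * D * (2 * D ^ 2 * 0.99 ^ m) := by ring
    _ ≤ 57600 * A ^ 2 * C ^ 15 * (m : ℝ)⁻¹ +
        18 * (80 * A) ^ 3 * 3 ^ 21 * ((m : ℝ) ^ 21 * 0.99 ^ m) := by
        rw [e1]; exact add_le_add e3 e2
    _ ≤ 1 / 1296 := hm

/-- The order of choice matters: K comes first, then a large m with κ = M = 2m+1, then n, and N
last. The increment budget is 0.00002 for 2/K, 0.00001 for ε and at most 0.00001 for 2l. -/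
theorem exists_params : ∃ (κ K M n N m q : ℕ) (ε δ l : ℝ), Params κ K M n q ε δ l ∧ 2 ≤ κ ∧
    0 < ε ∧ 0 < N ∧ (2 * Fintype.card (Slot κ K M n) + 1) *
      ((Fintype.card (Slot κ K M n)) ^ 3 * (2 / N) / ε) ≤ (1 / 4 : ℝ) ∧
    2 * m + 1 ≤ κ ∧ 2 * m ≤ 2 ^ K * M * n ∧
    (6 * Fintype.card (Slot κ K M n) + 3) * (Fintype.card (Slot κ K M n) * l +
      (Fintype.card (Slot κ K M n)) ^ 2 * 0.99 ^ m + 0.98 ^ m) ≤ (1 / 1296 : ℝ) := by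
  obtain ⟨K, hK, hK'⟩ : ∃ K : ℕ, 0 < K ∧ (2 / K : ℝ) ≤ 0.00002 :=
    ⟨100000, by norm_num, by norm_num⟩
  obtain ⟨a, ha, ha1⟩ : ∃ a : ℕ, a = 2 ^ K ∧ 1 ≤ a := ⟨_, rfl, Nat.one_le_two_pow⟩
  have hA : (1 : ℝ) ≤ a := by exact_mod_cast ha1
  obtain ⟨C, hC, hC0⟩ : ∃ C : ℝ, (16 * (a : ℝ) ^ 2 * 21 * 81) / (0.0007 ^ 2 * 20) = C ∧ 0 ≤ C :=
    ⟨_, rfl, by positivity⟩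
  have tl : Tendsto (fun m : ℕ => (C / (2 * m + 1 : ℝ)) ^ 15) atTop (𝓝 0) := by
    have h1 : Tendsto (fun m : ℕ => (2 * m + 1 : ℝ)) atTop atTop :=
      tendsto_atTop_add_const_right _ _ (tendsto_natCast_atTop_atTop.const_mul_atTop two_pos)
    simpa using (h1.const_div_atTop C).pow 15
  obtain ⟨m, herr, hl, hm⟩ := ((eventually_error_le hA hC0).and
    ((tl.eventually_le_const (show (0 : ℝ) < 0.000005 by norm_num)).and
      (eventually_ge_atTop 2000))).exists
  obtain ⟨M, hM⟩ : ∃ M : ℕ, M = 2 * m + 1 := ⟨_, rfl⟩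
  have hMr : (2 * m + 1 : ℝ) = M := by rw [hM]; push_cast; ring
  rw [hMr] at herr hl
  have hM1 : 1 ≤ M := by omega
  have hM1r : (1 : ℝ) ≤ M := by exact_mod_cast hM1
  obtain ⟨n, hn⟩ : ∃ n : ℕ, n = 20 * M ^ 5 := ⟨_, rfl⟩
  have hn0 : 0 < n := by rw [hn]; positivity
  obtain ⟨d, hd⟩ : ∃ d : ℕ, d = Fintype.card (Slot M K M n) := ⟨_, rfl⟩
  have hd' := hd
  rw [card_slot, ← ha] at hd'
  have h4 : (3 + M) * (a * M) ≤ 4 * a * M ^ 2 := by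
    calc (3 + M) * (a * M) ≤ (4 * M) * (a * M) := Nat.mul_le_mul_right _ (by omega)
      _ = _ := by ring
  have hdle : (d : ℝ) ≤ 80 * a * M ^ 7 := by
    have : d ≤ 80 * a * M ^ 7 := by
      rw [hd', hn]
      calc _ ≤ 4 * a * M ^ 2 * (20 * M ^ 5) := Nat.mul_le_mul_right _ h4
        _ = _ := by ring
    exact_mod_cast this
  -- The number of labels does not affect the number of slots, so it can be taken large enough to
  -- make clashes negligible.
  obtain ⟨N, hN⟩ := exists_nat_gt ((2 * (d : ℝ) + 1) * (d ^ 3 * 2 / 0.00001) * 4)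
  have hN0 : (0 : ℝ) < N := lt_of_le_of_lt (by positivity) hN
  refine ⟨M, K, M, n, N, m, 15, 0.00001, 0.0007, (C / M) ^ 15, ?_, by omega, by norm_num,
    by exact_mod_cast hN0, ?_, by omega, ?_, ?_⟩
  · refine ⟨⟨M ^ 5, hn⟩, hn0, hK, by omega, by norm_num, by norm_num, by norm_num, ?_, ?_⟩
    · refine pow_le_pow_left₀ (by positivity) ?_ 15
      rw [← ha]
      have h4r : ((((3 + M) * (a * M) : ℕ) : ℝ)) ≤ 4 * a * M ^ 2 := by exact_mod_cast h4
      have hnr : (n : ℝ) = 20 * M ^ 5 := by rw [hn]; push_cast; ring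
      calc ((((3 + M) * (a * M) : ℕ) : ℝ)) ^ 2 * (21 * ((8 + 1) ^ 2 / 0.0007 ^ 2 / n))
          ≤ (4 * a * M ^ 2) ^ 2 * (21 * ((8 + 1) ^ 2 / 0.0007 ^ 2 / n)) :=
            mul_le_mul_of_nonneg_right (pow_le_pow_left₀ (by positivity) h4r 2) (by positivity)
        _ = C / M := by
            have : (M : ℝ) ≠ 0 := by linarith
            rw [hnr, ← hC]
            field_simp
            ring
    · linarith
  · rw [← hd]
    have : (2 * (d : ℝ) + 1) * (d ^ 3 * (2 / N) / 0.00001) =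
        (2 * (d : ℝ) + 1) * (d ^ 3 * 2 / 0.00001) / N := by ring
    rw [this, div_le_iff₀ hN0]
    linarith
  · rw [← ha]
    calc 2 * m ≤ 1 * M * 1 := by omega
      _ ≤ a * M * n := Nat.mul_le_mul (Nat.mul_le_mul_right _ ha1) hn0
  · rw [← hd]
    exact herr d (Nat.cast_nonneg _) hdle

/-- Some graph of the family has no non-percolating model of density `0.5847`. -/
theorem exists_bigGraph_percolates : ∃ (κ K M n N : ℕ),
    ∀ μ ∈ modelsGE (bigGraph (Slot κ K M n) N) 0.5847, Percolates μ := by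
  obtain ⟨κ, K, M, n, N, m, q, ε, δ, l, P, hκ, hε, hN, hs, hm, hm', hc⟩ := exists_params
  refine ⟨κ, K, M, n, N, fun μ hμ => ?_⟩
  have := hμ.1
  exact Base.percolates P hκ hμ.2.1 hμ.2.2 hε hN hs hm hm' hc

/-! ### Subgraphs -/

section Pullback

variable {V V' : Type*} {G : SimpleGraph V} {G' : SimpleGraph V'}

/-- The restriction of a configuration along a graph homomorphism. -/
def pullConfig (φ : G' →g G) (ω : Config G) : Config G' :=
  fun e => ω ⟨Sym2.map φ e, φ.map_mem_edgeSet e.2⟩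

theorem measurable_pullConfig (φ : G' →g G) : Measurable (pullConfig φ) :=
  measurable_pi_lambda _ fun _ => measurable_pi_apply _

theorem OneIndependent.pullConfig {μ : Measure (Config G)} (h1 : OneIndependent μ) (φ : G' →g G)
    (hφ : Function.Injective φ) : OneIndependent (μ.map (pullConfig φ)) := by
  refine oneIndependent_map h1 _ (measurable_pullConfig φ)
    (fun e => {v | v ∈ Sym2.map φ (e : Sym2 V')}) (fun e ω ω' h hω => ?_) fun e e' he => ?_
  · have := h ⟨Sym2.map φ e, φ.map_mem_edgeSet e.2⟩ fun v hv => hv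
    exact this.symm.trans hω
  · refine Set.disjoint_left.2 fun v hv hv' => ?_
    obtain ⟨a, ha, rfl⟩ := Sym2.mem_map.1 hv
    obtain ⟨b, hb, hab⟩ := Sym2.mem_map.1 hv'
    exact he a ha (hφ hab ▸ hb)

theorem infinite_of_pullConfig (φ : G' →g G) (hφ : Function.Injective φ) (ω : Config G) (v : V')
    (h : {w | (openGraph (pullConfig φ ω)).Reachable v w}.Infinite) :
    ∃ v', {w | (openGraph ω).Reachable v' w}.Infinite := by
  refine ⟨φ v, (h.image hφ.injOn).mono ?_⟩
  rintro _ ⟨w, hw, rfl⟩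
  refine reachable_of_adj_reachable φ (fun a b hab => SimpleGraph.Adj.reachable ?_) hw
  obtain ⟨hG, ht⟩ := openGraph_adj.1 hab
  exact openGraph_adj.2 ⟨φ.map_adj hG, ht⟩

/-- Percolation at density `p` is inherited from subgraphs. -/
theorem percolates_of_hom [Countable V'] (φ : G' →g G) (hφ : Function.Injective φ) {p : ℝ}
    (h : ∀ μ ∈ modelsGE G' p, Percolates μ) : ∀ μ ∈ modelsGE G p, Percolates μ := by
  rintro μ ⟨hμ, h1, hp⟩
  have hm := measurable_pullConfig φ
  refine (h (μ.map (pullConfig φ)) ⟨Measure.isProbabilityMeasure_map hm.aemeasurable,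
    h1.pullConfig φ hφ, fun e => ?_⟩).of_map hm (infinite_of_pullConfig φ hφ)
  have hs : MeasurableSet {ω : Config G' | ω e = true} :=
    measurableSet_eq_fun (measurable_pi_apply _) measurable_const
  rw [map_measureReal_apply hm hs]
  exact hp ⟨Sym2.map φ e, φ.map_mem_edgeSet e.2⟩

end Pullback

/-! ### Monotonicity of the critical density. -/

theorem pmax_nonneg {V : Type*} (G : SimpleGraph V) : 0 ≤ pmax G :=
  Real.sSup_nonneg fun _ hp => hp.1

theorem pmax_le_of_hom {V V' : Type*} [Countable V'] {G : SimpleGraph V} {G' : SimpleGraph V'}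
    (φ : G' →g G) (hφ : Function.Injective φ) : pmax G ≤ pmax G' := by
  refine Real.sSup_le (fun p hp => le_csSup ⟨1, fun _ hq => hq.2.1⟩ ⟨hp.1, hp.2.1, ?_⟩)
    (pmax_nonneg G')
  obtain ⟨μ, hμ, hμ'⟩ := hp.2.2
  by_contra! hcon
  exact hμ' (percolates_of_hom φ hφ hcon μ hμ)

theorem pmax_le_of_percolates {V : Type*} {G : SimpleGraph V} {p : ℝ} (hp : 0 ≤ p)
    (h : ∀ μ ∈ modelsGE G p, Percolates μ) : pmax G ≤ p := by
  refine Real.sSup_le (fun q hq => ?_) hp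
  obtain ⟨μ, hμ, hμ'⟩ := hq.2.2
  by_contra! hcon
  exact hμ' (h μ ⟨hμ.1, hμ.2.1, fun e => hcon.le.trans (hμ.2.2 e)⟩)

/-! ### Embeddings into the lattice -/

/-- The inclusion of `ℤⁿ` into `ℤⁿ⁺¹`. -/
def latticeSucc (n : ℕ) : latticeGraph n →g latticeGraph (n + 1) where
  toFun x := Fin.cons 0 x
  map_rel' {x y} h := by
    simp only [latticeGraph] at h ⊢
    rw [Fin.sum_univ_succ]
    simpa using h

theorem latticeSucc_injective (n : ℕ) : Function.Injective (latticeSucc n) :=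
  Fin.cons_right_injective (α := fun _ => ℤ) 0

theorem antitone_pmax_latticeGraph : Antitone fun n => pmax (latticeGraph n) :=
  antitone_nat_of_succ_le fun n => pmax_le_of_hom (latticeSucc n) (latticeSucc_injective n)

section Embedding

variable {I : Type*} {N : ℕ}

/-- The grid coordinates of a site, followed by the indicators of its labels. -/
def coord (w : Site I N) : Fin 2 ⊕ I × Fin N → ℤ :=
  Sum.elim ![w.1.1, w.1.2] fun j => if w.2 j.1 = some j.2 then 1 else 0

theorem coord_injective : Function.Injective (coord (I := I) (N := N)) := by
  intro v w h
  refine Prod.ext (Prod.ext (congrFun h (Sum.inl 0)) (congrFun h (Sum.inl 1)))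
    (funext fun t => Option.ext fun k => ?_)
  have := congrFun h (Sum.inr (t, k))
  simp only [coord, Sum.elim_inr] at this
  by_cases h1 : v.2 t = some k <;> by_cases h2 : w.2 t = some k <;> simp_all

variable [DecidableEq I]

/-- Removing a label switches exactly one indicator from 1 to 0. This is why the empty slot, as the
centre of the star K_{1,N}, is sent to the zero vector. -/
theorem sum_coord_erase [Fintype I] (u : ℤ × ℤ) {y : I → Option (Fin N)} {t : I}
    (h : y t ≠ none) : ∑ j, |coord (u, y) j - coord (u, erase y t) j| = 1 := by
  obtain ⟨k, hk⟩ := Option.ne_none_iff_exists'.1 h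
  rw [Finset.sum_eq_single (Sum.inr (t, k))]
  · simp [coord, hk, erase_apply_self]
  · rintro (j | ⟨t', k'⟩) - hne
    · simp [coord]
    · by_cases ht : t' = t
      · subst ht
        have : k ≠ k' := fun h => hne (by rw [h])
        simp [coord, hk, erase_apply_self, this]
      · simp [coord, erase_apply_of_ne _ ht]
  · simp

theorem sum_coord_eq_one [Fintype I] {v w : Site I N} (h : (bigGraph I N).Adj v w) :
    ∑ j, |coord v j - coord w j| = 1 := by
  obtain ⟨u, y⟩ := v
  obtain ⟨u', y'⟩ := w
  rcases h with ⟨h, h'⟩ | ⟨h, t, ⟨h1, h2⟩ | ⟨h1, h2⟩⟩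
  · simp only at h h'
    subst h'
    rw [Fintype.sum_sum_type, Fin.sum_univ_two]
    simpa [coord, gridGraph] using h
  · simp only at h h1 h2
    subst h h2
    exact sum_coord_erase u h1
  · simp only at h h1 h2
    subst h h2
    simp only [abs_sub_comm (coord (u, erase y' t) _)]
    exact sum_coord_erase u h1

theorem exists_hom_latticeGraph (I : Type*) [DecidableEq I] [Fintype I] (N : ℕ) :
    ∃ (d : ℕ) (φ : bigGraph I N →g latticeGraph d), Function.Injective φ := by
  let e := Fintype.equivFin (Fin 2 ⊕ I × Fin N)
  refine ⟨_, ⟨fun w i => coord w (e.symm i), fun {v w} h => ?_⟩, fun v w h => ?_⟩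
  · exact (e.symm.sum_comp fun j => |coord v j - coord w j|).trans (sum_coord_eq_one h)
  · refine coord_injective (funext fun j => ?_)
    have : coord v (e.symm (e j)) = coord w (e.symm (e j)) := congrFun h (e j)
    rwa [e.symm_apply_apply] at this

end Embedding

end BondPercolation

theorem theorem1p2 :
    ∃ L : ℝ, Tendsto (fun n : ℕ => BondPercolation.pmax (BondPercolation.latticeGraph n))
      atTop (𝓝 L) ∧ L ≤ 0.5847 := by
  have hbdd : BddBelow (Set.range fun n =>
      BondPercolation.pmax (BondPercolation.latticeGraph n)) :=
    ⟨0, by rintro _ ⟨n, rfl⟩; exact BondPercolation.pmax_nonneg _⟩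
  -- The limit is the infimum over all dimensions, so a single dimension containing the graph
  -- suffices.
  refine ⟨_, tendsto_atTop_ciInf BondPercolation.antitone_pmax_latticeGraph hbdd, ?_⟩
  obtain ⟨κ, K, M, n, N, h⟩ := BondPercolation.exists_bigGraph_percolates
  obtain ⟨d, φ, hφ⟩ :=
    BondPercolation.exists_hom_latticeGraph (BondPercolation.Slot κ K M n) N
  exact (ciInf_le hbdd d).trans (BondPercolation.pmax_le_of_percolates (by norm_num)
    (BondPercolation.percolates_of_hom φ hφ h))
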